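/- Fix $0<q<1$ and $a\in\mathbb R$, and write $[c]=\frac{q^{c}-q^{-c}}{q-q^{-1}}$, $\llbracket c\rrbracket=q^{c}-q^{-c}$, $\{c\}=q^{c}+q^{-c}$, $t=\llbracket a\rrbracket$. **The double.** Let $\mathcal A=\mathcal O_q(SU(2))$ be the Hopf $*$-algebra generated by $\alpha,\gamma$ with $\alpha^*\alpha+\gamma^*\gamma=1$, $\alpha\alpha^*+q^2\gamma\gamma^*=1$, $\gamma^*\gamma=\gamma\gamma^*$, $\alpha\gamma=q\gamma\alpha$, $\alpha\gamma^*=q\gamma^*\alpha$, whose fundamental unitary corepresentation is $U_{1/2}=\begin{pmatrix}\alpha&-q\gamma^*\\ \gamma&\alpha^*\end{pmatrix}$ (so $\Delta(\alpha)=\alpha\otimes\alpha-q\gamma^*\otimes\gamma$, $\Delta(\gamma)=\gamma\otimes\alpha+\alpha^*\otimes\gamma$). Let $\mathcal U=\mathrm{Hom}(\mathcal A,\mathbb C)$ with the convolution product, $\epsilon(h)=h(1)$, $S^{-1}(h)=h\circ S^{-1}$, $h^*(b)=\overline{h(S(b)^*)}$, $h\rhd b=b_{(1)}h(b_{(2)})$,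 $b\lhd h=h(b_{(1)})b_{(2)}$. Let $k,e,f\in\mathcal U$ be the functionals with $k(U_{1/2})=\mathrm{diag}(q,q^{-1})$, $e(U_{1/2})=\begin{pmatrix}0&q^{1/2}\\0&0\end{pmatrix}$, $f(U_{1/2})=\begin{pmatrix}0&0\\q^{-1/2}&0\end{pmatrix}$, $\Delta(k)=k\otimes k$, $\Delta(e)=e\otimes1+k\otimes e$, $\Delta(f)=1\otimes f+f\otimes k^{-1}$ (that is, $e(bc)=e(b)\epsilon(c)+k(b)e(c)$, etc.). The Drinfeld double $\mathcal A\bowtie\mathcal U$ is $\mathcal A\otimes\mathcal U$ with $hb=b_{(2)}\,h(b_{(3)}\,\cdot\,S^{-1}(b_{(1)}))$ for $h\in\mathcal U$, $b\in\mathcal A$, and $\epsilon(bh)=\epsilon(b)h(1)$. Put $$B_t=-q^{1/2}k^{-1}e+q^{1/2}f-\sqrt{-1}\,(q-q^{-1})^{-1}t\,k^{-1},\qquad I=\mathbb C[B_t],$$ $\mathcal O_q(S_t^2)=\{b\in\mathcal A: h\rhd b=\epsilon(h)b\ \ \forall h\in I\}$ (the Podleś sphere), $\mathcal O_q(S^2_t)_+=\mathcal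 O_q(S^2_t)\cap\ker\epsilon$, and $\mathcal I=\{y\in\mathcal U: y(\mathcal O_q(S_t^2)_+\mathcal A)=0\}$. Let $\mathcal I_c\subset\mathcal I$ be the span of all $y\in\mathcal I$ with $\sqrt{-1}B_ty=y\sqrt{-1}B_t=[a+m]y$ for some $m\in\mathbb Z$. Let $U_q(\mathfrak{sl}(2,\mathbb R)_t)$ and $\mathcal O_q(S_t^2)\bowtie\mathcal I_c$ be the unital subalgebras of $\mathcal A\bowtie\mathcal U$ generated by $\mathcal O_q(S_t^2)$ and $B_t$, respectively by $\mathcal O_q(S_t^2)$ and $\mathcal I_c$; here $B_t^*=-B_t$. **The modules.** Let $H_1$ be the spin $1$ corepresentation with orthonormal weight basis $\xi_1,\xi_0,\xi_{-1}$, realised in $H_{1/2}\otimes H_{1/2}$ by $\xi_{1}\mapsto \zeta_+\otimes\zeta_+$, $\xi_0\mapsto-(q+q^{-1})^{-1/2}(q^{1/2}\zeta_+\otimes\zeta_-+q^{-1/2}\zeta_-\otimes\zeta_+)$, $\xi_{-1}\mapsto\zeta_-\otimes\zeta_-$, and with matrix coefficients $u^1_{\xi,\eta}$ (conjugate-linear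 in $\xi$, linear in $\eta$). For $c\in\mathbb R$ put $$\xi^{(c)}=q^{1/2}\xi_1-\tfrac{\sqrt{-1}\llbracket c\rrbracket}{\sqrt{q+q^{-1}}}\xi_0+q^{-1/2}\xi_{-1},\quad \xi^{(c)}_{+}=-q^{-c-1/2}\xi_1+\sqrt{-1}\sqrt{q+q^{-1}}\,\xi_0+q^{c+1/2}\xi_{-1},\quad \xi^{(c)}_-=q^{c-1/2}\xi_1+\sqrt{-1}\sqrt{q+q^{-1}}\,\xi_0-q^{-c+1/2}\xi_{-1},$$ $$T_c^{\pm}=(u^1_{\xi_\pm^{(c)},\xi^{(a)}})^*,\qquad A_c=(u^1_{\xi^{(c)},\xi^{(a)}})^*-(q+q^{-1})^{-1}\llbracket c\rrbracket t ,$$ which are elements of $\mathcal O_q(S_t^2)$. For $\lambda,b\in\mathbb R$ let $\mathcal M_{\lambda,b}$ be the universal $U_q(\mathfrak{sl}(2,\mathbb R)_t)$-module with a cyclic vector $e_b$ such that $\sqrt{-1}B_te_b=[b]e_b$ and $A_be_b=\lambda e_b$, and let $\mathcal L_{\lambda,b}$ be its quotient by the kernel of the $*$-invariant sesquilinear form (the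 vectors orthogonal to everything for every invariant form). Put $\mathcal D_2^{\pm}=\mathcal L_{q+q^{-1},a\pm2}$, with cyclic vectors $e_{a\pm2}$. A $U_q(\mathfrak{sl}(2,\mathbb R)_t)$-module structure on $V$ *corresponds* to a representation $\pi$ of $\mathcal O_q(S_t^2)\bowtie\mathcal I_c$ on $V$ if both agree on $\mathcal O_q(S_t^2)$, $\pi(\sqrt{-1}B_ty)=\sqrt{-1}B_t\,\pi(y)$ for $y\in\mathcal I_c$, and $\pi(\mathcal I_c)V$ spans $V$. **Theorem.** The modules $\mathcal M_{q+q^{-1},a}$ and $\mathcal D_2^+\oplus\mathcal D_2^-$ correspond to representations $\tilde\pi$ and $\pi$ of $\mathcal O_q(S_t^2)\bowtie\mathcal I_c$, and there is an exact sequence of representations of $\mathcal O_q(S_t^2)\bowtie\mathcal I_c$, which does not split, $$0\to\mathcal D_2^+\oplus\mathcal D_2^-\xrightarrow{\ \phi\ }\mathcal M_{q+q^{-1},a}\xrightarrow{\ p\ }\mathbb C_\epsilon\to0,\qquad \phi(e_{a\pm2})=T_a^{\pm}e_a,\quad p(e_a)=1 .$$ There is an inner product on $\mathcal D_2^+\oplus\mathcal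 D_2^-$ for which $\pi$ is a $*$-representation, with $\langle e_{a+2},e_{a+2}\rangle=1$ and $\langle e_{a-2},e_{a-2}\rangle=\frac{\{a+2\}\{a-1\}}{\{a-2\}\{a+1\}}$. Regarding $\mathcal D_2^+\oplus\mathcal D_2^-$ as a subspace of $\mathcal M_{q+q^{-1},a}$ through $\phi$, put $$\tilde C(z)=\tilde\pi(z)e_a-\epsilon(z)e_a\quad(z\in\mathcal O_q(S_t^2)\bowtie\mathcal I_c),\qquad C(b)=\tilde\pi(b)e_a-\epsilon(b)e_a\quad(b\in\mathcal O_q(S_t^2));$$ in particular $\tilde C(bx)=\tilde\pi(bx)e_a-\epsilon(bx)e_a$ for $b\in\mathcal O_q(S_t^2)$, $x\in\mathcal I_c$. Both maps take values in $\mathcal D_2^+\oplus\mathcal D_2^-$. Then $\tilde C$ is a $(\pi,\epsilon)$-$1$-cocycle, i.e. $\tilde C(zw)=\pi(z)\tilde C(w)+\tilde C(z)\epsilon(w)$ for all $z,w\in\mathcal O_q(S_t^2)\bowtie\mathcal I_c$, and $C$ is a Yetter–Drinfeld $(\pi,\epsilon)$-$1$-cocycle, i.e. $C(bc)=\pi(b)C(c)+C(b)\epsilon(c)$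 for all $b,c\in\mathcal O_q(S_t^2)$ and $\pi(y)C(b)=C(b\lhd S^{-1}(y))$ for all $y\in\mathcal I_c$, $b\in\mathcal O_q(S_t^2)$. -/

import Mathlib

open scoped TensorProduct ComplexConjugate
open Coalgebra
noncomputable section
set_option linter.unusedSimpArgs false
set_option linter.unnecessarySeqFocus false
set_option linter.unusedSectionVars false

namespace SLqR

/-- The deformation parameter: a real number `0 < q < 1`. -/
abbrev QParam : Type := Set.Ioo (0 : ℝ) 1

/-- `q` as a complex number. -/
def qc (q : QParam) : ℂ := ((q : ℝ) : ℂ)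

lemma qc_ne (q : QParam) : qc q ≠ 0 := by
  have := q.2.1
  simp only [qc, ne_eq, Complex.ofReal_eq_zero]
  exact this.ne'

@[simp] lemma conj_qc (q : QParam) : conj (qc q) = qc q := Complex.conj_ofReal _

/-- Names for the four generators `α, α*, γ, γ*`. -/
inductive Gen : Type
  | al | als | ga | gas

/-- The generators of the free algebra. -/
abbrev gen (g : Gen) : FreeAlgebra ℂ Gen := FreeAlgebra.ι ℂ g

/-- The defining relations of `O_q(SU(2))`, together with their adjoints. -/
inductive Rel (q : QParam) : FreeAlgebra ℂ Gen → FreeAlgebra ℂ Gen → Prop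
  | als_al : Rel q (gen .als * gen .al + gen .gas * gen .ga) 1
  | al_als : Rel q (gen .al * gen .als + qc q ^ 2 • (gen .ga * gen .gas)) 1
  | gas_ga : Rel q (gen .gas * gen .ga) (gen .ga * gen .gas)
  | al_ga : Rel q (gen .al * gen .ga) (qc q • (gen .ga * gen .al))
  | al_gas : Rel q (gen .al * gen .gas) (qc q • (gen .gas * gen .al))
  | gas_als : Rel q (gen .gas * gen .als) (qc q • (gen .als * gen .gas))
  | ga_als : Rel q (gen .ga * gen .als) (qc q • (gen .als * gen .ga))

/-- The algebra `O_q(SU(2))`. -/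
def OqSU2 (q : QParam) : Type := RingQuot (Rel q)

namespace OqSU2
variable {q : QParam}

instance : Ring (OqSU2 q) := inferInstanceAs (Ring (RingQuot (Rel q)))
instance : Algebra ℂ (OqSU2 q) := inferInstanceAs (Algebra ℂ (RingQuot (Rel q)))

/-- The quotient map from the free algebra. -/
def mk (q : QParam) : FreeAlgebra ℂ Gen →ₐ[ℂ] OqSU2 q := RingQuot.mkAlgHom ℂ (Rel q)

/-- The generators `α, α*, γ, γ*` of `O_q(SU(2))`. -/
def x (q : QParam) (g : Gen) : OqSU2 q := mk q (gen g)

lemma mk_rel {a b : FreeAlgebra ℂ Gen} (h : Rel q a b) : mk q a = mk q b :=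
  RingQuot.mkAlgHom_rel ℂ h

lemma als_al : x q .als * x q .al = 1 - x q .ga * x q .gas := by
  have h := mk_rel (q := q) .als_al
  have h' := mk_rel (q := q) .gas_ga
  simp only [map_add, map_mul, map_one] at h h'
  simp only [x]; rw [← h', ← h]; abel

lemma al_als : x q .al * x q .als = 1 - qc q ^ 2 • (x q .ga * x q .gas) := by
  have h := mk_rel (q := q) .al_als
  simp only [map_add, map_mul, map_one, map_smul] at h
  simp only [x]; rw [← h]; abel

lemma gas_ga : x q .gas * x q .ga = x q .ga * x q .gas := by
  simpa [x] using mk_rel (q := q) .gas_ga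
lemma al_ga : x q .al * x q .ga = qc q • (x q .ga * x q .al) := by
  simpa [x] using mk_rel (q := q) .al_ga
lemma al_gas : x q .al * x q .gas = qc q • (x q .gas * x q .al) := by
  simpa [x] using mk_rel (q := q) .al_gas
lemma als_gas : x q .als * x q .gas = (qc q)⁻¹ • (x q .gas * x q .als) := by
  have h := mk_rel (q := q) .gas_als
  simp only [map_mul, map_smul] at h
  rw [eq_inv_smul_iff₀ (qc_ne q)]; exact h.symm
lemma als_ga : x q .als * x q .ga = (qc q)⁻¹ • (x q .ga * x q .als) := by
  have h := mk_rel (q := q) .ga_als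
  simp only [map_mul, map_smul] at h
  rw [eq_inv_smul_iff₀ (qc_ne q)]; exact h.symm

/-- The universal property of `O_q(SU(2))`. -/
def lift {R : Type*} [Ring R] [Algebra ℂ R] (f : Gen → R)
    (h1 : f .als * f .al + f .gas * f .ga = 1)
    (h2 : f .al * f .als + qc q ^ 2 • (f .ga * f .gas) = 1)
    (h3 : f .gas * f .ga = f .ga * f .gas)
    (h4 : f .al * f .ga = qc q • (f .ga * f .al))
    (h5 : f .al * f .gas = qc q • (f .gas * f .al))
    (h6 : f .gas * f .als = qc q • (f .als * f .gas))
    (h7 : f .ga * f .als = qc q • (f .als * f .ga)) : OqSU2 q →ₐ[ℂ] R :=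
  RingQuot.liftAlgHom ℂ ⟨FreeAlgebra.lift ℂ f, by
    intro a b h
    cases h <;> simpa⟩

@[simp] lemma lift_x {R : Type*} [Ring R] [Algebra ℂ R] (f : Gen → R) (h1 h2 h3 h4 h5 h6 h7)
    (g : Gen) : lift (q := q) f h1 h2 h3 h4 h5 h6 h7 (x q g) = f g := by
  exact (RingQuot.liftAlgHom_mkAlgHom_apply ℂ _ _ _).trans (FreeAlgebra.lift_ι_apply _ _)

@[elab_as_elim]
lemma induction {P : OqSU2 q → Prop} (hC : ∀ c : ℂ, P (algebraMap ℂ _ c)) (hx : ∀ g, P (x q g))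
    (hmul : ∀ a b, P a → P b → P (a * b)) (hadd : ∀ a b, P a → P b → P (a + b))
    (a : OqSU2 q) : P a := by
  obtain ⟨w, rfl⟩ := RingQuot.mkAlgHom_surjective ℂ (Rel q) a
  change P (mk q w)
  induction w using FreeAlgebra.induction with
  | grade0 r => simpa using hC r
  | grade1 g => exact hx g
  | mul a b ha hb => simpa using hmul _ _ ha hb
  | add a b ha hb => simpa using hadd _ _ ha hb

lemma algHom_ext {R : Type*} [Semiring R] [Algebra ℂ R] {f g : OqSU2 q →ₐ[ℂ] R}
    (h : ∀ i, f (x q i) = g (x q i)) : f = g := by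
  ext a
  induction a using induction with
  | hC c => simp
  | hx i => exact h i
  | hmul a b ha hb => simp [ha, hb]
  | hadd a b ha hb => simp [ha, hb]

/-- `Δ` on generators. -/
def comulGen (q : QParam) : Gen → OqSU2 q ⊗[ℂ] OqSU2 q
  | .al => x q .al ⊗ₜ x q .al - qc q • (x q .gas ⊗ₜ x q .ga)
  | .als => x q .als ⊗ₜ x q .als - qc q • (x q .ga ⊗ₜ x q .gas)
  | .ga => x q .ga ⊗ₜ x q .al + x q .als ⊗ₜ x q .ga
  | .gas => x q .gas ⊗ₜ x q .als + x q .al ⊗ₜ x q .gas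

lemma ga_mul (a : OqSU2 q) : x q .gas * (x q .ga * a) = x q .ga * (x q .gas * a) := by
  rw [← mul_assoc, gas_ga, mul_assoc]

/-- The coproduct as an algebra homomorphism. -/
def comulHom (q : QParam) : OqSU2 q →ₐ[ℂ] OqSU2 q ⊗[ℂ] OqSU2 q := by
  have hq := qc_ne q
  refine lift (comulGen q) ?_ ?_ ?_ ?_ ?_ ?_ ?_ <;>
  · simp only [comulGen, mul_add, add_mul, mul_sub, sub_mul, Algebra.TensorProduct.tmul_mul_tmul,
      smul_mul_assoc, mul_smul_comm, als_al, al_als, gas_ga, al_ga, al_gas, als_gas, als_ga,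
      TensorProduct.tmul_smul, ← TensorProduct.smul_tmul', TensorProduct.tmul_sub,
      TensorProduct.sub_tmul, smul_sub, smul_add, smul_smul, Algebra.TensorProduct.one_def]
    match_scalars <;> (try field_simp) <;> ring


@[simp] lemma comulHom_x (g : Gen) : comulHom q (x q g) = comulGen q g := by
  simp [comulHom]

/-- The counit on generators. -/
def counitGen : Gen → ℂ
  | .al => 1
  | .als => 1
  | .ga => 0
  | .gas => 0

/-- The counit as an algebra homomorphism. -/
def counitHom (q : QParam) : OqSU2 q →ₐ[ℂ] ℂ := by
  refine lift counitGen ?_ ?_ ?_ ?_ ?_ ?_ ?_ <;> simp [counitGen]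

@[simp] lemma counitHom_x (g : Gen) : counitHom q (x q g) = counitGen g := by
  simp [counitHom]

instance : Bialgebra ℂ (OqSU2 q) :=
  Bialgebra.ofAlgHom (comulHom q) (counitHom q)
    (by
      apply algHom_ext
      rintro (_ | _ | _ | _) <;>
      · simp [comulGen, TensorProduct.add_tmul, TensorProduct.tmul_add, TensorProduct.sub_tmul,
          TensorProduct.tmul_sub, ← TensorProduct.smul_tmul']
        try module)
    (by
      apply algHom_ext
      rintro (_ | _ | _ | _) <;> simp [comulGen, counitGen])
    (by
      apply algHom_ext
      rintro (_ | _ | _ | _) <;> simp [comulGen, counitGen])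

lemma comul_x (g : Gen) : comul (R := ℂ) (x q g) = comulGen q g := comulHom_x g
lemma counit_x (g : Gen) : counit (R := ℂ) (x q g) = counitGen g := counitHom_x g

/-- The antipode on generators. -/
def antipodeGen (q : QParam) : Gen → OqSU2 q
  | .al => x q .als
  | .als => x q .al
  | .ga => -(qc q • x q .ga)
  | .gas => -((qc q)⁻¹ • x q .gas)

/-- The inverse antipode on generators. -/
def antipodeInvGen (q : QParam) : Gen → OqSU2 q
  | .al => x q .als
  | .als => x q .al
  | .ga => -((qc q)⁻¹ • x q .ga)
  | .gas => -(qc q • x q .gas)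

open MulOpposite in
/-- The antipode as an anti-homomorphism. -/
def antipodeHom (q : QParam) : OqSU2 q →ₐ[ℂ] (OqSU2 q)ᵐᵒᵖ := by
  have hq := qc_ne q
  refine lift (fun g => op (antipodeGen q g)) ?_ ?_ ?_ ?_ ?_ ?_ ?_ <;>
  · simp only [antipodeGen, ← op_mul, ← op_add, ← op_smul, ← op_one, op_inj, neg_mul,
      mul_neg, neg_neg, smul_mul_assoc, mul_smul_comm, als_al, al_als, gas_ga, al_ga, al_gas,
      als_gas, als_ga, smul_smul, smul_neg]
    try (match_scalars <;> (try field_simp) <;> ring)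

open MulOpposite in
/-- The inverse `S⁻¹` of the antipode, as an anti-homomorphism. -/
def antipodeInvHom (q : QParam) : OqSU2 q →ₐ[ℂ] (OqSU2 q)ᵐᵒᵖ := by
  have hq := qc_ne q
  refine lift (fun g => op (antipodeInvGen q g)) ?_ ?_ ?_ ?_ ?_ ?_ ?_ <;>
  · simp only [antipodeInvGen, ← op_mul, ← op_add, ← op_smul, ← op_one, op_inj, neg_mul,
      mul_neg, neg_neg, smul_mul_assoc, mul_smul_comm, als_al, al_als, gas_ga, al_ga,
      al_gas, als_gas, als_ga, smul_smul, smul_neg]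
    try (match_scalars <;> (try field_simp) <;> ring)

/-- The antipode as a linear map. -/
def S (q : QParam) : OqSU2 q →ₗ[ℂ] OqSU2 q :=
  (MulOpposite.opLinearEquiv ℂ).symm.toLinearMap ∘ₗ (antipodeHom q).toLinearMap

/-- The inverse antipode as a linear map. -/
def Sinv (q : QParam) : OqSU2 q →ₗ[ℂ] OqSU2 q :=
  (MulOpposite.opLinearEquiv ℂ).symm.toLinearMap ∘ₗ (antipodeInvHom q).toLinearMap

lemma S_mul (a b : OqSU2 q) : S q (a * b) = S q b * S q a := by simp [S]
lemma S_one : S q 1 = 1 := by simp [S]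
lemma S_algebraMap (c : ℂ) : S q (algebraMap ℂ _ c) = algebraMap ℂ _ c := by simp [S]
lemma S_x (g : Gen) : S q (x q g) = antipodeGen q g := by simp [S, antipodeHom]
lemma Sinv_mul (a b : OqSU2 q) : Sinv q (a * b) = Sinv q b * Sinv q a := by simp [Sinv]
lemma Sinv_one : Sinv q 1 = 1 := by simp [Sinv]
lemma Sinv_algebraMap (c : ℂ) : Sinv q (algebraMap ℂ _ c) = algebraMap ℂ _ c := by simp [Sinv]
lemma Sinv_x (g : Gen) : Sinv q (x q g) = antipodeInvGen q g := by simp [Sinv, antipodeInvHom]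

lemma S_Sinv (a : OqSU2 q) : S q (Sinv q a) = a := by
  induction a using induction with
  | hC c => rw [Sinv_algebraMap, S_algebraMap]
  | hx g => cases g <;> simp [Sinv_x, S_x, antipodeInvGen, antipodeGen, smul_smul, qc_ne]
  | hmul a b ha hb => rw [Sinv_mul, S_mul, ha, hb]
  | hadd a b ha hb => rw [map_add, map_add, ha, hb]

lemma Sinv_S (a : OqSU2 q) : Sinv q (S q a) = a := by
  induction a using induction with
  | hC c => rw [S_algebraMap, Sinv_algebraMap]
  | hx g => cases g <;> simp [Sinv_x, S_x, antipodeInvGen, antipodeGen, smul_smul, qc_ne]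
  | hmul a b ha hb => rw [S_mul, Sinv_mul, ha, hb]
  | hadd a b ha hb => rw [map_add, map_add, ha, hb]

lemma S_mul_aux (X Y : OqSU2 q ⊗[ℂ] OqSU2 q) (c d : ℂ)
    (hX : LinearMap.mul' ℂ _ ((S q).rTensor _ X) = algebraMap ℂ _ c)
    (hY : LinearMap.mul' ℂ _ ((S q).rTensor _ Y) = algebraMap ℂ _ d) :
    LinearMap.mul' ℂ _ ((S q).rTensor _ (X * Y)) = algebraMap ℂ _ (c * d) := by
  have key : ∀ X Y : OqSU2 q ⊗[ℂ] OqSU2 q, LinearMap.mul' ℂ _ ((S q).rTensor _ (X * Y)) =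
      LinearMap.mul' ℂ _ ((S q).rTensor _
        ((1 ⊗ₜ LinearMap.mul' ℂ _ ((S q).rTensor _ X)) * Y)) := by
    intro X Y
    induction X with
    | zero => simp
    | add X X' h h' => simp [add_mul, h, h', TensorProduct.tmul_add]
    | tmul a b =>
      induction Y with
      | zero => simp
      | add X X' h h' => simp [mul_add, h, h']
      | tmul a' b' => simp [S_mul, mul_assoc]
  rw [key, hX, Algebra.algebraMap_eq_smul_one, TensorProduct.tmul_smul, smul_mul_assoc,
    ← Algebra.TensorProduct.one_def, one_mul, map_smul, map_smul, hY]
  simp [Algebra.smul_def]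

lemma S_mul_aux' (X Y : OqSU2 q ⊗[ℂ] OqSU2 q) (c d : ℂ)
    (hX : LinearMap.mul' ℂ _ ((S q).lTensor _ X) = algebraMap ℂ _ c)
    (hY : LinearMap.mul' ℂ _ ((S q).lTensor _ Y) = algebraMap ℂ _ d) :
    LinearMap.mul' ℂ _ ((S q).lTensor _ (X * Y)) = algebraMap ℂ _ (c * d) := by
  have key : ∀ X Y : OqSU2 q ⊗[ℂ] OqSU2 q, LinearMap.mul' ℂ _ ((S q).lTensor _ (X * Y)) =
      LinearMap.mul' ℂ _ ((S q).lTensor _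
        (X * (LinearMap.mul' ℂ _ ((S q).lTensor _ Y) ⊗ₜ 1))) := by
    intro X Y
    induction X with
    | zero => simp
    | add X X' h h' => simp [add_mul, h, h']
    | tmul a b =>
      induction Y with
      | zero => simp
      | add X X' h h' => simp [mul_add, h, h', TensorProduct.add_tmul]
      | tmul a' b' => simp [S_mul, mul_assoc]
  rw [key, hY, Algebra.algebraMap_eq_smul_one, ← TensorProduct.smul_tmul', mul_smul_comm,
    ← Algebra.TensorProduct.one_def, mul_one, map_smul, map_smul, hX]
  simp [Algebra.smul_def, mul_comm c d]

/-- `O_q(SU(2))` is a Hopf algebra. -/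
instance : HopfAlgebra ℂ (OqSU2 q) where
  antipode := S q
  mul_antipode_rTensor_comul := by
    have hq := qc_ne q
    ext a
    simp only [LinearMap.coe_comp, Function.comp_apply, Algebra.linearMap_apply]
    induction a using induction with
    | hC c => simp [S_one, Algebra.algebraMap_eq_smul_one, Algebra.TensorProduct.one_def]
    | hx g =>
      rw [comul_x, counit_x]
      cases g <;>
      · simp only [comulGen, counitGen, map_add, map_sub, map_smul, LinearMap.rTensor_tmul,
          LinearMap.mul'_apply, S_x, antipodeGen, neg_mul, smul_mul_assoc, als_al, al_als, gas_ga,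
          al_ga, al_gas, als_gas, als_ga, map_one, map_zero]
        match_scalars <;> (try field_simp) <;> ring
    | hmul a b ha hb =>
      rw [Bialgebra.comul_mul, Bialgebra.counit_mul]
      exact S_mul_aux _ _ _ _ ha hb
    | hadd a b ha hb => simp only [map_add, ha, hb]
  mul_antipode_lTensor_comul := by
    have hq := qc_ne q
    ext a
    simp only [LinearMap.coe_comp, Function.comp_apply, Algebra.linearMap_apply]
    induction a using induction with
    | hC c => simp [S_one, Algebra.algebraMap_eq_smul_one, Algebra.TensorProduct.one_def]
    | hx g =>
      rw [comul_x, counit_x]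
      cases g <;>
      · simp only [comulGen, counitGen, map_add, map_sub, map_smul, LinearMap.lTensor_tmul,
          LinearMap.mul'_apply, S_x, antipodeGen, mul_neg, mul_smul_comm, als_al, al_als, gas_ga,
          al_ga, al_gas, als_gas, als_ga, map_one, map_zero]
        match_scalars <;> (try field_simp) <;> ring
    | hmul a b ha hb =>
      rw [Bialgebra.comul_mul, Bialgebra.counit_mul]
      exact S_mul_aux' _ _ _ _ ha hb
    | hadd a b ha hb => simp only [map_add, ha, hb]

end OqSU2
end SLqR

namespace SLqR
namespace OqSU2
variable {q : QParam}

/-- The opposite ring, with complex scalars acting through complex conjugation. -/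
def ConjOp (R : Type*) : Type _ := Rᵐᵒᵖ

/-- The identity map onto the conjugate opposite ring. -/
def toC {R : Type*} (a : R) : ConjOp R := MulOpposite.op a

/-- The identity map from the conjugate opposite ring. -/
def ofC {R : Type*} (a : ConjOp R) : R := MulOpposite.unop a

instance (R : Type*) [Ring R] : Ring (ConjOp R) := inferInstanceAs (Ring Rᵐᵒᵖ)

section
variable {R : Type*} [Ring R] [Algebra ℂ R]
lemma toC_mul (a b : R) : toC a * toC b = toC (b * a) := rfl
lemma toC_add (a b : R) : toC a + toC b = toC (a + b) := rfl
lemma toC_one : (1 : ConjOp R) = toC 1 := rfl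
lemma ofC_mul (a b : ConjOp R) : ofC (a * b) = ofC b * ofC a := rfl
lemma ofC_add (a b : ConjOp R) : ofC (a + b) = ofC a + ofC b := rfl
lemma ofC_toC (a : R) : ofC (toC a) = a := rfl

instance : Algebra ℂ (ConjOp R) :=
  RingHom.toAlgebra' (S := ConjOp R)
    { toFun := fun c => toC (algebraMap ℂ R (conj c))
      map_one' := by simp [toC_one]
      map_zero' := by simp only [map_zero]; rfl
      map_mul' := fun a b => by rw [toC_mul, ← map_mul, ← map_mul, mul_comm]
      map_add' := fun a b => by rw [toC_add, ← map_add, ← map_add] }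
    (fun c y => by
      change toC (algebraMap ℂ R (conj c)) * toC (ofC y) = toC (ofC y) * toC _
      rw [toC_mul, toC_mul, Algebra.commutes])

lemma algebraMap_conjOp (c : ℂ) :
    algebraMap ℂ (ConjOp R) c = toC (algebraMap ℂ R (conj c)) := rfl

lemma smul_toC (c : ℂ) (a : R) : c • toC a = toC (conj c • a) := by
  rw [Algebra.smul_def, algebraMap_conjOp, toC_mul, Algebra.smul_def, Algebra.commutes]
end

/-- The involution on generators. -/
def starGen : Gen → Gen
  | .al => .als
  | .als => .al
  | .ga => .gas
  | .gas => .ga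

/-- The involution on generators, with values in the conjugate opposite ring. -/
def starGenC (q : QParam) (g : Gen) : ConjOp (OqSU2 q) := toC (x q (starGen g))

lemma starRel (q : QParam) :
    starGenC q .als * starGenC q .al + starGenC q .gas * starGenC q .ga = 1 ∧
    starGenC q .al * starGenC q .als + qc q ^ 2 • (starGenC q .ga * starGenC q .gas) = 1 ∧
    starGenC q .gas * starGenC q .ga = starGenC q .ga * starGenC q .gas ∧
    starGenC q .al * starGenC q .ga = qc q • (starGenC q .ga * starGenC q .al) ∧
    starGenC q .al * starGenC q .gas = qc q • (starGenC q .gas * starGenC q .al) ∧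
    starGenC q .gas * starGenC q .als = qc q • (starGenC q .als * starGenC q .gas) ∧
    starGenC q .ga * starGenC q .als = qc q • (starGenC q .als * starGenC q .ga) := by
  have hq := qc_ne q
  refine ⟨?_, ?_, ?_, ?_, ?_, ?_, ?_⟩ <;>
  · simp only [starGenC, starGen, toC_mul, smul_toC, toC_add, toC_one, map_pow, conj_qc, als_al,
      al_als, gas_ga, al_ga, al_gas, als_gas, als_ga, smul_smul]
    try
      congr 1
      try (match_scalars <;> (try field_simp) <;> ring)

/-- The involution as a conjugate-linear anti-homomorphism. -/
def starHom (q : QParam) : OqSU2 q →ₐ[ℂ] ConjOp (OqSU2 q) :=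
  lift (starGenC q) (starRel q).1 (starRel q).2.1 (starRel q).2.2.1 (starRel q).2.2.2.1
    (starRel q).2.2.2.2.1 (starRel q).2.2.2.2.2.1 (starRel q).2.2.2.2.2.2

instance : Star (OqSU2 q) := ⟨fun a => ofC (starHom q a)⟩

lemma star_def (a : OqSU2 q) : star a = ofC (starHom q a) := rfl

lemma star_x (g : Gen) : star (x q g) = x q (starGen g) := by
  rw [star_def, starHom, lift_x, starGenC, ofC_toC]

lemma conjStar_add (a b : OqSU2 q) : star (a + b) = star a + star b := by
  rw [star_def, map_add, ofC_add]; rfl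

lemma conjStar_mul (a b : OqSU2 q) : star (a * b) = star b * star a := by
  rw [star_def, map_mul, ofC_mul]; rfl

lemma star_algebraMap (c : ℂ) :
    star (algebraMap ℂ (OqSU2 q) c) = algebraMap ℂ (OqSU2 q) (conj c) := by
  rw [star_def, AlgHom.commutes, algebraMap_conjOp, ofC_toC]

/-- `O_q(SU(2))` is a `*`-algebra. -/
instance : StarRing (OqSU2 q) where
  star_involutive a := by
    induction a using induction with
    | hC c => rw [star_algebraMap, star_algebraMap, Complex.conj_conj]
    | hx g => rw [star_x, star_x]; cases g <;> rfl
    | hmul a b ha hb => rw [conjStar_mul, conjStar_mul, ha, hb]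
    | hadd a b ha hb => rw [conjStar_add, conjStar_add, ha, hb]
  star_mul := conjStar_mul
  star_add := conjStar_add

instance : StarModule ℂ (OqSU2 q) where
  star_smul c a := by
    rw [Algebra.smul_def, star_mul, star_algebraMap, Algebra.smul_def, Algebra.commutes]; rfl

/-- The coproduct is a `*`-homomorphism. -/
lemma comul_star (a : OqSU2 q) : comul (R := ℂ) (star a) = star (comul (R := ℂ) a) := by
  induction a using induction with
  | hC c =>
    rw [star_algebraMap, Bialgebra.comul_algebraMap, Bialgebra.comul_algebraMap,
      Algebra.algebraMap_eq_smul_one, Algebra.algebraMap_eq_smul_one, star_smul, star_one]; rfl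
  | hx g =>
    rw [star_x, comul_x, comul_x]
    cases g <;> simp [starGen, comulGen, star_x, star_sub, star_smul, TensorProduct.star_tmul,
      ← starRingEnd_apply]
  | hmul a b ha hb => rw [star_mul, Bialgebra.comul_mul, ha, hb, Bialgebra.comul_mul, star_mul]
  | hadd a b ha hb => simp only [star_add, map_add, ha, hb]

end OqSU2
end SLqR

namespace SLqR
open OqSU2
variable {q : QParam}

/-- The full linear dual `𝒰 = Hom(O_q(SU(2)), ℂ)`, with the convolution product
`(h k)(a) = h(a₍₁₎) k(a₍₂₎)`. -/
abbrev Dual (q : QParam) : Type := WithConv (OqSU2 q →ₗ[ℂ] ℂ)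

/-- `h ▷ a = a₍₁₎ h(a₍₂₎)`. -/
def lact (h : Dual q) : OqSU2 q →ₗ[ℂ] OqSU2 q :=
  (TensorProduct.rid ℂ (OqSU2 q)).toLinearMap ∘ₗ h.ofConv.lTensor (OqSU2 q) ∘ₗ comul

/-- `a ◁ h = h(a₍₁₎) a₍₂₎`. -/
def ract (h : Dual q) : OqSU2 q →ₗ[ℂ] OqSU2 q :=
  (TensorProduct.lid ℂ (OqSU2 q)).toLinearMap ∘ₗ h.ofConv.rTensor (OqSU2 q) ∘ₗ comul

/-- `S⁻¹(h)`, the functional `a ↦ h(S⁻¹(a))`. -/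
def dualSinv (h : Dual q) : Dual q := .toConv (h.ofConv ∘ₗ Sinv q)

/-- The involution of the dual: `h*(a)` is the complex conjugate of `h(S(a)*)`. -/
def dualStar (h : Dual q) : Dual q := .toConv
  { toFun := fun a => conj (h (star (S q a)))
    map_add' := fun a b => by simp
    map_smul' := fun c a => by simp [star_smul] }

lemma lact_apply_repr {ι : Type*} (h : Dual q) {a : OqSU2 q} (r : Coalgebra.Repr ℂ a ι) :
    lact h a = ∑ i ∈ r.index, h (r.right i) • r.left i := by
  simp [lact, ← r.eq]

lemma lact_add (h k : Dual q) (a : OqSU2 q) : lact (h + k) a = lact h a + lact k a := by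
  simp [lact, LinearMap.lTensor_add]

lemma lact_sub (h k : Dual q) (a : OqSU2 q) : lact (h - k) a = lact h a - lact k a := by
  simp [lact, LinearMap.lTensor_sub]

lemma lact_smul (c : ℂ) (h : Dual q) (a : OqSU2 q) : lact (c • h) a = c • lact h a := by
  simp [lact, LinearMap.lTensor_smul]

lemma lact_mul (h k : Dual q) (a : OqSU2 q) : lact (h * k) a = lact h (lact k a) := by
  have key : ∀ X : OqSU2 q ⊗[ℂ] OqSU2 q,
      TensorProduct.rid ℂ _ ((h * k).ofConv.lTensor (OqSU2 q) X) =
      TensorProduct.rid ℂ _ ((LinearMap.mul' ℂ ℂ ∘ₗ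
        TensorProduct.map h.ofConv k.ofConv).lTensor (OqSU2 q) (comul.lTensor (OqSU2 q) X)) := by
    intro X
    induction X with
    | zero => simp
    | add X Y hX hY => simp only [map_add, hX, hY]
    | tmul a b => rfl
  have key2 : ∀ X : OqSU2 q ⊗[ℂ] OqSU2 q,
      lact h (TensorProduct.rid ℂ _ (k.ofConv.lTensor (OqSU2 q) X)) =
      TensorProduct.rid ℂ _ ((LinearMap.mul' ℂ ℂ ∘ₗ
        TensorProduct.map h.ofConv k.ofConv).lTensor (OqSU2 q)
          (TensorProduct.assoc ℂ _ _ _ (comul.rTensor (OqSU2 q) X))) := by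
    intro X
    induction X with
    | zero => simp
    | add X Y hX hY => simp only [map_add, hX, hY]
    | tmul a b =>
      have : ∀ Y : OqSU2 q ⊗[ℂ] OqSU2 q,
        k b • TensorProduct.rid ℂ _ (h.ofConv.lTensor (OqSU2 q) Y) =
        TensorProduct.rid ℂ _ ((LinearMap.mul' ℂ ℂ ∘ₗ
          TensorProduct.map h.ofConv k.ofConv).lTensor (OqSU2 q)
          (TensorProduct.assoc ℂ _ _ _ (Y ⊗ₜ b))) := by
        intro Y
        induction Y with
        | zero => simp
        | add X Y hX hY => simp only [map_add, hX, hY, smul_add, TensorProduct.add_tmul]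
        | tmul c d => simp [smul_smul, mul_comm]
      simpa [lact] using this (comul a)
  have h1 := key (comul a)
  have h2 := key2 (comul a)
  rw [Coalgebra.coassoc_apply] at h2
  rw [show lact (h * k) a = _ from h1, show lact k a = _ from rfl]
  exact h2.symm

lemma lact_one (a : OqSU2 q) : lact (1 : Dual q) a = a := by
  have : (1 : Dual q).ofConv = counit := by ext; simp [LinearMap.convOne_def]
  simp [lact, this]

lemma lact_ract (h k : Dual q) (a : OqSU2 q) : lact h (ract k a) = ract k (lact h a) := by
  have key : ∀ X : OqSU2 q ⊗[ℂ] OqSU2 q,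
      ract k (TensorProduct.rid ℂ _ (h.ofConv.lTensor (OqSU2 q) X)) =
      TensorProduct.lid ℂ _ (k.ofConv.rTensor (OqSU2 q)
        ((TensorProduct.rid ℂ _).toLinearMap.lTensor (OqSU2 q)
          ((h.ofConv.lTensor (OqSU2 q)).lTensor (OqSU2 q)
            (TensorProduct.assoc ℂ _ _ _ (comul.rTensor (OqSU2 q) X))))) := by
    intro X
    induction X with
    | zero => simp
    | add X Y hX hY => simp only [map_add, hX, hY]
    | tmul a b =>
      have : ∀ Y : OqSU2 q ⊗[ℂ] OqSU2 q,
        h b • TensorProduct.lid ℂ _ (k.ofConv.rTensor (OqSU2 q) Y) =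
        TensorProduct.lid ℂ _ (k.ofConv.rTensor (OqSU2 q)
          ((TensorProduct.rid ℂ _).toLinearMap.lTensor (OqSU2 q)
          ((h.ofConv.lTensor (OqSU2 q)).lTensor (OqSU2 q)
            (TensorProduct.assoc ℂ _ _ _ (Y ⊗ₜ b))))) := by
        intro Y
        induction Y with
        | zero => simp
        | add X Y hX hY => simp only [map_add, hX, hY, smul_add, TensorProduct.add_tmul]
        | tmul c d => simp [smul_smul, mul_comm]
      simpa [ract] using this (comul a)
  have key2 : ∀ X : OqSU2 q ⊗[ℂ] OqSU2 q,
      lact h (TensorProduct.lid ℂ _ (k.ofConv.rTensor (OqSU2 q) X)) =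
      TensorProduct.lid ℂ _ (k.ofConv.rTensor (OqSU2 q)
        ((TensorProduct.rid ℂ _).toLinearMap.lTensor (OqSU2 q)
          ((h.ofConv.lTensor (OqSU2 q)).lTensor (OqSU2 q)
            (comul.lTensor (OqSU2 q) X)))) := by
    intro X
    induction X with
    | zero => simp
    | add X Y hX hY => simp only [map_add, hX, hY]
    | tmul a b => simp [lact]
  have h1 := key (comul a)
  rw [Coalgebra.coassoc_apply] at h1
  exact (key2 (comul a)).trans h1.symm

/-- If `conj (h (a*)) = k a` for all `a`, then `(h ▷ a*)* = k ▷ a`. -/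
lemma star_lact_star (h k : Dual q) (hk : ∀ a, conj (h (star a)) = k a) (a : OqSU2 q) :
    star (lact h (star a)) = lact k a := by
  have key : ∀ X : OqSU2 q ⊗[ℂ] OqSU2 q,
      star (TensorProduct.rid ℂ _ (h.ofConv.lTensor (OqSU2 q) (star X))) =
      TensorProduct.rid ℂ _ (k.ofConv.lTensor (OqSU2 q) X) := by
    intro X
    induction X with
    | zero => simp
    | add X Y hX hY => simp only [map_add, star_add, hX, hY]
    | tmul a b => simp [TensorProduct.star_tmul, star_smul, ← hk]
  have := key (comul a)
  rw [← comul_star] at this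
  exact this

/-! ### The functionals `k, k⁻¹, e, f` -/

/-- Values of the character `k` on generators. -/
def kGen (q : QParam) : Gen → ℂ
  | .al => qc q
  | .als => (qc q)⁻¹
  | .ga => 0
  | .gas => 0

/-- Values of the character `k⁻¹` on generators. -/
def kinvGen (q : QParam) : Gen → ℂ
  | .al => (qc q)⁻¹
  | .als => qc q
  | .ga => 0
  | .gas => 0

/-- `q^{1/2}`. -/
def sq (q : QParam) : ℂ := ((√(q : ℝ) : ℝ) : ℂ)

/-- Values of `e` on generators. -/
def eGen (q : QParam) : Gen → ℂ
  | .al => 0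
  | .als => 0
  | .ga => 0
  | .gas => -((qc q)⁻¹ * sq q)

/-- Values of `f` on generators. -/
def fGen (q : QParam) : Gen → ℂ
  | .al => 0
  | .als => 0
  | .ga => (sq q)⁻¹
  | .gas => 0

/-- The character `k`. -/
def kHom (q : QParam) : OqSU2 q →ₐ[ℂ] ℂ := by
  have := qc_ne q
  refine lift (kGen q) ?_ ?_ ?_ ?_ ?_ ?_ ?_ <;> simp [kGen, this]

/-- The character `k⁻¹`. -/
def kinvHom (q : QParam) : OqSU2 q →ₐ[ℂ] ℂ := by
  have := qc_ne q
  refine lift (kinvGen q) ?_ ?_ ?_ ?_ ?_ ?_ ?_ <;> simp [kinvGen, this]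

/-- The homomorphism `a ↦ [[k(a), e(a)], [0, ε(a)]]`, encoding `Δ(e) = e ⊗ 1 + k ⊗ e`. -/
def eHom (q : QParam) : OqSU2 q →ₐ[ℂ] Matrix (Fin 2) (Fin 2) ℂ := by
  have := qc_ne q
  refine lift (fun g => !![kGen q g, eGen q g; 0, counitGen g]) ?_ ?_ ?_ ?_ ?_ ?_ ?_ <;>
  · ext i j
    fin_cases i <;> fin_cases j <;> simp [kGen, eGen, counitGen, this] <;> (try field_simp)

/-- The homomorphism `a ↦ [[ε(a), f(a)], [0, k⁻¹(a)]]`, encoding `Δ(f) = 1 ⊗ f + f ⊗ k⁻¹`. -/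
def fHom (q : QParam) : OqSU2 q →ₐ[ℂ] Matrix (Fin 2) (Fin 2) ℂ := by
  have := qc_ne q
  refine lift (fun g => !![counitGen g, fGen q g; 0, kinvGen q g]) ?_ ?_ ?_ ?_ ?_ ?_ ?_ <;>
  · ext i j
    fin_cases i <;> fin_cases j <;> simp [kinvGen, fGen, counitGen, this] <;> (try field_simp)

/-- The generator `k` of `U_q(su(2))` as a functional on `O_q(SU(2))`. -/
def k (q : QParam) : Dual q := .toConv (kHom q).toLinearMap

/-- The generator `k⁻¹` of `U_q(su(2))` as a functional on `O_q(SU(2))`. -/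
def kinv (q : QParam) : Dual q := .toConv (kinvHom q).toLinearMap

/-- The generator `e` of `U_q(su(2))` as a functional on `O_q(SU(2))`. -/
def e (q : QParam) : Dual q := .toConv (Matrix.entryLinearMap ℂ ℂ 0 1 ∘ₗ (eHom q).toLinearMap)

/-- The generator `f` of `U_q(su(2))` as a functional on `O_q(SU(2))`. -/
def f (q : QParam) : Dual q := .toConv (Matrix.entryLinearMap ℂ ℂ 0 1 ∘ₗ (fHom q).toLinearMap)

end SLqR

namespace SLqR
open OqSU2
variable {q : QParam}

lemma sq_ne (q : QParam) : sq q ≠ 0 := by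
  have := q.2.1
  simp only [sq, ne_eq, Complex.ofReal_eq_zero]
  exact (Real.sqrt_pos.2 this).ne'

lemma sq_sq (q : QParam) : sq q ^ 2 = qc q := by
  have := q.2.1
  rw [sq, qc, ← Complex.ofReal_pow, Real.sq_sqrt this.le]

@[simp] lemma conj_sq (q : QParam) : conj (sq q) = sq q := Complex.conj_ofReal _

lemma kHom_x (g : Gen) : kHom q (x q g) = kGen q g := by simp [kHom]
lemma kinvHom_x (g : Gen) : kinvHom q (x q g) = kinvGen q g := by simp [kinvHom]
lemma eHom_x (g : Gen) : eHom q (x q g) = !![kGen q g, eGen q g; 0, counitGen g] := by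
  simp [eHom]
lemma fHom_x (g : Gen) : fHom q (x q g) = !![counitGen g, fGen q g; 0, kinvGen q g] := by
  simp [fHom]

lemma k_mul (a b : OqSU2 q) : k q (a * b) = k q a * k q b := map_mul (kHom q) a b
lemma kinv_mul (a b : OqSU2 q) : kinv q (a * b) = kinv q a * kinv q b := map_mul (kinvHom q) a b
lemma k_x (g : Gen) : k q (x q g) = kGen q g := kHom_x g
lemma kinv_x (g : Gen) : kinv q (x q g) = kinvGen q g := kinvHom_x g
lemma k_algebraMap (c : ℂ) : k q (algebraMap ℂ _ c) = c := (kHom q).commutes c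
lemma kinv_algebraMap (c : ℂ) : kinv q (algebraMap ℂ _ c) = c := (kinvHom q).commutes c

lemma eHom_apply (a : OqSU2 q) : eHom q a = !![k q a, e q a; 0, counit (R := ℂ) a] := by
  induction a using induction with
  | hC c =>
    have h : e q (algebraMap ℂ _ c) = 0 := by
      change (eHom q (algebraMap ℂ _ c)) 0 1 = 0
      rw [AlgHom.commutes]; simp [Matrix.algebraMap_matrix_apply]
    rw [h, k_algebraMap, Bialgebra.counit_algebraMap, AlgHom.commutes]
    ext i j; fin_cases i <;> fin_cases j <;> simp [Matrix.algebraMap_matrix_apply]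
  | hx g =>
    have h : eHom q (x q g) = !![kGen q g, eGen q g; 0, counitGen g] := eHom_x g
    have h' : e q (x q g) = eGen q g := by
      change (eHom q (x q g)) 0 1 = _
      rw [h]; rfl
    rw [h, h', k_x, counit_x]
  | hmul a b ha hb =>
    have h' : e q (a * b) = k q a * e q b + e q a * counit (R := ℂ) b := by
      change (eHom q (a * b)) 0 1 = _
      rw [map_mul, ha, hb]; simp
    rw [h', k_mul, Bialgebra.counit_mul, map_mul, ha, hb]
    ext i j; fin_cases i <;> fin_cases j <;> simp
  | hadd a b ha hb =>
    rw [map_add, ha, hb]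
    ext i j; fin_cases i <;> fin_cases j <;> simp

lemma e_x (g : Gen) : e q (x q g) = eGen q g := by
  change (eHom q (x q g)) 0 1 = _
  have h : eHom q (x q g) = !![kGen q g, eGen q g; 0, counitGen g] := eHom_x g
  rw [h]; rfl

lemma e_mul (a b : OqSU2 q) :
    e q (a * b) = k q a * e q b + e q a * (1 : Dual q) b := by
  change (eHom q (a * b)) 0 1 = _
  rw [map_mul, eHom_apply, eHom_apply]; simp

lemma e_algebraMap (c : ℂ) : e q (algebraMap ℂ _ c) = 0 := by
  change (eHom q (algebraMap ℂ _ c)) 0 1 = 0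
  rw [AlgHom.commutes]; simp [Matrix.algebraMap_matrix_apply]

lemma f_x (g : Gen) : f q (x q g) = fGen q g := by
  change (fHom q (x q g)) 0 1 = _
  have h : fHom q (x q g) = !![counitGen g, fGen q g; 0, kinvGen q g] := fHom_x g
  rw [h]; rfl

lemma f_algebraMap (c : ℂ) : f q (algebraMap ℂ _ c) = 0 := by
  change (fHom q (algebraMap ℂ _ c)) 0 1 = 0
  rw [AlgHom.commutes]; simp [Matrix.algebraMap_matrix_apply]

lemma fHom_apply (a : OqSU2 q) : fHom q a = !![counit (R := ℂ) a, f q a; 0, kinv q a] := by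
  induction a using induction with
  | hC c =>
    rw [f_algebraMap, kinv_algebraMap, Bialgebra.counit_algebraMap, AlgHom.commutes]
    ext i j; fin_cases i <;> fin_cases j <;> simp [Matrix.algebraMap_matrix_apply]
  | hx g =>
    have h : fHom q (x q g) = !![counitGen g, fGen q g; 0, kinvGen q g] :=
      fHom_x g
    rw [h, f_x, kinv_x, counit_x]
  | hmul a b ha hb =>
    have h' : f q (a * b) = counit (R := ℂ) a * f q b + f q a * kinv q b := by
      change (fHom q (a * b)) 0 1 = _
      rw [map_mul, ha, hb]; simp
    rw [h', kinv_mul, Bialgebra.counit_mul, map_mul, ha, hb]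
    ext i j; fin_cases i <;> fin_cases j <;> simp
  | hadd a b ha hb =>
    rw [map_add, ha, hb]
    ext i j; fin_cases i <;> fin_cases j <;> simp

lemma f_mul (a b : OqSU2 q) :
    f q (a * b) = (1 : Dual q) a * f q b + f q a * kinv q b := by
  change (fHom q (a * b)) 0 1 = _
  rw [map_mul, fHom_apply, fHom_apply]; simp

lemma lact_prod (h h₁ h₂ h₃ h₄ : Dual q)
    (H : ∀ a b, h (a * b) = h₁ a * h₂ b + h₃ a * h₄ b) (a b : OqSU2 q) :
    lact h (a * b) = lact h₁ a * lact h₂ b + lact h₃ a * lact h₄ b := by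
  have key : ∀ X Y : OqSU2 q ⊗[ℂ] OqSU2 q,
      TensorProduct.rid ℂ _ (h.ofConv.lTensor (OqSU2 q) (X * Y)) =
      TensorProduct.rid ℂ _ (h₁.ofConv.lTensor (OqSU2 q) X) *
        TensorProduct.rid ℂ _ (h₂.ofConv.lTensor (OqSU2 q) Y) +
      TensorProduct.rid ℂ _ (h₃.ofConv.lTensor (OqSU2 q) X) *
        TensorProduct.rid ℂ _ (h₄.ofConv.lTensor (OqSU2 q) Y) := by
    intro X Y
    induction X with
    | zero => simp
    | add X X' hX hX' => simp only [map_add, add_mul, hX, hX']; abel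
    | tmul a b =>
      induction Y with
      | zero => simp
      | add X X' hX hX' => simp only [map_add, mul_add, hX, hX']; abel
      | tmul c d => simp [H, add_smul, smul_smul, mul_comm]
  have := key (comul a) (comul b)
  rw [← Bialgebra.comul_mul] at this
  exact this

lemma lact_k_mul (a b : OqSU2 q) : lact (k q) (a * b) = lact (k q) a * lact (k q) b := by
  have := lact_prod (k q) (k q) (k q) 0 0 (fun a b => by simp [k_mul]) a b
  simpa [lact] using this

lemma lact_kinv_mul (a b : OqSU2 q) :
    lact (kinv q) (a * b) = lact (kinv q) a * lact (kinv q) b := by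
  have := lact_prod (kinv q) (kinv q) (kinv q) 0 0 (fun a b => by simp [kinv_mul]) a b
  simpa [lact] using this

lemma lact_e_mul (a b : OqSU2 q) :
    lact (e q) (a * b) = lact (k q) a * lact (e q) b + lact (e q) a * b := by
  simpa [lact_one] using lact_prod (e q) (k q) (e q) (e q) 1 e_mul a b

lemma lact_f_mul (a b : OqSU2 q) :
    lact (f q) (a * b) = a * lact (f q) b + lact (f q) a * lact (kinv q) b := by
  simpa [lact_one] using lact_prod (f q) 1 (f q) (f q) (kinv q) f_mul a b

lemma lact_kinv_k (a : OqSU2 q) : lact (kinv q) (lact (k q) a) = a := by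
  induction a using induction with
  | hC c => simp [lact, Bialgebra.comul_algebraMap, Algebra.algebraMap_eq_smul_one,
      Algebra.TensorProduct.one_def, show k q 1 = 1 from map_one (kHom q),
      show kinv q 1 = 1 from map_one (kinvHom q)]
  | hx g =>
    cases g <;> simp [lact, comul_x, comulGen, k_x, kinv_x, kGen, kinvGen, smul_smul, qc_ne]
  | hmul a b ha hb => rw [lact_k_mul, lact_kinv_mul, ha, hb]
  | hadd a b ha hb => rw [map_add, map_add, ha, hb]

lemma lact_k_kinv (a : OqSU2 q) : lact (k q) (lact (kinv q) a) = a := by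
  induction a using induction with
  | hC c => simp [lact, Bialgebra.comul_algebraMap, Algebra.algebraMap_eq_smul_one,
      Algebra.TensorProduct.one_def, show k q 1 = 1 from map_one (kHom q),
      show kinv q 1 = 1 from map_one (kinvHom q)]
  | hx g =>
    cases g <;> simp [lact, comul_x, comulGen, k_x, kinv_x, kGen, kinvGen, smul_smul, qc_ne]
  | hmul a b ha hb => rw [lact_kinv_mul, lact_k_mul, ha, hb]
  | hadd a b ha hb => rw [map_add, map_add, ha, hb]

/-! ### The coideal generated by `B_t` and the Podleś sphere -/

/-- `[c] = (q^c - q^{-c}) / (q - q⁻¹)`. -/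
def qn (q : QParam) (c : ℝ) : ℝ := ((q : ℝ) ^ c - (q : ℝ) ^ (-c)) / ((q : ℝ) - (q : ℝ)⁻¹)

/-- `⟦c⟧ = q^c - q^{-c}`. -/
def qd (q : QParam) (c : ℝ) : ℝ := (q : ℝ) ^ c - (q : ℝ) ^ (-c)

/-- `{c} = q^c + q^{-c}`. -/
def qs (q : QParam) (c : ℝ) : ℝ := (q : ℝ) ^ c + (q : ℝ) ^ (-c)

/-- `B_t = -q^{1/2} k⁻¹ e + q^{1/2} f - i (q - q⁻¹)⁻¹ t k⁻¹`, where `t = ⟦a⟧`. -/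
def Bt (q : QParam) (a : ℝ) : Dual q :=
  -(sq q • (kinv q * e q)) + sq q • f q
    - (Complex.I * (qc q - (qc q)⁻¹)⁻¹ * (qd q a : ℂ)) • kinv q

/-- `i B_t`. -/
def iBt (q : QParam) (a : ℝ) : Dual q := Complex.I • Bt q a

/-- `I = ℂ[B_t]`. -/
def coidealI (q : QParam) (a : ℝ) : Subalgebra ℂ (Dual q) := Algebra.adjoin ℂ {Bt q a}

/-- The scalar `i (q - q⁻¹)⁻¹ t = -ε(B_t)`. -/
def kap (q : QParam) (a : ℝ) : ℂ := Complex.I * (qc q - (qc q)⁻¹)⁻¹ * (qd q a : ℂ)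

lemma conj_kap (a : ℝ) : conj (kap q a) = -kap q a := by
  simp [kap, map_mul, map_inv₀, map_sub]

lemma mul_apply_one (h h' : Dual q) : (h * h') 1 = h 1 * h' 1 := by
  simp [Algebra.TensorProduct.one_def]

lemma Bt_one (a : ℝ) : Bt q a 1 = -kap q a := by
  have h1 : e q 1 = 0 := by simpa using e_algebraMap (q := q) 1
  have h2 : f q 1 = 0 := by simpa using f_algebraMap (q := q) 1
  have h3 : kinv q 1 = 1 := map_one (kinvHom q)
  have : Bt q a 1 = -(sq q * ((kinv q * e q) 1)) + sq q * f q 1 - kap q a * kinv q 1 := rfl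
  rw [this, mul_apply_one, h1, h2, h3]; simp

lemma lact_Bt (a : ℝ) (b : OqSU2 q) : lact (Bt q a) b =
    -(sq q • lact (kinv q) (lact (e q) b)) + sq q • lact (f q) b - kap q a • lact (kinv q) b := by
  rw [Bt, lact_sub, lact_add, ← neg_smul, lact_smul, lact_smul, lact_smul, lact_mul, neg_smul, kap]

lemma lact_Bt_mul (a : ℝ) (b c : OqSU2 q) : lact (Bt q a) (b * c) =
    (lact (Bt q a) b + kap q a • b) * lact (kinv q) c + b * lact (Bt q a) c := by
  simp only [lact_Bt, lact_e_mul, lact_f_mul, lact_kinv_mul, map_add, lact_kinv_k, mul_add,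
    add_mul, mul_sub, sub_mul, smul_add, neg_mul, mul_neg, smul_mul_assoc, mul_smul_comm]
  module
end SLqR

namespace SLqR
open OqSU2
variable {q : QParam}

lemma conj_k_star (a : OqSU2 q) : conj (kinv q (star a)) = k q a := by
  induction a using induction with
  | hC c => rw [star_algebraMap, kinv_algebraMap, k_algebraMap, Complex.conj_conj]
  | hx g => rw [star_x, kinv_x, k_x]; cases g <;> simp [starGen, kinvGen, kGen]
  | hmul a b ha hb => rw [star_mul, kinv_mul, k_mul, map_mul, ha, hb, mul_comm]
  | hadd a b ha hb => simp only [star_add, map_add, ha, hb]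

lemma conj_k_star' (a : OqSU2 q) : conj (k q (star a)) = kinv q a := by
  rw [← conj_k_star, star_star, Complex.conj_conj]

lemma dual_one_apply (a : OqSU2 q) : (1 : Dual q) a = counit (R := ℂ) a := by
  simp [LinearMap.convOne_def]

lemma conj_counit_star (a : OqSU2 q) :
    conj (counit (R := ℂ) (star a)) = counit (R := ℂ) a := by
  induction a using induction with
  | hC c => rw [star_algebraMap, Bialgebra.counit_algebraMap, Bialgebra.counit_algebraMap,
      Complex.conj_conj]
  | hx g => rw [star_x, counit_x, counit_x]; cases g <;> simp [starGen, counitGen]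
  | hmul a b ha hb =>
    rw [star_mul, Bialgebra.counit_mul, Bialgebra.counit_mul, map_mul, ha, hb, mul_comm]
  | hadd a b ha hb => simp only [star_add, map_add, ha, hb]

lemma conj_e_star (a : OqSU2 q) : conj (e q (star a)) = (-f q) a := by
  have hs : (qc q)⁻¹ * sq q = (sq q)⁻¹ := by
    rw [← sq_sq]; field_simp [sq_ne q]
  change _ = -(f q a)
  induction a using induction with
  | hC c => rw [star_algebraMap, e_algebraMap, f_algebraMap]; simp
  | hx g => rw [star_x, e_x, f_x]; cases g <;> simp [starGen, eGen, fGen, hs]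
  | hmul a b ha hb =>
    rw [star_mul, e_mul, f_mul, map_add, map_mul, map_mul, ha, hb, conj_k_star', dual_one_apply,
      dual_one_apply, conj_counit_star]
    ring
  | hadd a b ha hb => simp only [star_add, map_add, ha, hb]; ring

lemma conj_f_star (a : OqSU2 q) : conj (f q (star a)) = (-e q) a := by
  have h := conj_e_star (q := q) (star a)
  rw [star_star] at h
  change _ = -(f q (star a)) at h
  change _ = -(e q a)
  rw [← neg_eq_iff_eq_neg] at h
  rw [← h, map_neg, Complex.conj_conj]

lemma lact_neg (h : Dual q) (a : OqSU2 q) : lact (-h) a = -lact h a := by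
  rw [← neg_one_smul ℂ, lact_smul, neg_one_smul]

lemma dual_add_apply (h h' : Dual q) (b : OqSU2 q) : (h + h') b = h b + h' b := rfl

lemma invariant_iff {a : ℝ} {b : OqSU2 q} :
    (∀ h ∈ coidealI q a, lact h b = h 1 • b) ↔ lact (Bt q a) b = -(kap q a • b) := by
  constructor
  · intro h
    rw [h _ (Algebra.subset_adjoin rfl), Bt_one, neg_smul]
  · intro hb h hh
    induction hh using Algebra.adjoin_induction with
    | mem h hh => rw [Set.mem_singleton_iff.1 hh, hb, Bt_one, neg_smul]
    | algebraMap c =>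
      rw [Algebra.algebraMap_eq_smul_one, lact_smul, lact_one]
      congr 1
      change c = c * (1 : Dual q) 1
      rw [dual_one_apply, Bialgebra.counit_one, mul_one]
    | add h h' _ _ e e' => rw [lact_add, e, e', dual_add_apply, add_smul]
    | mul h h' _ _ e e' => rw [lact_mul, e', map_smul, e, mul_apply_one, smul_smul, mul_comm]

/-- The Podleś sphere `O_q(S_t²)`: the elements `b` with `h ▷ b = ε(h) b` for all `h ∈ I`. -/
def podles (q : QParam) (a : ℝ) : Subalgebra ℂ (OqSU2 q) where
  carrier := {b | ∀ h ∈ coidealI q a, lact h b = h 1 • b}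
  add_mem' hb hc h hh := by rw [map_add, hb h hh, hc h hh, smul_add]
  mul_mem' {b c} hb hc := by
    refine invariant_iff.2 ?_
    have hb := invariant_iff.1 hb
    have hc := invariant_iff.1 hc
    rw [lact_Bt_mul, hb, hc]
    simp
  algebraMap_mem' c h _ := by
    rw [Algebra.algebraMap_eq_smul_one, map_smul, smul_comm]
    simp [lact, Algebra.TensorProduct.one_def]

lemma mem_podles_iff {a : ℝ} {b : OqSU2 q} :
    b ∈ podles q a ↔ lact (Bt q a) b = -(kap q a • b) := invariant_iff

lemma star_mem_podles {a : ℝ} {b : OqSU2 q} (hb : b ∈ podles q a) : star b ∈ podles q a := by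
  rw [mem_podles_iff] at *
  have h1 : lact (e q) (star b) = star (-lact (f q) b) := by
    rw [← lact_neg, ← star_lact_star _ _ conj_e_star, star_star]
  have h2 : lact (f q) (star b) = star (-lact (e q) b) := by
    rw [← lact_neg, ← star_lact_star _ _ conj_f_star, star_star]
  have h3 (c : OqSU2 q) : lact (kinv q) (star c) = star (lact (k q) c) := by
    rw [← star_lact_star _ _ conj_k_star, star_star]
  have h4 := congrArg (lact (k q)) hb
  rw [lact_Bt] at h4 ⊢
  simp only [map_sub, map_add, map_neg, map_smul, lact_k_kinv] at h4
  rw [h1, h2, h3, h3, map_neg]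
  have hc : (starRingEnd ℂ) (kap q a) = -kap q a := conj_kap a
  have h5 : star (-(sq q • lact (e q) b) + sq q • lact (k q) (lact (f q) b) - kap q a • b) =
      star (-(kap q a • lact (k q) b)) := by rw [h4]
  simp only [star_sub, star_add, star_neg, star_smul, ← starRingEnd_apply, conj_sq, hc] at h5 ⊢
  rw [← sub_eq_zero] at h5 ⊢
  rw [← h5]
  module

lemma ract_mem_podles {a : ℝ} {b : OqSU2 q} (h : Dual q) (hb : b ∈ podles q a) :
    ract h b ∈ podles q a := by
  intro x hx
  rw [lact_ract, hb x hx, map_smul]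

/-! ### The elements `T_c^±, A_c` -/

/-- The matrix `[[α, -qγ*], [γ, α*]]` of the fundamental corepresentation. -/
def uMat (q : QParam) : Fin 2 → Fin 2 → OqSU2 q :=
  ![![x q .al, -(qc q • x q .gas)], ![x q .ga, x q .als]]

/-- `√(q + q⁻¹)`. -/
def sd (q : QParam) : ℂ := ((√((q : ℝ) + (q : ℝ)⁻¹) : ℝ) : ℂ)

/-- The isometric embedding of the spin `1` corepresentation `H_1`, with orthonormal weight basis
`ξ_1, ξ_0, ξ_{-1}`, into the tensor square of the fundamental corepresentation. -/
def emb (q : QParam) (v : Fin 3 → ℂ) : Fin 2 → Fin 2 → ℂ :=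
  ![![v 0, -(sq q / sd q * v 1)], ![-((sq q * sd q)⁻¹ * v 1), v 2]]

/-- The spin `1` matrix coefficient `u¹_{v,w}`, conjugate-linear in `v` and linear in `w`. -/
def u1 (q : QParam) (v w : Fin 3 → ℂ) : OqSU2 q :=
  ∑ i, ∑ k, ∑ j, ∑ l, (conj (emb q v i k) * emb q w j l) • (uMat q i j * uMat q k l)

/-- The vector `ξ^{(⟦c⟧;1)}`. -/
def xi (q : QParam) (c : ℝ) : Fin 3 → ℂ :=
  ![sq q, -(Complex.I * (qd q c : ℂ) / sd q), (sq q)⁻¹]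

/-- `q^c` as a complex number. -/
def qpow (q : QParam) (c : ℝ) : ℂ := (((q : ℝ) ^ c : ℝ) : ℂ)

/-- The vector `ξ_+^{(⟦c⟧;1)}`. -/
def xiPlus (q : QParam) (c : ℝ) : Fin 3 → ℂ :=
  ![-qpow q (-c - 1 / 2), Complex.I * sd q, qpow q (c + 1 / 2)]

/-- The vector `ξ_-^{(⟦c⟧;1)}`. -/
def xiMinus (q : QParam) (c : ℝ) : Fin 3 → ℂ :=
  ![qpow q (c - 1 / 2), Complex.I * sd q, -qpow q (-c + 1 / 2)]

lemma lact_kinv_u (i j : Fin 2) :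
    lact (kinv q) (uMat q i j) = (![(qc q)⁻¹, qc q] : Fin 2 → ℂ) j • uMat q i j := by
  fin_cases i <;> fin_cases j <;>
    simp [uMat, lact, comul_x, comulGen, kinv_x, kinvGen, smul_smul, mul_comm]

lemma lact_e_u (i j : Fin 2) :
    lact (e q) (uMat q i j) = (![0, sq q] : Fin 2 → ℂ) j • uMat q i 0 := by
  have := qc_ne q
  fin_cases i <;> fin_cases j <;>
    simp [uMat, lact, comul_x, comulGen, e_x, eGen, smul_smul, mul_comm, this]

lemma lact_f_u (i j : Fin 2) :
    lact (f q) (uMat q i j) = (![(sq q)⁻¹, 0] : Fin 2 → ℂ) j • uMat q i 1 := by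
  fin_cases i <;> fin_cases j <;>
    simp [uMat, lact, comul_x, comulGen, f_x, fGen, smul_smul, mul_comm]

lemma lact_Bt_u0 (a : ℝ) (i : Fin 2) : lact (Bt q a) (uMat q i 0) =
    uMat q i 1 - (kap q a * (qc q)⁻¹) • uMat q i 0 := by
  have := sq_ne q
  rw [lact_Bt, lact_e_u, lact_f_u, lact_kinv_u]
  simp [smul_smul, this]

lemma lact_Bt_u1 (a : ℝ) (i : Fin 2) : lact (Bt q a) (uMat q i 1) =
    -uMat q i 0 - (kap q a * qc q) • uMat q i 1 := by
  have h := qc_ne q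
  have : sq q * sq q * (qc q)⁻¹ = 1 := by rw [← pow_two, sq_sq, mul_inv_cancel₀ h]
  rw [lact_Bt, lact_e_u, lact_f_u]
  simp [smul_smul, lact_kinv_u, ← mul_assoc, this]

lemma sd_sq : sd q ^ 2 = qc q + (qc q)⁻¹ := by
  have := q.2.1
  rw [sd, qc, ← Complex.ofReal_pow, Real.sq_sqrt (by positivity)]; simp

lemma sd_ne : sd q ≠ 0 := by
  have := q.2.1
  simp only [sd, ne_eq, Complex.ofReal_eq_zero]
  exact (Real.sqrt_pos.2 (by positivity)).ne'

lemma q_sub_ne : qc q - (qc q)⁻¹ ≠ 0 := by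
  have h0 := q.2.1
  have h1 := q.2.2
  have : (q : ℝ) - (q : ℝ)⁻¹ ≠ 0 := by
    have : 1 < (q : ℝ)⁻¹ := (one_lt_inv₀ h0).2 h1
    linarith
  rw [qc]; exact_mod_cast this

lemma emb_xi (a : ℝ) : emb q (xi q a) =
    ![![sq q, sq q * (kap q a * ((sq q ^ 4 - 1) / (sq q ^ 4 + 1)))],
      ![(sq q)⁻¹ * (kap q a * ((sq q ^ 4 - 1) / (sq q ^ 4 + 1))), (sq q)⁻¹]] ∧
    sq q ^ 4 + 1 ≠ 0 := by
  have h1 := sq_ne q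
  have h2 := sd_ne (q := q)
  have h3 := q_sub_ne (q := q)
  have hr := sd_sq (q := q)
  have hd : Complex.I * (qd q a : ℂ) = kap q a * (qc q - (qc q)⁻¹) := by
    rw [kap]
    calc _ = Complex.I * (qd q a : ℂ) * ((qc q - (qc q)⁻¹)⁻¹ * (qc q - (qc q)⁻¹)) := by
          rw [inv_mul_cancel₀ h3, mul_one]
      _ = _ := by ring
  rw [← sq_sq] at hr hd
  have h4 : sq q ^ 4 + 1 = sd q ^ 2 * sq q ^ 2 := by rw [hr]; field_simp
  have h5 : sq q ^ 4 + 1 ≠ 0 := by rw [h4]; positivity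
  refine ⟨?_, h5⟩
  ext i j
  fin_cases i <;> fin_cases j <;>
    simp only [emb, xi, hd, h4, Matrix.cons_val_zero, Matrix.cons_val_one, Matrix.cons_val,
      Fin.zero_eta, Fin.mk_one, Fin.isValue] <;>
    field_simp

lemma u1_mem (a : ℝ) (v : Fin 3 → ℂ) : u1 q v (xi q a) ∈ podles q a := by
  have h1 := sq_ne q
  obtain ⟨hx, h5⟩ := emb_xi (q := q) a
  rw [mem_podles_iff]
  have key (i k : Fin 2) : lact (Bt q a) (∑ j, ∑ l, emb q (xi q a) j l • (uMat q i j * uMat q k l))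
      = -(kap q a • ∑ j, ∑ l, emb q (xi q a) j l • (uMat q i j * uMat q k l)) := by
    simp only [Fin.sum_univ_two, map_add, map_smul, lact_Bt_mul, lact_Bt_u0, lact_Bt_u1,
      lact_kinv_u]
    simp only [hx, Matrix.cons_val_zero, Matrix.cons_val_one, add_mul, mul_add, sub_mul, mul_sub,
      neg_mul, mul_neg, smul_mul_assoc, mul_smul_comm, smul_smul, smul_add, smul_sub, smul_neg,
      Matrix.cons_val, ← sq_sq]
    match_scalars <;> field_simp <;> ring
  have e1 : u1 q v (xi q a) = ∑ i, ∑ k, conj (emb q v i k) •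
      ∑ j, ∑ l, emb q (xi q a) j l • (uMat q i j * uMat q k l) := by
    simp only [u1, Finset.smul_sum, smul_smul]
  rw [e1]
  rw [map_sum, Finset.smul_sum, ← Finset.sum_neg_distrib]
  refine Finset.sum_congr rfl fun i _ => ?_
  rw [map_sum, Finset.smul_sum, ← Finset.sum_neg_distrib]
  refine Finset.sum_congr rfl fun k _ => ?_
  rw [map_smul, key, smul_neg, smul_comm]

/-- `T_c^+ = (u¹_{ξ_+^{(c)}, ξ^{(t)}})*`. -/
def Tplus (q : QParam) (a c : ℝ) : podles q a :=
  ⟨star (u1 q (xiPlus q c) (xi q a)), star_mem_podles (u1_mem a _)⟩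

/-- `T_c^- = (u¹_{ξ_-^{(c)}, ξ^{(t)}})*`. -/
def Tminus (q : QParam) (a c : ℝ) : podles q a :=
  ⟨star (u1 q (xiMinus q c) (xi q a)), star_mem_podles (u1_mem a _)⟩

/-- `A_c = (u¹_{ξ^{(c)}, ξ^{(t)}})* - (q + q⁻¹)⁻¹ ⟦c⟧ t`. -/
def Ac (q : QParam) (a c : ℝ) : podles q a :=
  ⟨star (u1 q (xi q c) (xi q a)), star_mem_podles (u1_mem a _)⟩ -
    algebraMap ℂ _ ((((q : ℝ) + (q : ℝ)⁻¹)⁻¹ * qd q c * qd q a : ℝ) : ℂ)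

instance (a : ℝ) : Star (podles q a) := ⟨fun b => ⟨star b.1, star_mem_podles b.2⟩⟩

/-! ### The stabilizer duals -/

/-- `𝓘 = Hom(A / B₊A, ℂ)`, where `B₊ = B ∩ ker ε`. -/
def stabDual (q : QParam) (a : ℝ) : Submodule ℂ (Dual q) where
  carrier := {y | ∀ b ∈ podles q a, counit (R := ℂ) b = 0 → ∀ c, y (b * c) = 0}
  add_mem' hy hz b hb h0 c := by rw [dual_add_apply, hy b hb h0, hz b hb h0, add_zero]
  zero_mem' _ _ _ _ := rfl
  smul_mem' r y hy b hb h0 c := by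
    change r * y (b * c) = 0
    rw [hy b hb h0, mul_zero]

/-- `y` is a matrix unit for the one-dimensional summand of weight `[a + m]`. -/
def IsWeight (q : QParam) (a : ℝ) (m : ℤ) (y : Dual q) : Prop :=
  iBt q a * y = (qn q (a + m) : ℂ) • y ∧ y * iBt q a = (qn q (a + m) : ℂ) • y

/-- `𝓘_c = ⊕_m B(ℂ_m) ⊂ 𝓘`, where `i B_t` acts on `ℂ_m` as `[a + m]`. -/
def Ic (q : QParam) (a : ℝ) : Submodule ℂ (Dual q) :=
  Submodule.span ℂ {y | y ∈ stabDual q a ∧ ∃ m : ℤ, IsWeight q a m y}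

lemma iBt_mul_mem {a : ℝ} {y : Dual q} (hy : y ∈ Ic q a) : iBt q a * y ∈ Ic q a := by
  induction hy using Submodule.span_induction with
  | mem y hy =>
    obtain ⟨h1, m, h2⟩ := hy
    rw [h2.1]
    exact Submodule.smul_mem _ _ (Submodule.subset_span ⟨h1, m, h2⟩)
  | zero => rw [mul_zero]; exact zero_mem _
  | add y z _ _ h h' => rw [mul_add]; exact add_mem h h'
  | smul c y _ h => rw [mul_smul_comm]; exact Submodule.smul_mem _ _ h

end SLqR

namespace SLqR
open OqSU2
variable {q : QParam}

/-! ### The Drinfeld double `A ⋈ 𝒰` -/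

section sweedler
variable {V W : Type*} [AddCommMonoid V] [Module ℂ V] [AddCommMonoid W] [Module ℂ W]

/-- `sw β a = β(a₍₁₎, a₍₂₎)`. -/
def sw : (OqSU2 q →ₗ[ℂ] OqSU2 q →ₗ[ℂ] V) →ₗ[ℂ] OqSU2 q →ₗ[ℂ] V :=
  LinearMap.lcomp ℂ V comul ∘ₗ (TensorProduct.lift.equiv (RingHom.id ℂ) _ _ _).toLinearMap

lemma sw_apply (β : OqSU2 q →ₗ[ℂ] OqSU2 q →ₗ[ℂ] V) (a : OqSU2 q) :
    sw β a = TensorProduct.lift β (comul a) := rfl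

lemma sw_repr {ι : Type*} (β : OqSU2 q →ₗ[ℂ] OqSU2 q →ₗ[ℂ] V) {a : OqSU2 q}
    (r : Coalgebra.Repr ℂ a ι) : sw β a = ∑ i ∈ r.index, β (r.left i) (r.right i) := by
  rw [sw_apply, ← r.eq, map_sum]; simp

lemma map_sw (g : V →ₗ[ℂ] W) (β : OqSU2 q →ₗ[ℂ] OqSU2 q →ₗ[ℂ] V) (a : OqSU2 q) :
    g (sw β a) = sw (β.compr₂ g) a := by
  rw [sw_repr _ (ℛ ℂ a), sw_repr _ (ℛ ℂ a), map_sum]; rfl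

lemma sw_coassoc (φ : OqSU2 q →ₗ[ℂ] OqSU2 q →ₗ[ℂ] OqSU2 q →ₗ[ℂ] V) :
    sw (sw φ) = sw (sw ∘ₗ φ) := by
  ext a
  have h1 : ∀ X : OqSU2 q ⊗[ℂ] OqSU2 q, TensorProduct.lift (sw φ) X =
      TensorProduct.lift (TensorProduct.uncurry (RingHom.id ℂ) _ _ _ ∘ₗ φ)
        (TensorProduct.assoc ℂ _ _ _ (comul.rTensor (OqSU2 q) X)) := by
    intro X
    induction X with
    | zero => simp
    | add X Y hX hY => simp only [map_add, hX, hY]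
    | tmul a b =>
      have : ∀ Y : OqSU2 q ⊗[ℂ] OqSU2 q, TensorProduct.lift φ Y b =
        TensorProduct.lift (TensorProduct.uncurry (RingHom.id ℂ) _ _ _ ∘ₗ φ)
        (TensorProduct.assoc ℂ _ _ _ (Y ⊗ₜ b)) := by
        intro Y
        induction Y with
        | zero => simp
        | add X Y hX hY => simp only [map_add, hX, hY, TensorProduct.add_tmul, LinearMap.add_apply]
        | tmul c d => simp
      simpa [sw_apply] using this (comul a)
  have h2 : ∀ X : OqSU2 q ⊗[ℂ] OqSU2 q, TensorProduct.lift (sw ∘ₗ φ) X =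
      TensorProduct.lift (TensorProduct.uncurry (RingHom.id ℂ) _ _ _ ∘ₗ φ)
        (comul.lTensor (OqSU2 q) X) := by
    intro X
    induction X with
    | zero => simp
    | add X Y hX hY => simp only [map_add, hX, hY]
    | tmul a b => simp [sw_apply]; rfl
  rw [sw_apply, sw_apply, h1, h2, Coalgebra.coassoc_apply]

end sweedler

/-- `twist h y x` is the functional `z ↦ h(x z S⁻¹(y))`. -/
def twist (h : Dual q) : OqSU2 q →ₗ[ℂ] OqSU2 q →ₗ[ℂ] Dual q :=
  LinearMap.mk₂ ℂ
    (fun y x => .toConv (h.ofConv ∘ₗ LinearMap.mulLeft ℂ x ∘ₗ LinearMap.mulRight ℂ (Sinv q y)))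
    (fun y y' x => by ext; simp [mul_add])
    (fun c y x => by ext; simp)
    (fun y x x' => by ext; simp [add_mul])
    (fun c y x => by ext; simp)

lemma twist_apply (h : Dual q) (y x z : OqSU2 q) : twist h y x z = h (x * (z * Sinv q y)) := rfl

/-- `legs h y b x = b ⊗ (twist h y x)`. -/
def legs (h : Dual q) : OqSU2 q →ₗ[ℂ] OqSU2 q →ₗ[ℂ] OqSU2 q →ₗ[ℂ] OqSU2 q ⊗[ℂ] Dual q where
  toFun y := LinearMap.mk₂ ℂ (fun b x => b ⊗ₜ twist h y x)
    (fun _ _ _ => by simp [TensorProduct.add_tmul])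
    (fun _ _ _ => by simp [TensorProduct.smul_tmul'])
    (fun _ _ _ => by simp [TensorProduct.tmul_add])
    (fun _ _ _ => by simp)
  map_add' _ _ := by ext; simp [TensorProduct.tmul_add]; rfl
  map_smul' _ _ := by ext; simp; rfl

@[simp] lemma legs_apply (h : Dual q) (y b x : OqSU2 q) :
    legs h y b x = b ⊗ₜ twist h y x := rfl

/-- The exchange rule: `exch h a = a₍₂₎ ⊗ h(a₍₃₎ · S⁻¹(a₍₁₎))`, the product `h a` in the double. -/
def exch (h : Dual q) : OqSU2 q →ₗ[ℂ] OqSU2 q ⊗[ℂ] Dual q := sw (sw ∘ₗ legs h)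

/-- Left multiplication by `a ∈ A` on the double. -/
def lamA (a : OqSU2 q) : OqSU2 q ⊗[ℂ] Dual q →ₗ[ℂ] OqSU2 q ⊗[ℂ] Dual q :=
  (LinearMap.mulLeft ℂ a).rTensor _

/-- Right multiplication by `k ∈ 𝒰` on the double. -/
def rmulU (k : Dual q) : OqSU2 q ⊗[ℂ] Dual q →ₗ[ℂ] OqSU2 q ⊗[ℂ] Dual q :=
  (LinearMap.mulRight ℂ k).lTensor _

@[simp] lemma lamA_tmul (a b : OqSU2 q) (h : Dual q) : lamA a (b ⊗ₜ h) = (a * b) ⊗ₜ h := rfl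
@[simp] lemma rmulU_tmul (b : OqSU2 q) (k h : Dual q) : rmulU k (b ⊗ₜ h) = b ⊗ₜ (h * k) := rfl

/-- Left multiplication by `h ∈ 𝒰` on the double. -/
def lamU (h : Dual q) : OqSU2 q ⊗[ℂ] Dual q →ₗ[ℂ] OqSU2 q ⊗[ℂ] Dual q :=
  TensorProduct.lift (LinearMap.mk₂ ℂ (fun a k => rmulU k (exch h a))
    (fun _ _ _ => by simp) (fun _ _ _ => by simp)
    (fun a k k' => by
      have : rmulU (k + k') = rmulU k + rmulU k' := by ext; simp [mul_add, TensorProduct.tmul_add]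
      rw [this]; rfl)
    (fun c a k => by
      have : rmulU (c • k) = c • rmulU k := by ext; simp
      rw [this]; rfl))

@[simp] lemma lamU_tmul (a : OqSU2 q) (h k : Dual q) : lamU h (a ⊗ₜ k) = rmulU k (exch h a) := rfl

lemma twist_add (h k : Dual q) : twist (h + k) = twist h + twist k := by ext; rfl
lemma twist_smul (c : ℂ) (k : Dual q) : twist (c • k) = c • twist k := by ext; rfl

lemma exch_add (h k : Dual q) : exch (h + k) = exch h + exch k := by
  have : legs (h + k) = legs h + legs k := by
    ext : 3; simp [twist_add, TensorProduct.tmul_add]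
  rw [exch, this, LinearMap.comp_add, map_add]; rfl

lemma exch_smul (c : ℂ) (k : Dual q) : exch (c • k) = c • exch k := by
  have : legs (c • k) = c • legs k := by
    ext : 3; simp [twist_smul]
  rw [exch, this, LinearMap.comp_smul, map_smul]; rfl

/-- Left multiplication on the double: `(a ⊗ h) · w = a (h w)`. -/
def lmulD : OqSU2 q ⊗[ℂ] Dual q →ₗ[ℂ] OqSU2 q ⊗[ℂ] Dual q →ₗ[ℂ] OqSU2 q ⊗[ℂ] Dual q :=
  TensorProduct.lift (LinearMap.mk₂ ℂ (fun a h => lamA a ∘ₗ lamU h)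
    (fun a b h => by
      have : lamA (a + b) = lamA a + lamA b := by ext; simp [add_mul, TensorProduct.add_tmul]
      rw [this]; rfl)
    (fun c a h => by
      have : lamA (c • a) = c • lamA a := by ext; simp [TensorProduct.smul_tmul']
      rw [this]; rfl)
    (fun a h k => by ext; simp [exch_add])
    (fun c a h => by ext; simp [exch_smul]))

lemma lmulD_tmul (a : OqSU2 q) (h : Dual q) (w) : lmulD (a ⊗ₜ h) w = lamA a (lamU h w) := rfl

/-- The linear map `y ⊗ (b ⊗ x) ↦ b ⊗ (twist h y x)`. -/
def tri (h : Dual q) : OqSU2 q ⊗[ℂ] (OqSU2 q ⊗[ℂ] OqSU2 q) →ₗ[ℂ] OqSU2 q ⊗[ℂ] Dual q :=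
  TensorProduct.lift (TensorProduct.uncurry (RingHom.id ℂ) _ _ _ ∘ₗ legs h)

/-- `Δ²` as an algebra homomorphism. -/
def comul2 (q : QParam) : OqSU2 q →ₐ[ℂ] OqSU2 q ⊗[ℂ] (OqSU2 q ⊗[ℂ] OqSU2 q) :=
  (Algebra.TensorProduct.map (AlgHom.id ℂ _) (Bialgebra.comulAlgHom ℂ (OqSU2 q))).comp
    (Bialgebra.comulAlgHom ℂ (OqSU2 q))

@[simp] lemma tri_tmul (h : Dual q) (y b x : OqSU2 q) :
    tri h (y ⊗ₜ (b ⊗ₜ x)) = b ⊗ₜ twist h y x := rfl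

lemma exch_eq (h : Dual q) (a : OqSU2 q) : exch h a = tri h (comul2 q a) := by
  have h2 : ∀ X : OqSU2 q ⊗[ℂ] OqSU2 q, TensorProduct.lift (sw ∘ₗ legs h) X =
      tri h (Algebra.TensorProduct.map (AlgHom.id ℂ _) (Bialgebra.comulAlgHom ℂ (OqSU2 q)) X) := by
    intro X
    induction X with
    | zero => simp
    | add X Y hX hY => simp only [map_add, hX, hY]
    | tmul a b => simp [sw_apply]; rfl
  exact h2 _

lemma twist_twist (h : Dual q) (y x y' x' : OqSU2 q) :
    twist (twist h y x) y' x' = twist h (y * y') (x * x') := by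
  ext z
  simp [twist_apply, Sinv_mul, mul_assoc]

lemma tri_mul (h : Dual q) (y b x : OqSU2 q) (Y) :
    tri h ((y ⊗ₜ (b ⊗ₜ x)) * Y) = lamA b (tri (twist h y x) Y) := by
  induction Y with
  | zero => simp
  | add X Y hX hY => simp only [mul_add, map_add, hX, hY]
  | tmul y' Y =>
    induction Y with
    | zero => simp
    | add X Y hX hY => simp only [mul_add, map_add, hX, hY, TensorProduct.tmul_add]
    | tmul b' x' => simp [twist_twist]

lemma rmulU_lamA (k : Dual q) (b : OqSU2 q) (w) : rmulU k (lamA b w) = lamA b (rmulU k w) := by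
  induction w with
  | zero => simp
  | add X Y hX hY => simp only [map_add, hX, hY]
  | tmul a b => simp

lemma lmulD_tri (h : Dual q) (X) (a : OqSU2 q) (k : Dual q) :
    lmulD (tri h X) (a ⊗ₜ k) = rmulU k (tri h (X * comul2 q a)) := by
  induction X with
  | zero => simp
  | add X Y hX hY => simp only [map_add, add_mul, hX, hY, LinearMap.add_apply]
  | tmul y X =>
    induction X with
    | zero => simp
    | add X Y hX hY =>
      simp only [map_add, add_mul, hX, hY, LinearMap.add_apply, TensorProduct.tmul_add]
    | tmul b x => rw [tri_mul, tri_tmul, lmulD_tmul, lamU_tmul, exch_eq, rmulU_lamA]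

lemma lamU_lamA (h : Dual q) (b : OqSU2 q) (w) : lamU h (lamA b w) = lmulD (exch h b) w := by
  induction w with
  | zero => simp
  | add X Y hX hY => simp only [map_add, hX, hY]
  | tmul a k =>
    rw [exch_eq, lmulD_tri, lamA_tmul, lamU_tmul, exch_eq, map_mul]

lemma comul_Sinv (y : OqSU2 q) : comul (R := ℂ) (Sinv q y) =
    TensorProduct.map (Sinv q) (Sinv q) (TensorProduct.comm ℂ _ _ (comul (R := ℂ) y)) := by
  have hq := qc_ne q
  have hm (X Y : OqSU2 q ⊗[ℂ] OqSU2 q) :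
      TensorProduct.map (Sinv q) (Sinv q) (TensorProduct.comm ℂ _ _ (X * Y)) =
      TensorProduct.map (Sinv q) (Sinv q) (TensorProduct.comm ℂ _ _ Y) *
        TensorProduct.map (Sinv q) (Sinv q) (TensorProduct.comm ℂ _ _ X) := by
    induction X with
    | zero => simp
    | add X X' h h' => simp only [add_mul, mul_add, map_add, h, h']
    | tmul a b =>
      induction Y with
      | zero => simp
      | add X X' h h' => simp only [add_mul, mul_add, map_add, h, h']
      | tmul c d => simp [Sinv_mul]
  induction y using induction with
  | hC c =>
    rw [Sinv_algebraMap]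
    simp [Algebra.algebraMap_eq_smul_one, Algebra.TensorProduct.one_def, Sinv_one]
  | hx g =>
    rw [Sinv_x, comul_x]
    cases g <;>
    · simp only [comulGen, antipodeInvGen, map_neg, map_smul, map_add, map_sub, comul_x,
        TensorProduct.comm_tmul, TensorProduct.map_tmul, Sinv_x, TensorProduct.neg_tmul,
        TensorProduct.tmul_neg, TensorProduct.tmul_smul, ← TensorProduct.smul_tmul']
      match_scalars <;> field_simp
  | hmul a b ha hb => rw [Sinv_mul, Bialgebra.comul_mul, ha, hb, Bialgebra.comul_mul, hm]
  | hadd a b ha hb => simp only [map_add, ha, hb]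

end SLqR

namespace SLqR
open OqSU2
variable {q : QParam}

/-- `five h k p r b s t = b ⊗ (twist h r s * twist k p t)`. -/
def five (h k : Dual q) : OqSU2 q →ₗ[ℂ] OqSU2 q →ₗ[ℂ] OqSU2 q →ₗ[ℂ] OqSU2 q →ₗ[ℂ] OqSU2 q →ₗ[ℂ]
    OqSU2 q ⊗[ℂ] Dual q where
  toFun p :=
    { toFun := fun r =>
      { toFun := fun b => LinearMap.mk₂ ℂ (fun s t => b ⊗ₜ (twist h r s * twist k p t))
          (fun _ _ _ => by simp [add_mul, TensorProduct.tmul_add])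
          (fun _ _ _ => by simp)
          (fun _ _ _ => by simp [mul_add, TensorProduct.tmul_add])
          (fun _ _ _ => by simp)
        map_add' := fun _ _ => by ext : 2; simp [TensorProduct.add_tmul]
        map_smul' := fun _ _ => by ext : 2; simp [TensorProduct.smul_tmul'] }
      map_add' := fun _ _ => by ext : 3; simp [add_mul, TensorProduct.tmul_add]
      map_smul' := fun _ _ => by ext : 3; simp [smul_mul_assoc] }
  map_add' _ _ := by ext : 4; simp [mul_add, TensorProduct.tmul_add]
  map_smul' _ _ := by ext : 4; simp [mul_smul_comm]

@[simp] lemma five_apply (h k : Dual q) (p r b s t : OqSU2 q) :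
    five h k p r b s t = b ⊗ₜ (twist h r s * twist k p t) := rfl

lemma dual_mul_apply {ι : Type*} (h k : Dual q) {z : OqSU2 q} (r : Coalgebra.Repr ℂ z ι) :
    (h * k) z = ∑ i ∈ r.index, h (r.left i) * k (r.right i) := by
  change LinearMap.mul' ℂ ℂ (TensorProduct.map h.ofConv k.ofConv (comul z)) = _
  rw [← r.eq]; simp

lemma dual_sum_apply {ι : Type*} (s : Finset ι) (f : ι → Dual q) (z : OqSU2 q) :
    (∑ i ∈ s, f i) z = ∑ i ∈ s, f i z := by
  classical
  induction s using Finset.induction_on with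
  | empty => rfl
  | insert i s hi ih => rw [Finset.sum_insert hi, Finset.sum_insert hi, dual_add_apply, ih]

lemma twist_mul {ι κ : Type*} (h k : Dual q) {y x : OqSU2 q} (ry : Coalgebra.Repr ℂ y ι)
    (rx : Coalgebra.Repr ℂ x κ) : twist (h * k) y x = ∑ i ∈ ry.index, ∑ j ∈ rx.index,
      twist h (ry.right i) (rx.left j) * twist k (ry.left i) (rx.right j) := by
  ext z
  simp only [dual_sum_apply]
  simp only [dual_mul_apply _ _ (ℛ ℂ z), twist_apply]
  change LinearMap.mul' ℂ ℂ (TensorProduct.map h.ofConv k.ofConv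
    (comul (x * (z * Sinv q y)))) = _
  rw [Bialgebra.comul_mul, Bialgebra.comul_mul, comul_Sinv, ← ry.eq, ← rx.eq, ← (ℛ ℂ z).eq]
  simp only [map_sum, TensorProduct.comm_tmul, TensorProduct.map_tmul, Finset.sum_mul,
    Finset.mul_sum, Algebra.TensorProduct.tmul_mul_tmul, LinearMap.mul'_apply]
  refine Finset.sum_congr rfl fun i _ => ?_
  rw [Finset.sum_comm]

lemma legs_mul (h k : Dual q) :
    legs (h * k) = sw (q := q) (V := OqSU2 q →ₗ[ℂ] OqSU2 q →ₗ[ℂ] OqSU2 q ⊗[ℂ] Dual q) ((five h k).compr₂ (LinearMap.compRight ℂ (sw (q := q) (V := OqSU2 q ⊗[ℂ] Dual q)))) := by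
  ext y b x
  rw [legs_apply, twist_mul h k (ℛ ℂ y) (ℛ ℂ x), sw_repr _ (ℛ ℂ y)]
  simp only [LinearMap.sum_apply, LinearMap.compr₂_apply, LinearMap.compRight_apply,
    LinearMap.comp_apply, sw_repr _ (ℛ ℂ x), five_apply, TensorProduct.tmul_sum]

lemma exch_mul (h k : Dual q) (a : OqSU2 q) : exch (h * k) a = lamU h (exch k a) := by
  have e1 : sw ∘ₗ legs (h * k) =
      sw (q := q) (V := OqSU2 q →ₗ[ℂ] OqSU2 q ⊗[ℂ] Dual q) ((five h k).compr₂ (sw (q := q) ∘ₗ LinearMap.compRight ℂ (sw (q := q) (V := OqSU2 q ⊗[ℂ] Dual q)))) := by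
    ext : 1
    rw [legs_mul, LinearMap.comp_apply, map_sw]; rfl
  have e2 (p : OqSU2 q) : sw (q := q) (V := OqSU2 q ⊗[ℂ] Dual q) ((five h k).compr₂ (sw (q := q) ∘ₗ LinearMap.compRight ℂ (sw (q := q) (V := OqSU2 q ⊗[ℂ] Dual q))) p) =
      sw (q := q) (V := OqSU2 q ⊗[ℂ] Dual q) (sw (q := q) (V := OqSU2 q →ₗ[ℂ] OqSU2 q ⊗[ℂ] Dual q) (sw (q := q) ∘ₗ five h k p)) := by
    rw [sw_coassoc]
    congr 1
    ext : 1
    exact (sw_coassoc _).symm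
  have e3 (p : OqSU2 q) : sw (q := q) (V := OqSU2 q →ₗ[ℂ] OqSU2 q ⊗[ℂ] Dual q) (sw (q := q) ∘ₗ five h k p) = (legs k p).compr₂ (lamU h) := by
    ext b t : 2
    rw [LinearMap.compr₂_apply, legs_apply, lamU_tmul, exch, map_sw]
    have := map_sw (LinearMap.applyₗ t) (sw ∘ₗ five h k p) b
    refine this.trans ?_
    congr 2
    ext r c : 2
    simp only [LinearMap.compr₂_apply, LinearMap.comp_apply]
    rw [map_sw, map_sw]
    congr 2
  rw [exch, e1, sw_coassoc, exch, map_sw]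
  congr 2
  ext p : 1
  rw [LinearMap.comp_apply, e2, e3]
  ext : 1
  exact (map_sw _ _ _).symm

lemma lamU_mul (h k : Dual q) (w) : lamU (h * k) w = lamU h (lamU k w) := by
  have hr (l : Dual q) (v) : lamU h (rmulU l v) = rmulU l (lamU h v) := by
    induction v with
    | zero => simp
    | add X Y hX hY => simp only [map_add, hX, hY]
    | tmul a k =>
      have (X : OqSU2 q ⊗[ℂ] Dual q) : rmulU (k * l) X = rmulU l (rmulU k X) := by
        induction X with
        | zero => simp
        | add X Y hX hY => simp only [map_add, hX, hY]
        | tmul a k => simp [mul_assoc]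
      simp [this]
  induction w with
  | zero => simp
  | add X Y hX hY => simp only [map_add, hX, hY]
  | tmul a l => rw [lamU_tmul, lamU_tmul, exch_mul, hr]
end SLqR

namespace SLqR
open OqSU2
variable {q : QParam}

lemma lmulD_assoc (z w : OqSU2 q ⊗[ℂ] Dual q) (v) :
    lmulD (lmulD z w) v = lmulD z (lmulD w v) := by
  have hA (b : OqSU2 q) (X : OqSU2 q ⊗[ℂ] Dual q) (v) :
      lmulD (lamA b X) v = lamA b (lmulD X v) := by
    induction X with
    | zero => simp
    | add X Y hX hY => simp only [map_add, hX, hY, LinearMap.add_apply]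
    | tmul a k =>
      rw [lamA_tmul, lmulD_tmul, lmulD_tmul]
      induction lamU k v with
      | zero => simp
      | add X Y hX hY => simp only [map_add, hX, hY]
      | tmul c l => simp [mul_assoc]
  have hU (k : Dual q) (X : OqSU2 q ⊗[ℂ] Dual q) (v) :
      lmulD (rmulU k X) v = lmulD X (lamU k v) := by
    induction X with
    | zero => simp
    | add X Y hX hY => simp only [map_add, hX, hY, LinearMap.add_apply]
    | tmul a l => rw [rmulU_tmul, lmulD_tmul, lmulD_tmul, lamU_mul]
  induction z with
  | zero => simp
  | add X Y hX hY => simp only [map_add, hX, hY, LinearMap.add_apply]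
  | tmul b h =>
    induction w with
    | zero => simp
    | add X Y hX hY => simp only [map_add, hX, hY, LinearMap.add_apply]
    | tmul c k =>
      rw [lmulD_tmul, hA, lamU_tmul, hU, lmulD_tmul, lmulD_tmul, ← lamU_lamA]

lemma exch_one (h : Dual q) : exch h 1 = 1 ⊗ₜ h := by
  have : twist h 1 1 = h := by ext z; simp [twist_apply, Sinv_one]
  rw [exch, sw_apply]
  simp [sw_apply, this, Algebra.TensorProduct.one_def]

lemma counit_Sinv (a : OqSU2 q) : counit (R := ℂ) (Sinv q a) = counit (R := ℂ) a := by
  induction a using induction with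
  | hC c => rw [Sinv_algebraMap]
  | hx g => rw [Sinv_x]; cases g <;> simp [antipodeInvGen, counit_x, counitGen]
  | hmul a b ha hb => rw [Sinv_mul, Bialgebra.counit_mul, ha, hb, Bialgebra.counit_mul, mul_comm]
  | hadd a b ha hb => simp only [map_add, ha, hb]

lemma one_exch (a : OqSU2 q) : exch 1 a = a ⊗ₜ 1 := by
  have h1 (y x : OqSU2 q) : twist (1 : Dual q) y x =
      (counit (R := ℂ) y * counit (R := ℂ) x) • (1 : Dual q) := by
    ext z
    change _ = _ * (1 : Dual q) z
    rw [twist_apply, dual_one_apply, dual_one_apply, Bialgebra.counit_mul, Bialgebra.counit_mul,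
      counit_Sinv]
    ring
  have h2 (y b : OqSU2 q) : sw (legs 1 y) b = counit (R := ℂ) y • (b ⊗ₜ (1 : Dual q)) := by
    have h3 := congrArg (TensorProduct.rid ℂ _) (sum_tmul_counit_eq (ℛ ℂ b))
    simp only [map_sum, TensorProduct.rid_tmul, one_smul] at h3
    nth_rewrite 2 [← h3]
    rw [sw_repr _ (ℛ ℂ b), TensorProduct.sum_tmul, Finset.smul_sum]
    refine Finset.sum_congr rfl fun i _ => ?_
    rw [legs_apply, h1, mul_smul, TensorProduct.tmul_smul, TensorProduct.tmul_smul,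
      TensorProduct.smul_tmul']
  have h4 := sum_counit_smul (ℛ ℂ a)
  nth_rewrite 2 [← h4]
  rw [exch, sw_repr _ (ℛ ℂ a), TensorProduct.sum_tmul]
  refine Finset.sum_congr rfl fun i _ => ?_
  rw [LinearMap.comp_apply, h2, TensorProduct.smul_tmul']

lemma one_lmulD (w : OqSU2 q ⊗[ℂ] Dual q) : lmulD (1 ⊗ₜ 1) w = w := by
  rw [lmulD_tmul]
  have (X : OqSU2 q ⊗[ℂ] Dual q) : lamU 1 X = X := by
    induction X with
    | zero => simp
    | add X Y hX hY => simp only [map_add, hX, hY]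
    | tmul a k => simp [one_exch]
  rw [this]
  induction w with
  | zero => simp
  | add X Y hX hY => simp only [map_add, hX, hY]
  | tmul a k => simp

lemma lmulD_one (w : OqSU2 q ⊗[ℂ] Dual q) : lmulD w (1 ⊗ₜ 1) = w := by
  induction w with
  | zero => simp
  | add X Y hX hY => simp only [map_add, hX, hY, LinearMap.add_apply]
  | tmul a k => simp [lmulD_tmul, exch_one]

/-- The Drinfeld double `A ⋈ 𝒰`: the vector space `A ⊗ 𝒰`, where `a ⊗ h` stands for the product
`a h`, with the multiplication determined by `h a = a₍₂₎ h(a₍₃₎ · S⁻¹(a₍₁₎))`. -/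
def Double (q : QParam) : Type := OqSU2 q ⊗[ℂ] Dual q

namespace Double

instance : AddCommGroup (Double q) := inferInstanceAs (AddCommGroup (OqSU2 q ⊗[ℂ] Dual q))
instance : Module ℂ (Double q) := inferInstanceAs (Module ℂ (OqSU2 q ⊗[ℂ] Dual q))

/-- The element `a h` of the double. -/
def of (a : OqSU2 q) (h : Dual q) : Double q := a ⊗ₜ[ℂ] h

/-- The multiplication of the double. -/
def mul (z w : Double q) : Double q := lmulD z w

/-- The unit of the double. -/
def one : Double q := of 1 1

instance : Ring (Double q) :=
  { (inferInstance : AddCommGroup (Double q)) with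
    mul := mul
    one := one
    left_distrib := fun a b c => map_add (lmulD a) b c
    right_distrib := fun a b c => LinearMap.map_add₂ lmulD a b c
    zero_mul := fun a => LinearMap.map_zero₂ lmulD a
    mul_zero := fun a => map_zero (lmulD a)
    mul_assoc := fun a b c => lmulD_assoc a b c
    one_mul := fun a => one_lmulD a
    mul_one := fun a => lmulD_one a }

lemma mul_def (z w : Double q) : z * w = lmulD z w := rfl

instance : Algebra ℂ (Double q) :=
  Algebra.ofModule (fun c z w => LinearMap.map_smul₂ lmulD c z w)
    (fun c z w => (lmulD z).map_smul c w)

/-- The inclusion of `A` in the double. -/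
def ofA : OqSU2 q →ₐ[ℂ] Double q :=
  AlgHom.ofLinearMap ((TensorProduct.mk ℂ _ _).flip 1 : OqSU2 q →ₗ[ℂ] OqSU2 q ⊗[ℂ] Dual q) rfl
    (fun a b => by
      change (a * b) ⊗ₜ 1 = lmulD (a ⊗ₜ 1) (b ⊗ₜ 1)
      simp [lmulD_tmul, one_exch])

/-- The inclusion of `𝒰` in the double. -/
def ofU : Dual q →ₐ[ℂ] Double q :=
  AlgHom.ofLinearMap (TensorProduct.mk ℂ _ _ 1 : Dual q →ₗ[ℂ] OqSU2 q ⊗[ℂ] Dual q) rfl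
    (fun h k => by
      change 1 ⊗ₜ (h * k) = lmulD (1 ⊗ₜ h) (1 ⊗ₜ k)
      simp [lmulD_tmul, exch_one])

lemma ofA_mul_ofU (a : OqSU2 q) (h : Dual q) : ofA a * ofU h = of a h := by
  change lmulD (a ⊗ₜ 1) (1 ⊗ₜ h) = a ⊗ₜ h
  simp [lmulD_tmul, exch_one]

/-- The exchange rule `h a = a₍₂₎ h(a₍₃₎ · S⁻¹(a₍₁₎))`. -/
lemma ofU_mul_ofA (h : Dual q) (a : OqSU2 q) :
    ofU h * ofA a = (exch h a : OqSU2 q ⊗[ℂ] Dual q) := by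
  change lmulD (1 ⊗ₜ h) (a ⊗ₜ 1) = _
  have (X : OqSU2 q ⊗[ℂ] Dual q) : lamA 1 (rmulU 1 X) = X := by
    induction X with
    | zero => simp
    | add X Y hX hY => simp only [map_add, hX, hY]
    | tmul a k => simp
  rw [lmulD_tmul, lamU_tmul, this]

/-- The counit `ε(a h) = ε(a) h(1)` of the double. -/
def counitD : Double q →ₗ[ℂ] ℂ :=
  LinearMap.mul' ℂ ℂ ∘ₗ TensorProduct.map (counit (R := ℂ) (A := OqSU2 q))
    (LinearMap.applyₗ (1 : OqSU2 q) ∘ₗ (WithConv.linearEquiv ℂ _).toLinearMap)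

end Double
end SLqR

namespace SLqR
open OqSU2
variable {q : QParam}

/-! ### `U_q(sl(2,ℝ)_t)` and the Drinfeld double coideal -/

/-- `U_q(sl(2,ℝ)_t) = O_q(S_t²) ⋈ I`, generated inside the double by `O_q(S_t²)` and `B_t`. -/
def UqSL (q : QParam) (a : ℝ) : Subalgebra ℂ (Double q) :=
  Algebra.adjoin ℂ (Double.ofA '' (podles q a : Set (OqSU2 q)) ∪ {Double.ofU (Bt q a)})

/-- The Drinfeld double coideal `O_q(S_t²) ⋈ 𝓘_c`, generated inside the double by `O_q(S_t²)`
and `𝓘_c`. -/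
def DCoid (q : QParam) (a : ℝ) : Subalgebra ℂ (Double q) :=
  Algebra.adjoin ℂ
    (Double.ofA '' (podles q a : Set (OqSU2 q)) ∪ Double.ofU '' (Ic q a : Set (Dual q)))

/-- The inclusion of `O_q(S_t²)` in `U_q(sl(2,ℝ)_t)`. -/
def bU {a : ℝ} : podles q a →ₐ[ℂ] UqSL q a :=
  (Double.ofA.comp (podles q a).val).codRestrict (UqSL q a)
    fun b => Algebra.subset_adjoin (Or.inl ⟨b.1, b.2, rfl⟩)

/-- The element `i B_t` of `U_q(sl(2,ℝ)_t)`. -/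
def iBU (q : QParam) (a : ℝ) : UqSL q a :=
  ⟨Double.ofU (iBt q a), by
    rw [iBt, map_smul]
    exact (UqSL q a).smul_mem (Algebra.subset_adjoin (Set.mem_union_right _ rfl)) _⟩

/-- The inclusion of `O_q(S_t²)` in `O_q(S_t²) ⋈ 𝓘_c`. -/
def bD {a : ℝ} : podles q a →ₐ[ℂ] DCoid q a :=
  (Double.ofA.comp (podles q a).val).codRestrict (DCoid q a)
    fun b => Algebra.subset_adjoin (Or.inl ⟨b.1, b.2, rfl⟩)

/-- The inclusion of `𝓘_c` in `O_q(S_t²) ⋈ 𝓘_c`. -/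
def yD {a : ℝ} (y : Dual q) (hy : y ∈ Ic q a) : DCoid q a :=
  ⟨Double.ofU y, Algebra.subset_adjoin (Or.inr ⟨y, hy, rfl⟩)⟩

/-- The counit of `O_q(S_t²) ⋈ 𝓘_c`. -/
def epsD {a : ℝ} : DCoid q a →ₗ[ℂ] ℂ := Double.counitD ∘ₗ (DCoid q a).val.toLinearMap

/-! ### The modules `M_{λ,b}` and `L_{λ,b}` -/

/-- The left ideal generated by `i B_t - [b]` and `A_b - λ`. -/
def basicIdeal (q : QParam) (a lam b : ℝ) : Submodule (UqSL q a) (UqSL q a) :=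
  Submodule.span _ {iBU q a - algebraMap ℂ _ (qn q b : ℂ), bU (Ac q a b) - algebraMap ℂ _ (lam : ℂ)}

/-- The largest `(λ,b)`-basic module `M_{λ,b}`: the universal module with a cyclic vector `e_b`
such that `i B_t e_b = [b] e_b` and `A_b e_b = λ e_b`. -/
abbrev Mmod (q : QParam) (a lam b : ℝ) : Type := UqSL q a ⧸ basicIdeal q a lam b

/-- The cyclic vector `e_b` of `M_{λ,b}`. -/
def Mmod.cyc (q : QParam) (a lam b : ℝ) : Mmod q a lam b := Submodule.Quotient.mk 1

/-- A `*`-invariant sesquilinear form on a `U_q(sl(2,ℝ)_t)`-module (conjugate-linear in the first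
variable). -/
def IsInvariantForm {a : ℝ} {V : Type*} [AddCommGroup V] [Module ℂ V] [Module (UqSL q a) V]
    (s : V →ₗ⋆[ℂ] V →ₗ[ℂ] ℂ) : Prop :=
  (∀ (b : podles q a) (v w : V), s v (bU b • w) = s (bU (star b) • v) w) ∧
  ∀ v w : V, s v (iBU q a • w) = s (iBU q a • v) w

lemma UqSL_induction {a : ℝ} {P : UqSL q a → Prop} (hb : ∀ b, P (bU b)) (hB : P (iBU q a))
    (hc : ∀ c, P (algebraMap ℂ _ c)) (hadd : ∀ x y, P x → P y → P (x + y))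
    (hmul : ∀ x y, P x → P y → P (x * y)) (x : UqSL q a) : P x := by
  obtain ⟨x, hx⟩ := x
  induction hx using Algebra.adjoin_induction with
  | mem x hx =>
    rcases hx with ⟨b, hb', rfl⟩ | hx
    · exact hb ⟨b, hb'⟩
    · have hx' : x = Double.ofU (Bt q a) := hx
      have h := hmul _ _ (hc (-Complex.I)) hB
      convert h using 1
      ext1
      rw [← Algebra.smul_def]
      change x = (-Complex.I) • Double.ofU (Complex.I • Bt q a)
      rw [hx', map_smul, smul_smul]
      simp
  | algebraMap c => exact hc c
  | add x y hx hy h h' => exact hadd ⟨x, hx⟩ ⟨y, hy⟩ h h'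
  | mul x y hx hy h h' => exact hmul ⟨x, hx⟩ ⟨y, hy⟩ h h'

/-- The kernel of the `*`-invariant sesquilinear form of `M_{λ,b}`, which is unique up to a
scalar. -/
def formKer (q : QParam) (a lam b : ℝ) : Submodule (UqSL q a) (Mmod q a lam b) where
  carrier := {v | ∀ s : Mmod q a lam b →ₗ⋆[ℂ] Mmod q a lam b →ₗ[ℂ] ℂ,
    IsInvariantForm (q := q) (a := a) s → ∀ w, s w v = 0}
  add_mem' hv hv' s hs w := by rw [map_add, hv s hs, hv' s hs, add_zero]
  zero_mem' s _ w := map_zero _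
  smul_mem' x v hv := by
    refine UqSL_induction (P := fun x => ∀ v : Mmod q a lam b,
      (∀ s : Mmod q a lam b →ₗ⋆[ℂ] Mmod q a lam b →ₗ[ℂ] ℂ, IsInvariantForm (q := q) (a := a) s →
        ∀ w, s w v = 0) → ∀ s : Mmod q a lam b →ₗ⋆[ℂ] Mmod q a lam b →ₗ[ℂ] ℂ,
        IsInvariantForm (q := q) (a := a) s → ∀ w, s w (x • v) = 0) ?_ ?_ ?_ ?_ ?_ x v hv
    · intro b v hv s hs w
      rw [hs.1]; exact hv s hs _
    · intro v hv s hs w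
      rw [hs.2]; exact hv s hs _
    · intro c v hv s hs w
      rw [algebraMap_smul, map_smul, hv s hs, smul_zero]
    · intro x y hx hy v hv s hs w
      rw [add_smul, map_add, hx v hv s hs, hy v hv s hs, add_zero]
    · intro x y hx hy v hv s hs w
      rw [mul_smul]
      exact hx _ (hy v hv) s hs w

/-- The module `L_{λ,b} = M_{λ,b} / N_{λ,b}`. -/
abbrev Lmod (q : QParam) (a lam b : ℝ) : Type := Mmod q a lam b ⧸ formKer q a lam b

/-- The cyclic vector of `L_{λ,b}`. -/
def Lmod.cyc (q : QParam) (a lam b : ℝ) : Lmod q a lam b :=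
  Submodule.Quotient.mk (Mmod.cyc q a lam b)

/-! ### Representations of `O_q(S_t²) ⋈ 𝓘_c` and 1-cocycles -/

section reps
variable {a : ℝ} {V : Type*} [AddCommGroup V] [Module ℂ V]

/-- `π` is the non-degenerate representation of `O_q(S_t²) ⋈ 𝓘_c` on `V` that corresponds to the
`U_q(sl(2,ℝ)_t)`-module structure of `V`: the actions of `O_q(S_t²)` agree, and `i B_t y` acts as
`i B_t` after `y` for `y ∈ 𝓘_c`. -/
def CorrespondsTo [Module (UqSL q a) V] (π : DCoid q a →ₐ[ℂ] Module.End ℂ V) : Prop :=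
  (∀ (b : podles q a) (v : V), π (bD b) v = bU b • v) ∧
  (∀ (y : Dual q) (hy : y ∈ Ic q a) (v : V),
    π (yD (iBt q a * y) (iBt_mul_mem hy)) v = iBU q a • π (yD y hy) v) ∧
  Submodule.span ℂ {w : V | ∃ (y : Dual q) (hy : y ∈ Ic q a) (v : V), w = π (yD y hy) v} = ⊤

/-- `s` is an inner product on `V`, conjugate-linear in the first variable. -/
def IsInner (s : V →ₗ⋆[ℂ] V →ₗ[ℂ] ℂ) : Prop :=
  (∀ v w : V, conj (s v w) = s w v) ∧ ∀ v : V, v ≠ 0 → 0 < (s v v).re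

/-- `π` is a `*`-representation on the preHilbert space `(V, s)`. -/
def IsStarRep (s : V →ₗ⋆[ℂ] V →ₗ[ℂ] ℂ) (π : DCoid q a →ₐ[ℂ] Module.End ℂ V) : Prop :=
  (∀ (b : podles q a) (v w : V), s v (π (bD b) w) = s (π (bD (star b)) v) w) ∧
  ∀ (y : Dual q) (hy : y ∈ Ic q a), ∃ hy' : dualStar y ∈ Ic q a,
    ∀ v w : V, s v (π (yD y hy) w) = s (π (yD (dualStar y) hy') v) w

/-- `(π, ε)`-1-cocycles on `O_q(S_t²) ⋈ 𝓘_c`. -/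
def IsCocycle (π : DCoid q a →ₐ[ℂ] Module.End ℂ V) (C : DCoid q a →ₗ[ℂ] V) : Prop :=
  ∀ x y : DCoid q a, C (x * y) = π x (C y) + epsD y • C x

/-- Yetter–Drinfeld `(π, ε)`-1-cocycles on `O_q(S_t²)`: 1-cocycles for the restriction of `π` to
`O_q(S_t²)` with `π(y) C(b) = C(b ◁ S⁻¹(y))` for all `y ∈ 𝓘_c`. -/
def IsYDCocycle (π : DCoid q a →ₐ[ℂ] Module.End ℂ V) (C : podles q a →ₗ[ℂ] V) : Prop :=
  (∀ b c : podles q a, C (b * c) = π (bD b) (C c) + counit (R := ℂ) (c : OqSU2 q) • C b) ∧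
  ∀ (y : Dual q) (hy : y ∈ Ic q a) (b : podles q a),
    π (yD y hy) (C b) = C ⟨ract (dualSinv y) (b : OqSU2 q), ract_mem_podles _ b.2⟩

end reps

/-- The number `q + q⁻¹`. -/
def lam0 (q : QParam) : ℝ := (q : ℝ) + (q : ℝ)⁻¹

/-- The module `M_{q+q⁻¹,a}`. -/
abbrev MM (q : QParam) (a : ℝ) : Type := Mmod q a (lam0 q) a

/-- The vector `e_a` of `M_{q+q⁻¹,a}`. -/
def ea (q : QParam) (a : ℝ) : MM q a := Mmod.cyc q a (lam0 q) a

/-- The discrete series `D_2^+ = L_{q+q⁻¹,a+2}`. -/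
abbrev Dplus (q : QParam) (a : ℝ) : Type := Lmod q a (lam0 q) (a + 2)

/-- The discrete series `D_2^- = L_{q+q⁻¹,a-2}`. -/
abbrev Dminus (q : QParam) (a : ℝ) : Type := Lmod q a (lam0 q) (a - 2)

/-- The space `D_2^+ ⊕ D_2^-`. -/
abbrev DD (q : QParam) (a : ℝ) : Type := Dplus q a × Dminus q a

/-- The cyclic vector `e_{a+2}` of `D_2^+`, in `D_2^+ ⊕ D_2^-`. -/
def ePlus (q : QParam) (a : ℝ) : DD q a := (Lmod.cyc q a (lam0 q) (a + 2), 0)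

/-- The cyclic vector `e_{a-2}` of `D_2^-`, in `D_2^+ ⊕ D_2^-`. -/
def eMinus (q : QParam) (a : ℝ) : DD q a := (0, Lmod.cyc q a (lam0 q) (a - 2))

/-- `0 → D_2^+ ⊕ D_2^- → M_{q+q⁻¹,a} → ℂ_ε → 0` (maps `φ` and `p`) is an exact sequence of
representations of `O_q(S_t²) ⋈ 𝓘_c`, with `φ(e_{a±2}) = T_a^± e_a` and `p(e_a) = 1`. -/
def IsExtension {a : ℝ} (πM : DCoid q a →ₐ[ℂ] Module.End ℂ (MM q a))
    (π : DCoid q a →ₐ[ℂ] Module.End ℂ (DD q a))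
    (φ : DD q a →ₗ[ℂ] MM q a) (p : MM q a →ₗ[ℂ] ℂ) : Prop :=
  (∀ (z : DCoid q a) (w : DD q a), φ (π z w) = πM z (φ w)) ∧
  (∀ (z : DCoid q a) (v : MM q a), p (πM z v) = epsD z * p v) ∧
  Function.Injective φ ∧ (∀ v : MM q a, p v = 0 ↔ ∃ w : DD q a, φ w = v) ∧
  φ (ePlus q a) = bU (Tplus q a a) • ea q a ∧ φ (eMinus q a) = bU (Tminus q a a) • ea q a ∧
  p (ea q a) = 1

/-- The extension does not split: no vector spans a copy of `ε` that maps onto `ℂ_ε`. -/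
def NonSplit {a : ℝ} (πM : DCoid q a →ₐ[ℂ] Module.End ℂ (MM q a))
    (p : MM q a →ₗ[ℂ] ℂ) : Prop :=
  ¬ ∃ v : MM q a, p v = 1 ∧ ∀ z : DCoid q a, πM z v = epsD z • v

end SLqR

end
open SLqR

/-!
# The cocycle of the extension `0 → D_2^+ ⊕ D_2^- → M_{q+q⁻¹,a} → ℂ_ε → 0`

The module `M_{q+q⁻¹,a}` is realised as a quotient of the Podleś sphere `O_q(S_t²)` itself. Inside
the double, `𝓘` acts on `O_q(S_t²)` by `b ↦ b ◁ S⁻¹(y)` (`act_ofU`), and `O_q(S_t²)` acts by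
multiplication. The element `c0 = A_a - (q + q⁻¹)` preserves the weight `[a]`, so right multiplication
by it commutes with `i B_t` (`tauB_mul_c0`), and
`M_{q+q⁻¹,a} = O_q(S_t²) / O_q(S_t²) c0` (`theta_surjective`, `theta_eq_zero`). As `ε(c0) = 0`, the
counit of `O_q(S_t²)` descends to the quotient map `p` (`pM`).

The space `𝓘_c` is made explicit by the weight decomposition of `O_q(SU(2))` under `B_t`: every
element of `𝓘` is a multiple of the counit on each eigenspace (`stab_EE`), so `𝓘_c` is spanned by the
matrix units `ψ_m`, equal to `ε` on the eigenspace for `[a + m]` and to zero on the others (`Ic_eq`).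
They are self-adjoint (`dualStar_psi`) and act on modules as the eigenprojections of `i B_t`; this
gives the representation `π̃` (`piM`) and the correspondence with `U_q(sl(2,ℝ)_t)`
(`correspondsTo_piM`). The decomposition also yields generators of the Podleś sphere
(`podles_eq_GB`).

The elements `T_c^±` and `A_c` are products of two linear elements of `O_q(SU(2))`, up to constants,
and their relations follow from one exchange relation (`lin_flip`). Applied to `e_a`, the operators
`T^±` produce a string of vectors `f_n` of weights `[a + 2n]`, on which the generators of the Podleś
sphere are tridiagonal (`IsString.combo`). The vectors `f_n` form a basis, since the weights are
different and no `f_n` vanishes. That `f_{±1} ≠ 0` is the delicate point (`theta_Tp_Tm_ne_zero`): it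
uses a derivation of `O_q(SU(2))` at the counit that does not kill `c0`. Further out, `T^∓ T^±`
multiplies `f_n` by a number that is negative, except on `e_a` and where `T^±` leads back to it, when
it is zero (`tr_neg`,
`tr_zero`, `tr_neg_one`). Hence the kernel of `p` is the direct sum of the spans of `f_n` with `n ≥ 1`
and with `n ≤ -1`, and rescaling the `f_n` gives an inner product on it for which the generators of
the Podleś sphere act by a `*`-representation (`sM_bU`).

Pulled back along `M_{q+q⁻¹,a±2} → ker p`, the inner product is an invariant form, and the weights
determine all invariant forms on the cyclic vector. So the kernel of this map is the kernel of the
invariant forms, and the two summands of `ker p` are `D_2^±` (`exists_embedding`, `exists_phiM`). The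
cocycles are `π̃(z) e_a - ε(z) e_a`, which `p` maps to zero; the cocycle identities hold for any such
coboundary in a larger representation. The extension does not split, because an invariant vector has
weight `[a]`, hence is a multiple of `e_a`, whereas `T_a^+ e_a` is not a multiple of `e_a`
(`nonSplit_piM`).
-/

noncomputable section
set_option linter.unusedSimpArgs false
set_option linter.unnecessarySeqFocus false
set_option linter.unusedSectionVars false

namespace SLqR
open OqSU2
variable {q : QParam}

/-! ### Linear elements of `O_q(SU(2))` and their exchange relations -/

/-- The linear element `u_{i0} + i z u_{i1}` of the `i`-th row of the fundamental corepresentation. -/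
def row (q : QParam) (z : ℂ) (i : Fin 2) : OqSU2 q := uMat q i 0 + (Complex.I * z) • uMat q i 1

/-- The element `row z 0 + i W row z 1`: both indices of the fundamental corepresentation are
contracted with a vector. -/
def lin (q : QParam) (W z : ℂ) : OqSU2 q := row q z 0 + (Complex.I * W) • row q z 1

/-- The commutation relation between the two rows; for `z' = q z + 1` the scalar is `i`. -/
lemma row_zero_mul_row_one (z z' : ℂ) :
    row q z 0 * row q z' 1 =
      qc q • (row q z 1 * row q z' 0) + algebraMap ℂ _ (Complex.I * (z' - qc q * z)) := by
  have hq := qc_ne q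
  simp only [row, uMat, Matrix.cons_val_zero, Matrix.cons_val_one, Matrix.cons_val_fin_one,
    Algebra.algebraMap_eq_smul_one, mul_add, add_mul, neg_mul, mul_neg, smul_neg,
    smul_mul_assoc, mul_smul_comm, als_al, al_als, gas_ga, al_ga, al_gas, als_gas, als_ga,
    smul_add, smul_sub, smul_smul]
  match_scalars
  all_goals field_simp
  all_goals try ring_nf

lemma row_mul_row_self {P : ℂ} (hP : P ≠ 0) (i : Fin 2) :
    row q P i * row q (-(qc q * P)⁻¹) i = row q (-P⁻¹) i * row q (P / qc q) i := by
  have hq := qc_ne q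
  fin_cases i <;>
  · simp only [row, uMat, Matrix.cons_val_zero, Matrix.cons_val_one, Matrix.cons_val_fin_one,
      Algebra.algebraMap_eq_smul_one, mul_add, add_mul, neg_mul, mul_neg, smul_neg, Fin.zero_eta,
      Fin.mk_one, smul_mul_assoc, mul_smul_comm, als_al, al_als, gas_ga, al_ga, al_gas, als_gas,
      als_ga, smul_add, smul_sub, smul_smul]
    match_scalars
    all_goals field_simp
    all_goals try ring_nf

lemma row_one_mul_row_zero {P : ℂ} (hP : P ≠ 0) :
    row q P 1 * row q (-(qc q * P)⁻¹) 0 = row q (-P⁻¹) 1 * row q (P / qc q) 0 +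
      algebraMap ℂ _ (Complex.I * (P + P⁻¹)) := by
  have hq := qc_ne q
  simp only [row, uMat, Matrix.cons_val_zero, Matrix.cons_val_one, Matrix.cons_val_fin_one,
    Algebra.algebraMap_eq_smul_one, mul_add, add_mul, neg_mul, mul_neg, smul_neg,
    smul_mul_assoc, mul_smul_comm, als_al, al_als, gas_ga, al_ga, al_gas, als_gas, als_ga,
    smul_add, smul_sub, smul_smul]
  match_scalars
  all_goals field_simp
  all_goals try ring_nf

/-- Going up and then down with the right index agrees with going down and then up, up to a
scalar. -/
lemma row_flip {P : ℂ} (hP : P ≠ 0) (i j : Fin 2) : ∃ c : ℂ,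
    row q P i * row q (-(qc q * P)⁻¹) j =
      row q (-P⁻¹) i * row q (P / qc q) j + algebraMap ℂ _ c := by
  by_cases hij : i = j
  · subst hij
    exact ⟨0, by rw [row_mul_row_self hP, map_zero, add_zero]⟩
  obtain ⟨rfl, rfl⟩ | ⟨rfl, rfl⟩ : (i = 0 ∧ j = 1) ∨ (i = 1 ∧ j = 0) := by
    fin_cases i <;> fin_cases j <;> simp_all
  · refine ⟨qc q * (Complex.I * (P + P⁻¹)) + Complex.I * (-(qc q * P)⁻¹ - qc q * P)
      - Complex.I * (P / qc q - qc q * (-P⁻¹)), ?_⟩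
    rw [row_zero_mul_row_one, row_zero_mul_row_one, row_one_mul_row_zero hP, map_sub, map_add,
      map_mul _ (qc q), smul_add, Algebra.smul_def (qc q) (algebraMap _ _ _)]
    abel
  · exact ⟨_, row_one_mul_row_zero hP⟩

/-- Exchange relation for the left index; the two products correspond to the two ways of going
up and down by one step. -/
lemma lin_flip (W W' z z' : ℂ) : lin q W z * lin q W' z' =
    lin q (qc q * W') z * lin q (W / qc q) z' +
      algebraMap ℂ _ ((W / qc q - W') * (z' - qc q * z)) := by
  have hq := qc_ne q
  simp only [lin, mul_add, add_mul, smul_mul_assoc, mul_smul_comm, smul_add, smul_smul,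
    row_zero_mul_row_one, Algebra.algebraMap_eq_smul_one]
  match_scalars
  all_goals field_simp
  all_goals try ring_nf
  all_goals simp only [Complex.I_sq]
  all_goals ring

/-- The elements that move the weight up and down span the `i`-th row. -/
lemma uMat_eq_row {P : ℂ} (hP : P ≠ 0) (hP' : P ^ 2 + 1 ≠ 0) (i j : Fin 2) :
    uMat q i j ∈ Submodule.span ℂ {row q P i, row q (-P⁻¹) i} := by
  have hI := Complex.I_ne_zero
  have h1 : P + P⁻¹ ≠ 0 := by
    intro h
    apply hP'
    field_simp at h
    simpa using h
  have e1 : uMat q i 1 = (Complex.I * (P + P⁻¹))⁻¹ • row q P i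
      - (Complex.I * (P + P⁻¹))⁻¹ • row q (-P⁻¹) i := by
    rw [← smul_sub, eq_inv_smul_iff₀ (mul_ne_zero hI h1), row, row]
    module
  have h : uMat q i 1 ∈ Submodule.span ℂ {row q P i, row q (-P⁻¹) i} := by
    rw [e1]
    exact sub_mem (Submodule.smul_mem _ _ (Submodule.subset_span (by simp)))
      (Submodule.smul_mem _ _ (Submodule.subset_span (by simp)))
  fin_cases j
  · have e0 : uMat q i 0 = row q P i - (Complex.I * P) • uMat q i 1 := by rw [row]; abel
    change uMat q i 0 ∈ _
    rw [e0]
    exact sub_mem (Submodule.subset_span (by simp)) (Submodule.smul_mem _ _ h)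
  · exact h

/-! ### Powers of `q` and quantum numbers -/

/-- `q^{a+m}` for an integer `m`. -/
def qm (q : QParam) (a : ℝ) (m : ℤ) : ℂ := qpow q (a + m)

lemma qpow_pos (c : ℝ) : 0 < (q : ℝ) ^ c := Real.rpow_pos_of_pos q.2.1 c

lemma qpow_ne (q : QParam) (c : ℝ) : qpow q c ≠ 0 := by
  rw [qpow]; exact_mod_cast (qpow_pos (q := q) c).ne'

lemma qpow_add (c d : ℝ) : qpow q (c + d) = qpow q c * qpow q d := by
  simp only [qpow]; rw [Real.rpow_add q.2.1]; push_cast; rfl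

lemma qpow_neg (c : ℝ) : qpow q (-c) = (qpow q c)⁻¹ := by
  simp only [qpow]; rw [Real.rpow_neg q.2.1.le]; push_cast; rfl

lemma qpow_one : qpow q 1 = qc q := by simp [qpow, qc]

lemma qpow_add_one (c : ℝ) : qpow q (c + 1) = qc q * qpow q c := by
  rw [qpow_add, qpow_one, mul_comm]

lemma qpow_sub_one (c : ℝ) : qpow q (c - 1) = qpow q c / qc q := by
  rw [sub_eq_add_neg, qpow_add, qpow_neg, qpow_one]; rfl

lemma qpow_add_two (c : ℝ) : qpow q (c + 2) = qc q ^ 2 * qpow q c := by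
  rw [show c + 2 = c + 1 + 1 by ring, qpow_add_one, qpow_add_one]; ring

lemma qpow_sub_two (c : ℝ) : qpow q (c - 2) = qpow q c / qc q ^ 2 := by
  rw [show c - 2 = c - 1 - 1 by ring, qpow_sub_one, qpow_sub_one]; field_simp

lemma qm_ne (q : QParam) (a : ℝ) (m : ℤ) : qm q a m ≠ 0 := qpow_ne q _

lemma qm_add_one (a : ℝ) (m : ℤ) : qm q a (m + 1) = qc q * qm q a m := by
  rw [qm, qm, ← qpow_add_one]; push_cast; congr 1; ring

lemma qm_sub_one (a : ℝ) (m : ℤ) : qm q a (m - 1) = qm q a m / qc q := by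
  rw [qm, qm, ← qpow_sub_one]; push_cast; congr 1; ring

lemma qm_zero (a : ℝ) : qm q a 0 = qpow q a := by simp [qm]

lemma qpow_add_inv_ne (c : ℝ) : qpow q c + (qpow q c)⁻¹ ≠ 0 := by
  have h := qpow_pos (q := q) c
  rw [qpow]
  exact_mod_cast (by positivity : 0 < (q : ℝ) ^ c + ((q : ℝ) ^ c)⁻¹).ne'

lemma qpow_sq_add_one_ne (c : ℝ) : qpow q c ^ 2 + 1 ≠ 0 := by
  have h := qpow_pos (q := q) c
  rw [qpow]
  exact_mod_cast (by positivity : 0 < ((q : ℝ) ^ c) ^ 2 + 1).ne'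

lemma qd_eq (c : ℝ) : (qd q c : ℂ) = qpow q c - (qpow q c)⁻¹ := by
  rw [← qpow_neg, qd, qpow, qpow]; push_cast; rfl

lemma qs_eq (c : ℝ) : (qs q c : ℂ) = qpow q c + (qpow q c)⁻¹ := by
  rw [← qpow_neg, qs, qpow, qpow]; push_cast; rfl

lemma qn_eq (c : ℝ) : (qn q c : ℂ) = (qpow q c - (qpow q c)⁻¹) / (qc q - (qc q)⁻¹) := by
  rw [← qpow_neg, qn, qpow, qpow, qc]; push_cast; rfl

lemma kap_eq (a : ℝ) : kap q a = Complex.I * (qn q a : ℂ) := by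
  rw [kap, qn_eq, qd_eq]; ring

lemma qn_strictMono : StrictMono (qn q) := by
  intro c d h
  have h0 := q.2.1
  have h1 := q.2.2
  have hd : (q : ℝ) - (q : ℝ)⁻¹ < 0 := by
    have : 1 < (q : ℝ)⁻¹ := (one_lt_inv₀ h0).2 h1
    linarith
  have e1 : (q : ℝ) ^ d < (q : ℝ) ^ c := Real.rpow_lt_rpow_of_exponent_gt h0 h1 h
  have e2 : (q : ℝ) ^ (-c) < (q : ℝ) ^ (-d) :=
    Real.rpow_lt_rpow_of_exponent_gt h0 h1 (by linarith)
  rw [qn, qn]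
  exact div_lt_div_of_neg_of_lt hd (by linarith)

lemma qn_int_injective (a : ℝ) : Function.Injective fun m : ℤ => (qn q (a + m) : ℂ) := by
  intro m n h
  have h' : qn q (a + m) = qn q (a + n) := Complex.ofReal_injective h
  have := qn_strictMono.injective h'
  exact_mod_cast (add_left_cancel this)

/-! ### The decomposition of `O_q(SU(2))` under `B_t` -/

/-- The eigenspace of `i B_t ▷ ·` on `O_q(SU(2))` for the eigenvalue `[a + m]`. -/
def EE (q : QParam) (a : ℝ) (m : ℤ) : Submodule ℂ (OqSU2 q) :=
  Module.End.eigenspace (lact (iBt q a)) (qn q (a + m) : ℂ)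

lemma mem_EE {a : ℝ} {m : ℤ} {b : OqSU2 q} :
    b ∈ EE q a m ↔ lact (Bt q a) b = -((Complex.I * (qn q (a + m) : ℂ)) • b) := by
  rw [EE, Module.End.mem_eigenspace_iff, iBt, lact_smul]
  constructor
  · intro h
    have := congrArg (fun x => (-Complex.I) • x) h
    simp only [smul_smul] at this
    simpa using this
  · intro h
    rw [h, smul_neg, smul_smul, ← mul_assoc]; simp

/-- As `B_t` generates the coideal subalgebra, invariance means being an eigenvector of `i B_t` for the
eigenvalue `(i B_t)(1) = [a]`. -/
lemma EE_zero (a : ℝ) {b : OqSU2 q} : b ∈ EE q a 0 ↔ b ∈ podles q a := by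
  rw [mem_EE, mem_podles_iff, kap_eq]; simp

lemma one_mem_EE (a : ℝ) : (1 : OqSU2 q) ∈ EE q a 0 := (EE_zero a).2 (one_mem _)

/-- Multiplication by a linear element with `z = q^{a+m}` moves the weight `[a + m]` one step up,
with `z = -q^{-(a+m)}` one step down. -/
lemma mul_row_mem_EE {a : ℝ} {m : ℤ} {b : OqSU2 q} (hb : b ∈ EE q a m) (i : Fin 2) :
    b * row q (qm q a m) i ∈ EE q a (m + 1) ∧ b * row q (-(qm q a m)⁻¹) i ∈ EE q a (m - 1) := by
  have hP := qm_ne q a m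
  have hq := qc_ne q
  have hd := q_sub_ne (q := q)
  have hd' : qc q ^ 2 - 1 ≠ 0 := by
    intro h; apply hd; field_simp; linear_combination h
  rw [mem_EE] at hb
  constructor <;>
  · rw [mem_EE]
    simp only [row, lact_Bt_mul, map_add, map_smul, lact_Bt_u0, lact_Bt_u1, lact_kinv_u, hb, kap_eq,
      qn_eq]
    push_cast
    simp only [← qm.eq_1, ← add_assoc, add_sub, qpow_add_one, qpow_sub_one, mul_add, add_mul, mul_sub, sub_mul,
      neg_mul, mul_neg, smul_mul_assoc, mul_smul_comm, smul_smul, smul_add, smul_sub, smul_neg,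
      Matrix.cons_val_zero, Matrix.cons_val_one, Matrix.cons_val_fin_one]
    match_scalars
    all_goals field_simp
    all_goals try ring_nf
    all_goals try simp only [Complex.I_sq]
    all_goals try ring

/-- A subspace that contains `1` and is stable under right multiplication by the entries of the
fundamental corepresentation is everything. -/
lemma eq_top_of_mul_uMat_mem {T : Submodule ℂ (OqSU2 q)} (h1 : 1 ∈ T)
    (hgen : ∀ v ∈ T, ∀ i j, v * uMat q i j ∈ T) : T = ⊤ := by
  have hmul (x : OqSU2 q) : ∀ v ∈ T, v * x ∈ T := by
    induction x using OqSU2.induction with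
    | hC c => intro v hv; rw [← Algebra.commutes, ← Algebra.smul_def]; exact T.smul_mem _ hv
    | hx g =>
      intro v hv
      cases g
      · exact hgen v hv 0 0
      · exact hgen v hv 1 1
      · exact hgen v hv 1 0
      · have := T.smul_mem (-(qc q)⁻¹) (hgen v hv 0 1)
        simpa [uMat, smul_smul, qc_ne] using this
    | hmul x y hx hy => intro v hv; rw [← mul_assoc]; exact hy _ (hx _ hv)
    | hadd x y hx hy => intro v hv; rw [mul_add]; exact add_mem (hx _ hv) (hy _ hv)
  rw [eq_top_iff]
  intro x _
  simpa using hmul x 1 h1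

lemma mul_uMat_mem {T : Submodule ℂ (OqSU2 q)} {a : ℝ} {m : ℤ} {v : OqSU2 q} {i : Fin 2}
    (h1 : v * row q (qm q a m) i ∈ T) (h2 : v * row q (-(qm q a m)⁻¹) i ∈ T) (j : Fin 2) :
    v * uMat q i j ∈ T := by
  obtain ⟨c, d, h⟩ := Submodule.mem_span_pair.1
    (uMat_eq_row (q := q) (qm_ne q a m) (qpow_sq_add_one_ne _) i j)
  rw [← h, mul_add, mul_smul_comm, mul_smul_comm]
  exact add_mem (Submodule.smul_mem _ _ h1) (Submodule.smul_mem _ _ h2)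

/-- `B_t` acts semisimply on `O_q(SU(2))`, with eigenvalues `[a + m]`. -/
lemma iSup_EE (a : ℝ) : ⨆ m, EE q a m = ⊤ := by
  refine eq_top_of_mul_uMat_mem (Submodule.mem_iSup_of_mem 0 (one_mem_EE a)) fun v hv i j => ?_
  induction hv using Submodule.iSup_induction' with
  | zero => rw [zero_mul]; exact zero_mem _
  | add x y _ _ hx hy => rw [add_mul]; exact add_mem hx hy
  | mem m b hb =>
    exact mul_uMat_mem (Submodule.mem_iSup_of_mem _ (mul_row_mem_EE hb i).1)
      (Submodule.mem_iSup_of_mem _ (mul_row_mem_EE hb i).2) j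

lemma iSupIndep_EE (a : ℝ) : iSupIndep (EE q a) :=
  (Module.End.eigenspaces_iSupIndep (lact (iBt q a))).comp (qn_int_injective a)

/-- Projections attached to a decomposition into independent subspaces. -/
lemma exists_projections {ι V : Type*} [AddCommGroup V] [Module ℂ V] (E : ι → Submodule ℂ V)
    (h1 : iSupIndep E) (h2 : ⨆ i, E i = ⊤) : ∃ P : ι → V →ₗ[ℂ] V,
      (∀ i, ∀ v ∈ E i, P i v = v) ∧ (∀ i j, i ≠ j → ∀ v ∈ E j, P i v = 0) ∧
      (∀ i v, P i v ∈ E i) ∧ ∀ v, ∃ F : Finset ι, ∀ F' : Finset ι, F ⊆ F' → ∑ i ∈ F', P i v = v := by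
  classical
  have hI := DirectSum.isInternal_submodule_of_iSupIndep_of_iSup_eq_top h1 h2
  let := hI.chooseDecomposition
  refine ⟨fun i => (E i).subtype ∘ₗ DirectSum.component ℂ ι (fun i => E i) i ∘ₗ
    (DirectSum.decomposeLinearEquiv E).toLinearMap, ?_, ?_, ?_, ?_⟩
  · intro i v hv
    change ((DirectSum.decompose E v i : E i) : V) = v
    rw [DirectSum.decompose_of_mem_same E hv]
  · intro i j hij v hv
    change ((DirectSum.decompose E v i : E i) : V) = 0
    rw [DirectSum.decompose_of_mem_ne E hv hij.symm]
  · intro i v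
    exact (DirectSum.decompose E v i).2
  · intro v
    refine ⟨(DirectSum.decompose E v).support, fun F' hF => ?_⟩
    have := DirectSum.sum_support_decompose E v
    nth_rewrite 2 [← this]
    symm
    refine Finset.sum_subset hF fun i _ hi => ?_
    simpa using hi

/-! ### Generators of the Podleś sphere -/

/-- The product `row r i * row (-(q r)⁻¹) j` with `r = q^a`. -/
def GG (q : QParam) (a : ℝ) (i j : Fin 2) : OqSU2 q :=
  row q (qpow q a) i * row q (-(qc q * qpow q a)⁻¹) j

lemma GG_mem (a : ℝ) (i j : Fin 2) : GG q a i j ∈ podles q a := by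
  rw [← EE_zero]
  have h1 := (mul_row_mem_EE (mul_row_mem_EE (one_mem_EE (q := q) a) i).1 j).2
  rwa [zero_add, one_mul, qm_zero, sub_self, ← zero_add (1 : ℤ), qm_add_one, qm_zero] at h1

/-- The subalgebra generated by the elements `GG q a i j`. -/
def GB (q : QParam) (a : ℝ) : Subalgebra ℂ (OqSU2 q) :=
  Algebra.adjoin ℂ {x | ∃ i j, x = GG q a i j}

lemma GG_mem_GB (a : ℝ) (i j : Fin 2) : GG q a i j ∈ GB q a :=
  Algebra.subset_adjoin ⟨i, j, rfl⟩

lemma GB_le (a : ℝ) : GB q a ≤ podles q a := by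
  refine Algebra.adjoin_le ?_
  rintro _ ⟨i, j, rfl⟩
  exact GG_mem a i j

/-- The span of the products `b * row (q^a) i₁ * ⋯ * row (q^{a+n-1}) iₙ` with `b` in `GB q a`. -/
def Fup (q : QParam) (a : ℝ) : ℕ → Submodule ℂ (OqSU2 q)
  | 0 => (GB q a).toSubmodule
  | n + 1 => Submodule.span ℂ {x | ∃ b ∈ Fup q a n, ∃ i, x = b * row q (qm q a n) i}

/-- The span of the products `b * row (-q^{-a}) i₁ * ⋯ * row (-q^{-a+n-1}) iₙ` with `b` in
`GB q a`. -/
def Fdn (q : QParam) (a : ℝ) : ℕ → Submodule ℂ (OqSU2 q)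
  | 0 => (GB q a).toSubmodule
  | n + 1 => Submodule.span ℂ {x | ∃ b ∈ Fdn q a n, ∃ i, x = b * row q (-(qm q a (-n))⁻¹) i}

lemma Fup_le (a : ℝ) (n : ℕ) : Fup q a n ≤ EE q a n := by
  induction n with
  | zero => intro x hx; exact (EE_zero a).2 (GB_le a hx)
  | succ n ih =>
    refine Submodule.span_le.2 ?_
    rintro _ ⟨b, hb, i, rfl⟩
    have := (mul_row_mem_EE (ih hb) i).1
    push_cast
    exact this

lemma Fdn_le (a : ℝ) (n : ℕ) : Fdn q a n ≤ EE q a (-n) := by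
  induction n with
  | zero => intro x hx; exact (EE_zero a).2 (GB_le a hx)
  | succ n ih =>
    refine Submodule.span_le.2 ?_
    rintro _ ⟨b, hb, i, rfl⟩
    have := (mul_row_mem_EE (ih hb) i).2
    push_cast
    rwa [neg_add]

lemma mul_row_mem_Fup {a : ℝ} {n : ℕ} {b : OqSU2 q} (hb : b ∈ Fup q a (n + 1)) (j : Fin 2) :
    b * row q (-(qm q a (n + 1))⁻¹) j ∈ Fup q a n := by
  induction n generalizing b j with
  | zero =>
    rw [Fup] at hb
    induction hb using Submodule.span_induction with
    | zero => rw [zero_mul]; exact zero_mem _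
    | add x y _ _ hx hy => rw [add_mul]; exact add_mem hx hy
    | smul c x _ hx => rw [smul_mul_assoc]; exact Submodule.smul_mem _ _ hx
    | mem x hx =>
      obtain ⟨b, hb, i, rfl⟩ := hx
      have : row q (qm q a 0) i * row q (-(qm q a (0 + 1))⁻¹) j = GG q a i j := by
        rw [qm_add_one, qm_zero, GG]
      rw [mul_assoc, Nat.cast_zero, this]
      exact (GB q a).mul_mem hb (GG_mem_GB a i j)
  | succ n ih =>
    rw [Fup] at hb
    induction hb using Submodule.span_induction with
    | zero => rw [zero_mul]; exact zero_mem _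
    | add x y _ _ hx hy => rw [add_mul]; exact add_mem hx hy
    | smul c x _ hx => rw [smul_mul_assoc]; exact Submodule.smul_mem _ _ hx
    | mem x hx =>
      obtain ⟨b, hb, i, rfl⟩ := hx
      obtain ⟨c, hc⟩ := row_flip (q := q) (qm_ne q a (n + 1)) i j
      rw [mul_assoc, Nat.cast_succ, qm_add_one a (n + 1), hc, mul_add, ← mul_assoc, ← Algebra.commutes, ← Algebra.smul_def,
        ← qm_sub_one, add_sub_cancel_right]
      exact add_mem (Submodule.subset_span ⟨_, ih hb i, j, rfl⟩) (Submodule.smul_mem _ _ hb)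

lemma mul_row_mem_Fdn {a : ℝ} {n : ℕ} {b : OqSU2 q} (hb : b ∈ Fdn q a (n + 1)) (j : Fin 2) :
    b * row q (qm q a (-(n + 1))) j ∈ Fdn q a n := by
  have hq := qc_ne q
  have flip (m : ℤ) (i j : Fin 2) : ∃ c : ℂ, row q (-(qm q a m)⁻¹) i * row q (qm q a (m - 1)) j =
      row q (qm q a m) i * row q (-(qm q a (m + 1))⁻¹) j + algebraMap ℂ _ c := by
    obtain ⟨c, hc⟩ := row_flip (q := q) (qm_ne q a m) i j
    refine ⟨-c, ?_⟩
    rw [qm_add_one, qm_sub_one, hc, map_neg]; abel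
  induction n generalizing b j with
  | zero =>
    rw [Fdn] at hb
    induction hb using Submodule.span_induction with
    | zero => rw [zero_mul]; exact zero_mem _
    | add x y _ _ hx hy => rw [add_mul]; exact add_mem hx hy
    | smul c x _ hx => rw [smul_mul_assoc]; exact Submodule.smul_mem _ _ hx
    | mem x hx =>
      obtain ⟨b, hb, i, rfl⟩ := hx
      obtain ⟨c, hc⟩ := flip 0 i j
      have : row q (qm q a 0) i * row q (-(qm q a (0 + 1))⁻¹) j = GG q a i j := by
        rw [qm_add_one, qm_zero, GG]
      rw [this, zero_sub] at hc
      rw [mul_assoc, Nat.cast_zero, zero_add, neg_zero, hc]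
      exact (GB q a).mul_mem hb (add_mem (GG_mem_GB a i j) (algebraMap_mem _ _))
  | succ n ih =>
    rw [Fdn] at hb
    induction hb using Submodule.span_induction with
    | zero => rw [zero_mul]; exact zero_mem _
    | add x y _ _ hx hy => rw [add_mul]; exact add_mem hx hy
    | smul c x _ hx => rw [smul_mul_assoc]; exact Submodule.smul_mem _ _ hx
    | mem x hx =>
      obtain ⟨b, hb, i, rfl⟩ := hx
      obtain ⟨c, hc⟩ := flip (-(n + 1)) i j
      push_cast
      rw [mul_assoc, show (-((n : ℤ) + 1 + 1)) = -(n + 1) - 1 by ring, hc, mul_add, ← mul_assoc,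
        ← Algebra.commutes, ← Algebra.smul_def, show -((n : ℤ) + 1) + 1 = -n by ring]
      exact add_mem (Submodule.subset_span ⟨_, ih hb i, j, rfl⟩) (Submodule.smul_mem _ _ hb)

/-- The Podleś sphere is generated by the elements `GG q a i j`: the spaces `Fup` and `Fdn` span
`O_q(SU(2))`, and only the term of index `0` contributes to the weight `[a]`. -/
lemma podles_eq_GB (a : ℝ) : podles q a = GB q a := by
  set T := ⨆ n, Fup q a n ⊔ Fdn q a n with hT
  have hup (n : ℕ) : Fup q a n ≤ T := le_sup_left.trans (le_iSup (fun n => Fup q a n ⊔ Fdn q a n) n)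
  have hdn (n : ℕ) : Fdn q a n ≤ T :=
    le_sup_right.trans (le_iSup (fun n => Fup q a n ⊔ Fdn q a n) n)
  have hT' : T = ⊤ := by
    refine eq_top_of_mul_uMat_mem (hup 0 (one_mem (GB q a))) fun v hv i j => ?_
    induction hv using Submodule.iSup_induction' with
    | zero => rw [zero_mul]; exact zero_mem _
    | add x y _ _ hx hy => rw [add_mul]; exact add_mem hx hy
    | mem n b hb =>
      obtain ⟨x, hx, y, hy, rfl⟩ := Submodule.mem_sup.1 hb
      rw [add_mul]
      refine add_mem (mul_uMat_mem (a := a) (m := n)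
          (hup (n + 1) (Submodule.subset_span ⟨x, hx, i, rfl⟩)) ?_ j)
        (mul_uMat_mem (a := a) (m := -n) ?_
          (hdn (n + 1) (Submodule.subset_span ⟨y, hy, i, rfl⟩)) j)
      · cases n with
        | zero => exact hdn 1 (Submodule.subset_span ⟨x, hx, i, by simp⟩)
        | succ n => push_cast; exact hup n (mul_row_mem_Fup hx i)
      · cases n with
        | zero => exact hup 1 (Submodule.subset_span ⟨y, hy, i, by simp⟩)
        | succ n => push_cast; exact hdn n (mul_row_mem_Fdn hy i)
  refine le_antisymm (fun x hx => ?_) (GB_le a)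
  obtain ⟨P, hP1, hP2, -, -⟩ := exists_projections _ (iSupIndep_EE (q := q) a) (iSup_EE a)
  have key : ∀ v ∈ T, P 0 v ∈ GB q a := by
    intro v hv
    induction hv using Submodule.iSup_induction' with
    | zero => rw [map_zero]; exact zero_mem _
    | add x y _ _ hx hy => rw [map_add]; exact add_mem hx hy
    | mem n b hb =>
      obtain ⟨x, hx, y, hy, rfl⟩ := Submodule.mem_sup.1 hb
      rw [map_add]
      cases n with
      | zero =>
        rw [hP1 0 x ((EE_zero a).2 (GB_le a hx)), hP1 0 y ((EE_zero a).2 (GB_le a hy))]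
        exact add_mem hx hy
      | succ n =>
        rw [hP2 0 _ (by push_cast; omega) x (Fup_le a _ hx),
          hP2 0 _ (by push_cast; omega) y (Fdn_le a _ hy), add_zero]
        exact zero_mem _
  have := key x (by rw [hT']; trivial)
  rwa [hP1 0 x ((EE_zero a).2 hx)] at this

/-! ### The elements `T_c^±` and `A_c` as products of linear elements -/

/-- The product of two linear elements that lies in the Podleś sphere. -/
def LL (q : QParam) (a : ℝ) (W W' : ℂ) : OqSU2 q :=
  lin q W (qpow q a) * lin q W' (-(qc q * qpow q a)⁻¹)

lemma LL_mem (a : ℝ) (W W' : ℂ) : LL q a W W' ∈ podles q a := by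
  have : LL q a W W' = GG q a 0 0 + (Complex.I * W') • GG q a 0 1 + (Complex.I * W) • GG q a 1 0
      + (Complex.I * W * (Complex.I * W')) • GG q a 1 1 := by
    simp only [LL, lin, GG, mul_add, add_mul, smul_mul_assoc, mul_smul_comm, smul_smul]
    module
  rw [this]
  exact add_mem (add_mem (add_mem (GG_mem a _ _) (Subalgebra.smul_mem _ (GG_mem a _ _) _))
    (Subalgebra.smul_mem _ (GG_mem a _ _) _)) (Subalgebra.smul_mem _ (GG_mem a _ _) _)

/-- The multiple of `T_c^+` with coefficient `1` at `α²`; here `C = q^c`. -/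
def Tp (q : QParam) (a : ℝ) (C : ℂ) : podles q a := ⟨LL q a C⁻¹ (qc q / C), LL_mem a _ _⟩

/-- The multiple of `T_c^-` with coefficient `1` at `α²`; here `C = q^c`. -/
def Tm (q : QParam) (a : ℝ) (C : ℂ) : podles q a := ⟨LL q a (-C) (-(qc q * C)), LL_mem a _ _⟩

/-- The element `q (A_c + {a + c + 1})`; here `C = q^c`. -/
def At (q : QParam) (a : ℝ) (C : ℂ) : podles q a :=
  ⟨LL q a (-(qc q ^ 2 * C)) (qc q / C), LL_mem a _ _⟩

/-- `{a + 1}`. -/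
def sa1 (q : QParam) (a : ℝ) : ℂ := qc q * qpow q a + (qc q * qpow q a)⁻¹

/-- `{1}`. -/
def s1 (q : QParam) : ℂ := qc q + (qc q)⁻¹

lemma s1_ne : s1 q ≠ 0 := by
  have := qpow_add_inv_ne (q := q) 1
  rwa [qpow_one] at this

/-- The generator `X` of the Podleś sphere. -/
def PX (q : QParam) (a : ℝ) : podles q a := ⟨GG q a 0 0, GG_mem a _ _⟩

/-- The generator `X*` of the Podleś sphere. -/
def PY (q : QParam) (a : ℝ) : podles q a := qc q • ⟨GG q a 1 1, GG_mem a _ _⟩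

/-- The self-adjoint generator of the Podleś sphere, normalized so that it has no constant term
in the formulas for `T_c^±`. -/
def PZ (q : QParam) (a : ℝ) : podles q a :=
  (Complex.I * qc q) • ⟨GG q a 1 0, GG_mem a _ _⟩ +
    algebraMap ℂ _ (qc q * sa1 q a / s1 q)

/-- The elements `LL` are affine combinations of the three generators. -/
lemma LL_eq (a : ℝ) (W W' : ℂ) : LL q a W W' = (PX q a + (W' + W / qc q) • PZ q a
    - (W * W' / qc q) • PY q a +
      algebraMap ℂ _ (sa1 q a * (W' - qc q * (W' + W / qc q) / s1 q)) : podles q a) := by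
  have hq := qc_ne q
  have hs := s1_ne (q := q)
  have h1 : LL q a W W' = GG q a 0 0 + (Complex.I * W') • GG q a 0 1
      + (Complex.I * W) • GG q a 1 0 - (W * W') • GG q a 1 1 := by
    simp only [LL, lin, GG, mul_add, add_mul, smul_mul_assoc, mul_smul_comm, smul_smul]
    match_scalars <;> ring_nf
    simp
  have h2 : GG q a 0 1 = qc q • GG q a 1 0 - algebraMap ℂ _ (Complex.I * sa1 q a) := by
    rw [GG, row_zero_mul_row_one, sa1, GG, sub_eq_add_neg, sub_eq_add_neg, ← map_neg]
    congr 2; ring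
  rw [h1, h2]
  simp only [PX, PY, PZ, Subalgebra.coe_add, Subalgebra.coe_sub, Subalgebra.coe_smul,
    Subalgebra.coe_algebraMap, Algebra.algebraMap_eq_smul_one, smul_sub, smul_add, smul_smul]
  match_scalars <;> field_simp
  ring_nf
  simp only [Complex.I_sq]
  ring

lemma Tp_eq (a : ℝ) {C : ℂ} (hC : C ≠ 0) :
    Tp q a C = PX q a + (s1 q / C) • PZ q a - (C ^ 2)⁻¹ • PY q a := by
  have hq := qc_ne q
  have hs := s1_ne (q := q)
  ext1
  change LL q a _ _ = _
  rw [LL_eq]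
  congr 1
  have e : qc q / C - qc q * (qc q / C + C⁻¹ / qc q) / s1 q = 0 := by
    rw [sub_eq_zero, eq_div_iff hs, s1]; field_simp
  rw [e, mul_zero, map_zero, add_zero]
  congr 2
  · rw [s1]; field_simp
  · congr 1; field_simp

lemma Tm_eq (a : ℝ) {C : ℂ} (hC : C ≠ 0) :
    Tm q a C = PX q a - (s1 q * C) • PZ q a - C ^ 2 • PY q a := by
  have hq := qc_ne q
  have hs := s1_ne (q := q)
  ext1
  change LL q a _ _ = _
  rw [LL_eq]
  congr 1
  have e : -(qc q * C) - qc q * (-(qc q * C) + -C / qc q) / s1 q = 0 := by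
    rw [sub_eq_zero, eq_div_iff hs, s1]; field_simp; ring
  rw [e, mul_zero, map_zero, add_zero, sub_eq_add_neg (PX q a), ← neg_smul]
  congr 2
  · rw [s1]; field_simp
    ring_nf
  · congr 1; field_simp

/-- The constant term of `At`. -/
def atc (q : QParam) (a : ℝ) (C : ℂ) : ℂ :=
  sa1 q a * (qc q / C - qc q * (qc q * (C⁻¹ - C)) / s1 q)

lemma At_eq (a : ℝ) {C : ℂ} (hC : C ≠ 0) :
    At q a C = PX q a - (qc q * (C - C⁻¹)) • PZ q a + qc q ^ 2 • PY q a +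
      algebraMap ℂ _ (atc q a C) := by
  have hq := qc_ne q
  have hs := s1_ne (q := q)
  ext1
  change LL q a _ _ = _
  rw [LL_eq, atc]
  have e : qc q / C + -(qc q ^ 2 * C) / qc q = -(qc q * (C - C⁻¹)) := by field_simp; ring
  have e' : -(qc q ^ 2 * C) * (qc q / C) / qc q = -qc q ^ 2 := by field_simp
  rw [e, e', neg_smul, neg_smul, sub_neg_eq_add, ← sub_eq_add_neg,
    show -(qc q * (C - C⁻¹)) = qc q * (C⁻¹ - C) by ring]

lemma star_PX (a : ℝ) : star (PX q a) = PY q a := by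
  have hq := qc_ne q
  have hr := qpow_ne q a
  have hcr : conj (qpow q a) = qpow q a := Complex.conj_ofReal _
  ext1
  change star (GG q a 0 0) = qc q • GG q a 1 1
  simp only [GG, row, uMat, Matrix.cons_val_zero, Matrix.cons_val_one, Matrix.cons_val_fin_one,
    star_mul, star_add, star_sub, star_one, star_smul, star_neg, star_x, starGen,
    ← starRingEnd_apply, map_mul, map_neg,
    map_inv₀, conj_qc, Complex.conj_I, hcr,
    mul_add, add_mul, neg_mul, mul_neg, smul_neg, neg_smul, neg_neg, inv_neg,
    smul_mul_assoc, mul_smul_comm, als_al, al_als, gas_ga, al_ga, al_gas, als_gas, als_ga,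
    smul_add, smul_sub, smul_smul]
  match_scalars
  all_goals field_simp
  all_goals try ring_nf
  all_goals try simp only [Complex.I_sq]
  all_goals try ring_nf

lemma podles_star_add {a : ℝ} (b c : podles q a) : star (b + c) = star b + star c :=
  Subtype.ext (star_add (b : OqSU2 q) c)

lemma podles_star_mul {a : ℝ} (b c : podles q a) : star (b * c) = star c * star b :=
  Subtype.ext (star_mul (b : OqSU2 q) c)

lemma podles_star_star {a : ℝ} (b : podles q a) : star (star b) = b :=
  Subtype.ext (star_star (b : OqSU2 q))

lemma podles_star_algebraMap {a : ℝ} (r : ℂ) :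
    star (algebraMap ℂ (podles q a) r) = algebraMap ℂ _ (conj r) :=
  Subtype.ext (star_algebraMap r)

lemma star_PZ (a : ℝ) : star (PZ q a) = PZ q a := by
  have hq := qc_ne q
  have hr := qpow_ne q a
  have hs := s1_ne (q := q)
  have hcr : conj (qpow q a) = qpow q a := Complex.conj_ofReal _
  ext1
  change star ((Complex.I * qc q) • GG q a 1 0 + algebraMap ℂ _ (qc q * sa1 q a / s1 q))
    = (Complex.I * qc q) • GG q a 1 0 + algebraMap ℂ _ (qc q * sa1 q a / s1 q)
  have e : conj (qc q * sa1 q a / s1 q) = qc q * sa1 q a / s1 q := by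
    simp [sa1, s1, hcr]
  rw [star_add, star_algebraMap, e]
  congr 1
  simp only [GG, row, uMat, Matrix.cons_val_zero, Matrix.cons_val_one, Matrix.cons_val_fin_one,
    star_mul, star_add, star_sub, star_one, star_smul, star_neg, star_x, starGen,
    ← starRingEnd_apply, map_mul, map_neg,
    map_inv₀, conj_qc, Complex.conj_I, hcr,
    mul_add, add_mul, neg_mul, mul_neg, smul_neg, neg_smul, neg_neg, inv_neg,
    smul_mul_assoc, mul_smul_comm, als_al, al_als, gas_ga, al_ga, al_gas, als_gas, als_ga,
    smul_add, smul_sub, smul_smul]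
  match_scalars
  all_goals field_simp
  all_goals try ring_nf
  all_goals try simp only [Complex.I_sq]
  all_goals try ring_nf

lemma conj_qpow (c : ℝ) : conj (qpow q c) = qpow q c := Complex.conj_ofReal _

lemma qpow_half : qpow q (1 / 2) = sq q := by
  rw [qpow, sq, Real.sqrt_eq_rpow]

lemma emb_xiPlus (c : ℝ) : emb q (xiPlus q c) =
    ![![-((qpow q c)⁻¹ * (sq q)⁻¹), -(Complex.I * sq q)],
      ![-(Complex.I * (sq q)⁻¹), qpow q c * sq q]] := by
  have h1 := sq_ne q
  have h2 := sd_ne (q := q)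
  have e1 : qpow q (-c - 1 / 2) = (qpow q c)⁻¹ * (sq q)⁻¹ := by
    rw [sub_eq_add_neg, qpow_add, qpow_neg, qpow_neg, qpow_half]
  ext i j
  fin_cases i <;> fin_cases j <;> simp [emb, xiPlus, e1, qpow_add, -one_div, qpow_half]
  · field_simp
  · field_simp

lemma emb_xiMinus (c : ℝ) : emb q (xiMinus q c) =
    ![![qpow q c * (sq q)⁻¹, -(Complex.I * sq q)],
      ![-(Complex.I * (sq q)⁻¹), -((qpow q c)⁻¹ * sq q)]] := by
  have h1 := sq_ne q
  have h2 := sd_ne (q := q)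
  have e1 : qpow q (c - 1 / 2) = qpow q c * (sq q)⁻¹ := by
    rw [sub_eq_add_neg, qpow_add, qpow_neg, qpow_half]
  ext i j
  fin_cases i <;> fin_cases j <;> simp [emb, xiMinus, e1, qpow_add, -one_div, qpow_half, qpow_neg]
  · field_simp
  · field_simp

lemma emb_xi' (c : ℝ) : emb q (xi q c) =
    ![![sq q, sq q * (Complex.I * (qpow q c - (qpow q c)⁻¹) / s1 q)],
      ![(sq q)⁻¹ * (Complex.I * (qpow q c - (qpow q c)⁻¹) / s1 q), (sq q)⁻¹]] := by
  have h1 := sq_ne q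
  have h2 := sd_ne (q := q)
  have h3 : s1 q = sd q ^ 2 := sd_sq.symm
  rw [h3]
  ext i j
  fin_cases i <;> fin_cases j <;> simp [emb, xi, qd_eq] <;> field_simp

lemma conj_s1 : conj (s1 q) = s1 q := by simp [s1]

lemma s1_eq : s1 q = (sq q ^ 4 + 1) / sq q ^ 2 ∧ sq q ^ 4 + 1 ≠ 0 := by
  have hq := sq_ne q
  have hs := s1_ne (q := q)
  have e : s1 q = (sq q ^ 4 + 1) / sq q ^ 2 := by rw [s1, ← sq_sq]; field_simp
  refine ⟨e, fun h => hs ?_⟩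
  rw [e, h, zero_div]

lemma Tplus_eq (a c : ℝ) : Tplus q a c = qpow q c • Tp q a (qpow q c) := by
  have hq := sq_ne q
  have hr := qpow_ne q a
  have hC := qpow_ne q c
  obtain ⟨hs, hs'⟩ := s1_eq (q := q)
  ext1
  change star (u1 q (xiPlus q c) (xi q a)) = qpow q c • LL q a _ _
  simp only [u1, Fin.sum_univ_two, emb_xiPlus, emb_xi', LL, lin, row, uMat,
    Matrix.cons_val_zero, Matrix.cons_val_one, Matrix.cons_val_fin_one,
    star_mul, star_add, star_sub, star_one, star_smul, star_neg, star_x, starGen,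
    ← starRingEnd_apply, map_mul, map_neg, map_one, map_pow,
    map_inv₀, map_sub, map_div₀, conj_qc, Complex.conj_I, conj_qpow, Complex.conj_conj, conj_sq,
    mul_add, add_mul, neg_mul, mul_neg, smul_neg, neg_smul, neg_neg, inv_neg, mul_sub, sub_mul,
    smul_mul_assoc, mul_smul_comm, als_al, al_als, gas_ga, al_ga, al_gas, als_gas, als_ga,
    smul_add, smul_sub, smul_smul, conj_s1, Algebra.algebraMap_eq_smul_one]
  simp only [hs, ← sq_sq]
  match_scalars
  all_goals field_simp
  all_goals try ring_nf
  all_goals try simp only [Complex.I_sq, Complex.I_pow_four]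
  all_goals try ring_nf

lemma Tminus_eq (a c : ℝ) : Tminus q a c = -(qpow q c)⁻¹ • Tm q a (qpow q c) := by
  have hq := sq_ne q
  have hr := qpow_ne q a
  have hC := qpow_ne q c
  obtain ⟨hs, hs'⟩ := s1_eq (q := q)
  ext1
  change star (u1 q (xiMinus q c) (xi q a)) = -(qpow q c)⁻¹ • LL q a _ _
  simp only [u1, Fin.sum_univ_two, emb_xiMinus, emb_xi', LL, lin, row, uMat,
    Matrix.cons_val_zero, Matrix.cons_val_one, Matrix.cons_val_fin_one,
    star_mul, star_add, star_sub, star_one, star_smul, star_neg, star_x, starGen,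
    ← starRingEnd_apply, map_mul, map_neg, map_one, map_pow,
    map_inv₀, map_sub, map_div₀, conj_qc, Complex.conj_I, conj_qpow, Complex.conj_conj, conj_sq,
    mul_add, add_mul, neg_mul, mul_neg, smul_neg, neg_smul, neg_neg, inv_neg, mul_sub, sub_mul,
    smul_mul_assoc, mul_smul_comm, als_al, al_als, gas_ga, al_ga, al_gas, als_gas, als_ga,
    smul_add, smul_sub, smul_smul, conj_s1, Algebra.algebraMap_eq_smul_one]
  simp only [hs, ← sq_sq]
  match_scalars
  all_goals field_simp
  all_goals try ring_nf
  all_goals try simp only [Complex.I_sq, Complex.I_pow_four]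
  all_goals try ring_nf

lemma Ac_eq (a c : ℝ) : Ac q a c = (qc q)⁻¹ • At q a (qpow q c) -
    algebraMap ℂ _ (qc q * qpow q a * qpow q c + (qc q * qpow q a * qpow q c)⁻¹) := by
  have hq := sq_ne q
  have hr := qpow_ne q a
  have hC := qpow_ne q c
  obtain ⟨hs, hs'⟩ := s1_eq (q := q)
  have e : ((((q : ℝ) + (q : ℝ)⁻¹)⁻¹ * qd q c * qd q a : ℝ) : ℂ) =
      (s1 q)⁻¹ * (qpow q c - (qpow q c)⁻¹) * (qpow q a - (qpow q a)⁻¹) := by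
    rw [← qd_eq, ← qd_eq, s1, qc]; push_cast; rfl
  have e1 : Ac q a c = ⟨star (u1 q (xi q c) (xi q a)), star_mem_podles (u1_mem a _)⟩ -
      algebraMap ℂ _ ((((q : ℝ) + (q : ℝ)⁻¹)⁻¹ * qd q c * qd q a : ℝ) : ℂ) := rfl
  rw [e1, e, sub_eq_iff_eq_add]
  ext1
  rw [Subalgebra.coe_add, Subalgebra.coe_sub, Subalgebra.coe_smul, Subalgebra.coe_algebraMap,
    Subalgebra.coe_algebraMap, show (At q a (qpow q c) : OqSU2 q) = LL q a _ _ from rfl]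
  simp only [u1, Fin.sum_univ_two, emb_xi', LL, lin, row, uMat,
    Matrix.cons_val_zero, Matrix.cons_val_one, Matrix.cons_val_fin_one,
    star_mul, star_add, star_sub, star_one, star_smul, star_neg, star_x, starGen,
    ← starRingEnd_apply, map_mul, map_neg, map_one, map_pow,
    map_inv₀, map_sub, map_div₀, conj_qc, Complex.conj_I, conj_qpow, Complex.conj_conj, conj_sq,
    mul_add, add_mul, neg_mul, mul_neg, smul_neg, neg_smul, neg_neg, inv_neg, mul_sub, sub_mul,
    smul_mul_assoc, mul_smul_comm, als_al, al_als, gas_ga, al_ga, al_gas, als_gas, als_ga,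
    smul_add, smul_sub, smul_smul, conj_s1, mul_one, Algebra.algebraMap_eq_smul_one]
  simp only [hs, ← sq_sq]
  match_scalars
  all_goals field_simp
  all_goals try ring_nf
  all_goals try simp only [Complex.I_sq, Complex.I_pow_four]
  all_goals try ring_nf

/-! ### Relations between `T_c^±`, `A_c` and `B_t` -/

/-- `{a}`. -/
def sa (q : QParam) (a : ℝ) : ℂ := qpow q a + (qpow q a)⁻¹

lemma lin_flip_in (a : ℝ) (W W' : ℂ) : lin q W (qpow q a) * lin q W' (-(qc q * qpow q a)⁻¹) =
    lin q (qc q * W') (qpow q a) * lin q (W / qc q) (-(qc q * qpow q a)⁻¹) -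
      algebraMap ℂ _ ((W / qc q - W') * sa1 q a) := by
  rw [lin_flip, show (W / qc q - W') * (-(qc q * qpow q a)⁻¹ - qc q * qpow q a) =
    -((W / qc q - W') * sa1 q a) by rw [sa1]; ring, map_neg, ← sub_eq_add_neg]

lemma lin_flip_out (a : ℝ) (W W' : ℂ) : lin q W (-(qc q * qpow q a)⁻¹) * lin q W' (qpow q a) =
    lin q (qc q * W') (-(qc q * qpow q a)⁻¹) * lin q (W / qc q) (qpow q a) +
      algebraMap ℂ _ ((W / qc q - W') * sa q a) := by
  have hq := qc_ne q
  have hr := qpow_ne q a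
  rw [lin_flip, sa]; congr 3; field_simp; ring

/-- Flipping the two middle factors of a product of two elements of the Podleś sphere. -/
lemma LL_mul_LL (a : ℝ) (V V' W W' : ℂ) : LL q a V V' * LL q a W W' =
    LL q a V (qc q * W) * LL q a (V' / qc q) W' + ((V' / qc q - W) * sa q a) • LL q a V W' := by
  have h : LL q a V V' * LL q a W W' = lin q V (qpow q a) *
      (lin q V' (-(qc q * qpow q a)⁻¹) * lin q W (qpow q a)) *
      lin q W' (-(qc q * qpow q a)⁻¹) := by simp only [LL, mul_assoc]
  rw [h, lin_flip_out, mul_add, add_mul, ← Algebra.commutes, ← Algebra.smul_def, smul_mul_assoc]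
  simp only [LL, mul_assoc]

lemma LL_flip (a : ℝ) (W W' : ℂ) : LL q a W W' =
    LL q a (qc q * W') (W / qc q) - algebraMap ℂ _ ((W / qc q - W') * sa1 q a) := lin_flip_in a W W'

/-- `T_{c+2}^- T_c^+` is a quadratic polynomial in `A_c`. -/
lemma Tm_mul_Tp (a : ℝ) {C : ℂ} (hC : C ≠ 0) : Tm q a (qc q ^ 2 * C) * Tp q a C =
    At q a C * At q a C - ((qc q ^ 2 * C + C⁻¹) * sa q a) • At q a C := by
  have hq := qc_ne q
  ext1
  change LL q a _ _ * LL q a _ _ = LL q a _ _ * LL q a _ _ - _ • LL q a _ _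
  have e1 : qc q * C⁻¹ = qc q / C := by field_simp
  have e2 : -(qc q * (qc q ^ 2 * C)) / qc q = -(qc q ^ 2 * C) := by field_simp
  rw [LL_mul_LL, e1, e2, show (-(qc q ^ 2 * C) - C⁻¹) * sa q a =
    -((qc q ^ 2 * C + C⁻¹) * sa q a) by ring, neg_smul, ← sub_eq_add_neg]

lemma At_mul_Tp (a : ℝ) {C : ℂ} (hC : C ≠ 0) : At q a (qc q ^ 2 * C) * Tp q a C =
    Tp q a C * At q a C + ((qc q ^ 3 * C + (qc q * C)⁻¹) * sa1 q a
      - (qc q ^ 2 * C + C⁻¹) * sa q a) • Tp q a C := by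
  have hq := qc_ne q
  ext1
  change LL q a _ _ * LL q a _ _ = LL q a _ _ * LL q a _ _ + _ • LL q a _ _
  rw [LL_flip, sub_mul, ← Algebra.smul_def, LL_mul_LL, sub_eq_add_neg, ← neg_smul, add_assoc]
  have e1 : qc q * (qc q / (qc q ^ 2 * C)) = C⁻¹ := by field_simp
  have e2 : qc q * C⁻¹ = qc q / C := by field_simp
  have e3 : -(qc q ^ 2 * (qc q ^ 2 * C)) / qc q / qc q = -(qc q ^ 2 * C) := by field_simp
  rw [e1, e2, e3]
  match_scalars <;> field_simp <;> ring

lemma At_eq_LL (a : ℝ) {C : ℂ} (hC : C ≠ 0) : (At q a C : OqSU2 q) =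
    LL q a (qc q ^ 2 / C) (-(qc q * C)) + algebraMap ℂ _ (qc q * (C + C⁻¹) * sa1 q a) := by
  have hq := qc_ne q
  change LL q a _ _ = _
  have e1 : qc q * (qc q / C) = qc q ^ 2 / C := by field_simp
  have e2 : -(qc q ^ 2 * C) / qc q = -(qc q * C) := by field_simp
  rw [LL_flip, e1, e2, show (-(qc q * C) - qc q / C) * sa1 q a =
    -(qc q * (C + C⁻¹) * sa1 q a) by field_simp; ring, map_neg, sub_neg_eq_add]

lemma Tp_mul_Tm (a : ℝ) {C : ℂ} (hC : C ≠ 0) : Tp q a (C / qc q ^ 2) * Tm q a C =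
    (At q a C - algebraMap ℂ _ (qc q * (C + C⁻¹) * sa1 q a)) *
      (At q a C - algebraMap ℂ _ (qc q * (C + C⁻¹) * sa1 q a) +
        algebraMap ℂ _ ((C + qc q ^ 2 * C⁻¹) * sa q a)) := by
  have hq := qc_ne q
  have h : ((At q a C - algebraMap ℂ _ (qc q * (C + C⁻¹) * sa1 q a) : podles q a) : OqSU2 q) =
      LL q a (qc q ^ 2 / C) (-(qc q * C)) := by
    rw [Subalgebra.coe_sub, At_eq_LL a hC]; simp
  ext1
  rw [Subalgebra.coe_mul, Subalgebra.coe_mul, Subalgebra.coe_add, h, mul_add,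
    Subalgebra.coe_algebraMap, ← Algebra.commutes, ← Algebra.smul_def]
  change LL q a _ _ * LL q a _ _ = _
  have e1 : qc q * (-C) = -(qc q * C) := by ring
  have e2 : qc q / (C / qc q ^ 2) / qc q = qc q ^ 2 / C := by field_simp
  have e3 : (C / qc q ^ 2)⁻¹ = qc q ^ 2 / C := by field_simp
  rw [LL_mul_LL, e1, e2, e3]
  congr 3
  field_simp
  ring

lemma At_mul_Tm (a : ℝ) {C : ℂ} (hC : C ≠ 0) : At q a (C / qc q ^ 2) * Tm q a C =
    Tm q a C * (At q a C - algebraMap ℂ _ (qc q * (C + C⁻¹) * sa1 q a) +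
        algebraMap ℂ _ ((C + qc q ^ 2 * C⁻¹) * sa q a)) := by
  have hq := qc_ne q
  have h : ((At q a C - algebraMap ℂ _ (qc q * (C + C⁻¹) * sa1 q a) : podles q a) : OqSU2 q) =
      LL q a (qc q ^ 2 / C) (-(qc q * C)) := by
    rw [Subalgebra.coe_sub, At_eq_LL a hC]; simp
  ext1
  rw [Subalgebra.coe_mul, Subalgebra.coe_mul, Subalgebra.coe_add, h, mul_add,
    Subalgebra.coe_algebraMap, ← Algebra.commutes, ← Algebra.smul_def]
  change LL q a _ _ * LL q a _ _ = LL q a _ _ * _ + _ • LL q a _ _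
  have e1 : qc q * (-C) = -(qc q * C) := by ring
  have e2 : qc q / (C / qc q ^ 2) / qc q = qc q ^ 2 / C := by field_simp
  have e3 : -(qc q ^ 2 * (C / qc q ^ 2)) = -C := by field_simp
  rw [LL_mul_LL, e1, e2, e3]
  congr 3
  field_simp
  ring

/-- A coproduct formula for a functional gives a twisted Leibniz rule for its right action. -/
lemma ract_prod (h h₁ h₂ h₃ h₄ : Dual q)
    (H : ∀ a b, h (a * b) = h₁ a * h₂ b + h₃ a * h₄ b) (a b : OqSU2 q) :
    ract h (a * b) = ract h₁ a * ract h₂ b + ract h₃ a * ract h₄ b := by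
  have key : ∀ X Y : OqSU2 q ⊗[ℂ] OqSU2 q,
      TensorProduct.lid ℂ _ (h.ofConv.rTensor (OqSU2 q) (X * Y)) =
      TensorProduct.lid ℂ _ (h₁.ofConv.rTensor (OqSU2 q) X) *
        TensorProduct.lid ℂ _ (h₂.ofConv.rTensor (OqSU2 q) Y) +
      TensorProduct.lid ℂ _ (h₃.ofConv.rTensor (OqSU2 q) X) *
        TensorProduct.lid ℂ _ (h₄.ofConv.rTensor (OqSU2 q) Y) := by
    intro X Y
    induction X with
    | zero => simp
    | add X X' hX hX' => simp only [map_add, add_mul, hX, hX']; abel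
    | tmul a b =>
      induction Y with
      | zero => simp
      | add X X' hX hX' => simp only [map_add, mul_add, hX, hX']; abel
      | tmul c d => simp [H, add_smul, smul_smul, mul_comm]
  have := key (comul a) (comul b)
  rw [← Bialgebra.comul_mul] at this
  exact this

lemma ract_add (h k : Dual q) (a : OqSU2 q) : ract (h + k) a = ract h a + ract k a := by
  simp [ract, LinearMap.rTensor_add]

lemma ract_smul (c : ℂ) (h : Dual q) (a : OqSU2 q) : ract (c • h) a = c • ract h a := by
  simp [ract, LinearMap.rTensor_smul]

lemma ract_one (a : OqSU2 q) : ract (1 : Dual q) a = a := by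
  have : (1 : Dual q).ofConv = counit := by ext; simp [LinearMap.convOne_def]
  simp [ract, this]

lemma counit_lact (h : Dual q) (x : OqSU2 q) : counit (R := ℂ) (lact h x) = h x := by
  have key : ∀ X : OqSU2 q ⊗[ℂ] OqSU2 q,
      counit (R := ℂ) (TensorProduct.rid ℂ _ (h.ofConv.lTensor (OqSU2 q) X)) =
        h (TensorProduct.lid ℂ _ ((counit (R := ℂ)).rTensor (OqSU2 q) X)) := by
    intro X
    induction X with
    | zero => simp
    | add X Y hX hY => simp only [map_add, hX, hY]
    | tmul a b => simp [mul_comm]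
  have := key (comul x)
  rw [Coalgebra.rTensor_counit_comul] at this
  rw [TensorProduct.lid_tmul, one_smul] at this
  exact this

lemma Bt_mul_apply (a : ℝ) (b c : OqSU2 q) : Bt q a (b * c) =
    (Bt q a b + kap q a * counit (R := ℂ) b) * kinv q c + counit (R := ℂ) b * Bt q a c := by
  rw [← counit_lact _ (b * c), lact_Bt_mul]
  simp [Bialgebra.counit_mul, counit_lact]

lemma kinv_Sinv (y : OqSU2 q) : kinv q (Sinv q y) = k q y := by
  induction y using OqSU2.induction with
  | hC c => rw [Sinv_algebraMap, kinv_algebraMap, k_algebraMap]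
  | hx g =>
    rw [Sinv_x, k_x]
    cases g <;> simp [antipodeInvGen, kinv_x, kinvGen, kGen]
  | hmul a b ha hb => rw [Sinv_mul, kinv_mul, ha, hb, k_mul, mul_comm]
  | hadd a b ha hb => simp only [map_add, ha, hb]

lemma dualSinv_apply (h : Dual q) (y : OqSU2 q) : dualSinv h y = h (Sinv q y) := rfl

lemma dual_smul_apply (c : ℂ) (h : Dual q) (y : OqSU2 q) : (c • h) y = c * h y := rfl

lemma ract_Bt_mul (a : ℝ) (x y : OqSU2 q) : ract (dualSinv (Bt q a)) (x * y) =
    ract (k q) x * (ract (dualSinv (Bt q a)) y + kap q a • y) +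
      ract (dualSinv (Bt q a)) x * y := by
  rw [ract_prod (dualSinv (Bt q a)) (k q) (dualSinv (Bt q a) + kap q a • 1) (dualSinv (Bt q a)) 1,
    ract_add, ract_smul, ract_one]
  intro x y
  rw [dualSinv_apply, Sinv_mul, Bt_mul_apply, kinv_Sinv, dual_add_apply, dual_smul_apply,
    dual_one_apply, counit_Sinv, dualSinv_apply, dualSinv_apply]
  ring

lemma ract_uMat (h : Dual q) (i j : Fin 2) :
    ract h (uMat q i j) = ∑ l, h (uMat q i l) • uMat q l j := by
  have hq := qc_ne q
  fin_cases i <;> fin_cases j <;>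
    simp [uMat, ract, comul_x, comulGen, smul_smul, hq, mul_comm (qc q)] <;> abel

/-- The operator `x ↦ ([c] - [a]) (x ◁ k) + x ◁ S⁻¹(i B_t)`, up to the factor `i`, with
`μ = -i [c]`: it describes `i B_t` on `x v`, for `v` of weight `[c]`. -/
def wop (q : QParam) (a : ℝ) (μ : ℂ) : OqSU2 q →ₗ[ℂ] OqSU2 q :=
  (μ + kap q a) • ract (k q) + ract (dualSinv (Bt q a))

/-- If `y` moves the weight described by `μ` to the one described by `ν`, then the action on `x y v`
is the action on `x w` for a vector `w` of the new weight. -/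
lemma wop_mul {a : ℝ} {μ ν : ℂ} {y : OqSU2 q} (h : wop q a μ y = ν • y) (x : OqSU2 q) :
    wop q a μ (x * y) = wop q a ν x * y := by
  have h1 : ract (dualSinv (Bt q a)) y = ν • y - (μ + kap q a) • ract (k q) y := by
    rw [← h, wop]; simp
  have h2 : ract (k q) (x * y) = ract (k q) x * ract (k q) y := by
    have := ract_prod (k q) (k q) (k q) 0 0 (fun a b => by simp [k_mul]) x y
    simpa [ract] using this
  simp only [wop, LinearMap.add_apply, LinearMap.smul_apply, ract_Bt_mul, h1, h2, mul_add, mul_sub,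
    add_mul, smul_mul_assoc, mul_smul_comm]
  module

/-- `-i [c]` for `C = q^c`. -/
def mu (q : QParam) (C : ℂ) : ℂ := -(Complex.I * ((C - C⁻¹) / (qc q - (qc q)⁻¹)))

lemma ract_k_row (z : ℂ) (i : Fin 2) :
    ract (k q) (row q z i) = (![qc q, (qc q)⁻¹] : Fin 2 → ℂ) i • row q z i := by
  fin_cases i <;>
    simp [row, ract_uMat, Fin.sum_univ_two, smul_smul] <;> simp [uMat, k_x, kGen] <;> module

lemma Bt_uMat (a : ℝ) (i j : Fin 2) : Bt q a (uMat q i j) =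
    (![![-(kap q a * (qc q)⁻¹), -1], ![1, -(kap q a * qc q)]] : Fin 2 → Fin 2 → ℂ) i j := by
  rw [← counit_lact]
  fin_cases j
  · rw [show (⟨0, by decide⟩ : Fin 2) = 0 from rfl, lact_Bt_u0]
    fin_cases i <;> simp [uMat, counit_x, counitGen]
  · rw [show (⟨1, by decide⟩ : Fin 2) = 1 from rfl, lact_Bt_u1]
    fin_cases i <;> simp [uMat, counit_x, counitGen]

lemma ract_Bt_row (a : ℝ) (z : ℂ) :
    ract (dualSinv (Bt q a)) (row q z 0) = -(kap q a * qc q) • row q z 0 + qc q • row q z 1 ∧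
    ract (dualSinv (Bt q a)) (row q z 1) =
      -(qc q)⁻¹ • row q z 0 - (kap q a * (qc q)⁻¹) • row q z 1 := by
  have hq := qc_ne q
  have h00 : dualSinv (Bt q a) (uMat q 0 0) = -(kap q a * qc q) := by
    have := Bt_uMat (q := q) a 1 1
    rw [dualSinv_apply]; simpa [uMat, Sinv_x, antipodeInvGen] using this
  have h11 : dualSinv (Bt q a) (uMat q 1 1) = -(kap q a * (qc q)⁻¹) := by
    have := Bt_uMat (q := q) a 0 0
    rw [dualSinv_apply]; simpa [uMat, Sinv_x, antipodeInvGen] using this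
  have h10 : dualSinv (Bt q a) (uMat q 1 0) = -(qc q)⁻¹ := by
    have := Bt_uMat (q := q) a 1 0
    rw [dualSinv_apply]; simp [uMat] at this; simp [uMat, Sinv_x, antipodeInvGen, this]
  have h01 : dualSinv (Bt q a) (uMat q 0 1) = qc q := by
    have := Bt_uMat (q := q) a 0 1
    have e : Sinv q (uMat q 0 1) = -(qc q) • uMat q 0 1 := by
      simp [uMat, Sinv_x, antipodeInvGen]
    have e2 (c : ℂ) (x : OqSU2 q) : Bt q a (c • x) = c * Bt q a x := map_smul (Bt q a).ofConv c x
    rw [dualSinv_apply, e, e2, this]; simp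
  constructor <;>
  · simp only [row, map_add, map_smul, ract_uMat, Fin.sum_univ_two, h00, h01, h10, h11]
    module

lemma wop_lin (a : ℝ) (z : ℂ) {C : ℂ} (hC : C ≠ 0) :
    wop q a (mu q C) (lin q (qc q / C) z) = mu q (qc q * C) • lin q (qc q / C) z ∧
    wop q a (mu q C) (lin q (-(qc q * C)) z) = mu q (C / qc q) • lin q (-(qc q * C)) z := by
  have hq := qc_ne q
  have hd' : qc q ^ 2 - 1 ≠ 0 := by
    intro h; apply q_sub_ne (q := q); field_simp; linear_combination h
  constructor <;>
  · simp only [wop, lin, LinearMap.add_apply, LinearMap.smul_apply, map_add, map_smul, ract_k_row,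
      ract_Bt_row, Matrix.cons_val_zero, Matrix.cons_val_one, Matrix.cons_val_fin_one, mu]
    match_scalars <;> field_simp <;> ring_nf <;> simp only [Complex.I_sq] <;> ring

/-- `T_c^+` maps vectors of weight `[c]` to vectors of weight `[c + 2]`. -/
lemma wop_Tp (a : ℝ) {C : ℂ} (hC : C ≠ 0) :
    wop q a (mu q C) (Tp q a C) = mu q (qc q ^ 2 * C) • (Tp q a C : OqSU2 q) := by
  have hq := qc_ne q
  have h := (wop_lin (q := q) a (qpow q a) (mul_ne_zero hq hC)).1
  rw [show qc q / (qc q * C) = C⁻¹ by field_simp,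
    show qc q * (qc q * C) = qc q ^ 2 * C by ring] at h
  change wop q a (mu q C) (lin q _ _ * lin q _ _) = _ • (lin q _ _ * lin q _ _)
  rw [wop_mul (wop_lin a _ hC).1, h, smul_mul_assoc]

/-- `T_c^-` maps vectors of weight `[c]` to vectors of weight `[c - 2]`. -/
lemma wop_Tm (a : ℝ) {C : ℂ} (hC : C ≠ 0) :
    wop q a (mu q C) (Tm q a C) = mu q (C / qc q ^ 2) • (Tm q a C : OqSU2 q) := by
  have hq := qc_ne q
  have h := (wop_lin (q := q) a (qpow q a) (div_ne_zero hC hq)).2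
  rw [show qc q * (C / qc q) = C by field_simp,
    show C / qc q / qc q = C / qc q ^ 2 by field_simp] at h
  change wop q a (mu q C) (lin q _ _ * lin q _ _) = _ • (lin q _ _ * lin q _ _)
  rw [wop_mul (wop_lin a _ hC).2, h, smul_mul_assoc]

/-- `A_c` preserves the weight `[c]`. -/
lemma wop_At (a : ℝ) {C : ℂ} (hC : C ≠ 0) :
    wop q a (mu q C) (At q a C) = mu q C • (At q a C : OqSU2 q) := by
  have hq := qc_ne q
  have h := (wop_lin (q := q) a (qpow q a) (mul_ne_zero hq hC)).2
  rw [show qc q * (qc q * C) = qc q ^ 2 * C by ring,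
    show qc q * C / qc q = C by field_simp] at h
  change wop q a (mu q C) (lin q _ _ * lin q _ _) = _ • (lin q _ _ * lin q _ _)
  rw [wop_mul (wop_lin a _ hC).1, h, smul_mul_assoc]

/-! ### The stabilizer dual and its matrix units -/

lemma dual_map_add (y : Dual q) (b c : OqSU2 q) : y (b + c) = y b + y c := map_add y.ofConv b c
lemma dual_map_smul (y : Dual q) (r : ℂ) (b : OqSU2 q) : y (r • b) = r * y b :=
  map_smul y.ofConv r b
lemma dual_map_zero (y : Dual q) : y 0 = 0 := map_zero y.ofConv

lemma dual_ext {y z : Dual q} (h : ∀ b, y b = z b) : y = z := by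
  ext b; exact h b

lemma counit_ract (h : Dual q) (x : OqSU2 q) : counit (R := ℂ) (ract h x) = h x := by
  have key : ∀ X : OqSU2 q ⊗[ℂ] OqSU2 q,
      counit (R := ℂ) (TensorProduct.lid ℂ _ (h.ofConv.rTensor (OqSU2 q) X)) =
        h (TensorProduct.rid ℂ _ ((counit (R := ℂ)).lTensor (OqSU2 q) X)) := by
    intro X
    induction X with
    | zero => simp
    | add X Y hX hY => simp only [map_add, hX, hY]
    | tmul a b => simp [mul_comm]
  have := key (comul x)
  rw [Coalgebra.lTensor_counit_comul] at this
  rw [TensorProduct.rid_tmul, one_smul] at this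
  exact this

lemma dual_mul_eq (h k : Dual q) (x : OqSU2 q) : (h * k) x = h (lact k x) := by
  rw [← counit_lact, lact_mul, counit_lact]

lemma apply_lact_eq (g y : Dual q) (x : OqSU2 q) : g (lact y x) = y (ract g x) := by
  rw [← counit_ract g, ← lact_ract, counit_lact]

lemma stab_apply_mul {a : ℝ} {y : Dual q} (hy : y ∈ stabDual q a) {b : OqSU2 q}
    (hb : b ∈ podles q a) (c : OqSU2 q) : y (b * c) = counit (R := ℂ) b * y c := by
  have h := hy (b - algebraMap ℂ _ (counit (R := ℂ) b)) (sub_mem hb (Subalgebra.algebraMap_mem _ _))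
    (by simp) c
  rw [sub_mul, ← Algebra.smul_def, sub_eq_add_neg, ← neg_smul, dual_map_add, dual_map_smul] at h
  linear_combination h

lemma mul_mem_EE {a : ℝ} {m : ℤ} {b x : OqSU2 q} (hb : b ∈ podles q a) (hx : x ∈ EE q a m) :
    b * x ∈ EE q a m := by
  rw [mem_EE] at *
  rw [mem_podles_iff] at hb
  rw [lact_Bt_mul, hb, hx]
  simp

lemma lact_mem_EE {a : ℝ} {m : ℤ} {x : OqSU2 q} (hx : x ∈ EE q a m) :
    lact (iBt q a) x = (qn q (a + m) : ℂ) • x := Module.End.mem_eigenspace_iff.1 hx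

lemma ract_mem_EE {a : ℝ} {m : ℤ} {x : OqSU2 q} (h : Dual q) (hx : x ∈ EE q a m) :
    ract h x ∈ EE q a m := by
  rw [EE, Module.End.mem_eigenspace_iff, lact_ract, lact_mem_EE hx, map_smul]

/-- An element of the stabilizer dual is a multiple of the counit on every eigenspace of `B_t`. -/
lemma stab_EE {a : ℝ} {y : Dual q} (hy : y ∈ stabDual q a) (m : ℤ) :
    ∃ c : ℂ, ∀ x ∈ EE q a m, y x = c * counit (R := ℂ) x := by
  have step (n n' : ℤ) (z : ℂ) (hz : ∀ x ∈ EE q a n', ∀ j, x * row q z j ∈ EE q a n)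
      (h : ∃ Y : OqSU2 q →ₗ[ℂ] ℂ, ∀ x ∈ EE q a n, ∀ Q, y (x * Q) = counit (R := ℂ) x * Y Q) :
      ∃ Y : OqSU2 q →ₗ[ℂ] ℂ, ∀ x ∈ EE q a n', ∀ Q, y (x * Q) = counit (R := ℂ) x * Y Q := by
    obtain ⟨Y, hY⟩ := h
    -- `row z 0 * row z' 1 - q row z 1 * row z' 0` is the scalar `i`
    have e := row_zero_mul_row_one (q := q) z (qc q * z + 1)
    rw [add_sub_cancel_left, mul_one] at e
    refine ⟨(-Complex.I * counit (R := ℂ) (row q z 0)) •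
        (Y ∘ₗ LinearMap.mulLeft ℂ (row q (qc q * z + 1) 1)) +
      (Complex.I * qc q * counit (R := ℂ) (row q z 1)) •
        (Y ∘ₗ LinearMap.mulLeft ℂ (row q (qc q * z + 1) 0)), fun x hx Q => ?_⟩
    have e2 : x * Q = (-Complex.I) • ((x * row q z 0) * (row q (qc q * z + 1) 1 * Q)) +
        (Complex.I * qc q) • ((x * row q z 1) * (row q (qc q * z + 1) 0 * Q)) := by
      have : (x * row q z 0) * (row q (qc q * z + 1) 1 * Q) =
          x * (row q z 0 * row q (qc q * z + 1) 1) * Q := by simp only [mul_assoc]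
      rw [this, e, mul_add, add_mul, ← Algebra.commutes, ← Algebra.smul_def]
      simp only [mul_smul_comm, smul_mul_assoc, smul_add, smul_smul, mul_assoc]
      simp
    rw [e2, dual_map_add, dual_map_smul, dual_map_smul, hY _ (hz x hx 0), hY _ (hz x hx 1)]
    simp [Bialgebra.counit_mul]
    ring
  have main (m : ℤ) : ∃ Y : OqSU2 q →ₗ[ℂ] ℂ, ∀ x ∈ EE q a m, ∀ Q,
      y (x * Q) = counit (R := ℂ) x * Y Q := by
    induction m using Int.induction_on with
    | zero => exact ⟨y.ofConv, fun x hx Q => stab_apply_mul hy ((EE_zero a).1 hx) Q⟩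
    | succ n ih =>
      refine step n (n + 1) (-(qm q a (n + 1))⁻¹) (fun x hx j => ?_) ih
      simpa using (mul_row_mem_EE hx j).2
    | pred n ih =>
      refine step (-n) (-n - 1) (qm q a (-n - 1)) (fun x hx j => ?_) ih
      simpa using (mul_row_mem_EE hx j).1
  obtain ⟨Y, hY⟩ := main m
  exact ⟨Y 1, fun x hx => by rw [← mul_one x, hY x hx, mul_comm, mul_one]⟩

/-- The projections onto the eigenspaces of `B_t`. -/
def proj (q : QParam) (a : ℝ) : ℤ → OqSU2 q →ₗ[ℂ] OqSU2 q :=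
  (exists_projections (EE q a) (iSupIndep_EE a) (iSup_EE a)).choose

lemma proj_spec (q : QParam) (a : ℝ) :
    (∀ m, ∀ x ∈ EE q a m, proj q a m x = x) ∧
      (∀ m n, m ≠ n → ∀ x ∈ EE q a n, proj q a m x = 0) ∧
      (∀ m x, proj q a m x ∈ EE q a m) ∧
      ∀ x, ∃ F : Finset ℤ, ∀ F' : Finset ℤ, F ⊆ F' → ∑ m ∈ F', proj q a m x = x :=
  (exists_projections (EE q a) (iSupIndep_EE a) (iSup_EE a)).choose_spec

lemma proj_same {a : ℝ} {m : ℤ} {x : OqSU2 q} (hx : x ∈ EE q a m) : proj q a m x = x :=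
  (proj_spec q a).1 m x hx

lemma proj_ne {a : ℝ} {m n : ℤ} (h : m ≠ n) {x : OqSU2 q} (hx : x ∈ EE q a n) :
    proj q a m x = 0 := (proj_spec q a).2.1 m n h x hx

lemma proj_mem (a : ℝ) (m : ℤ) (x : OqSU2 q) : proj q a m x ∈ EE q a m :=
  (proj_spec q a).2.2.1 m x

lemma sum_proj (a : ℝ) (x : OqSU2 q) : ∃ F : Finset ℤ, ∀ F' : Finset ℤ, F ⊆ F' →
    ∑ m ∈ F', proj q a m x = x := (proj_spec q a).2.2.2 x

lemma EE_induction {a : ℝ} {P : OqSU2 q → Prop} (h : ∀ m, ∀ x ∈ EE q a m, P x) (h0 : P 0)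
    (hadd : ∀ x y, P x → P y → P (x + y)) (x : OqSU2 q) : P x := by
  have hx : x ∈ ⨆ m, EE q a m := by rw [iSup_EE]; trivial
  induction hx using Submodule.iSup_induction' with
  | zero => exact h0
  | add x y _ _ hx hy => exact hadd x y hx hy
  | mem m b hb => exact h m b hb

lemma proj_comm {a : ℝ} (T : OqSU2 q →ₗ[ℂ] OqSU2 q) (hT : ∀ m, ∀ x ∈ EE q a m, T x ∈ EE q a m)
    (m : ℤ) (x : OqSU2 q) : proj q a m (T x) = T (proj q a m x) := by
  induction x using EE_induction (a := a) with
  | h n x hx =>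
    by_cases h : m = n
    · subst h; rw [proj_same hx, proj_same (hT _ x hx)]
    · rw [proj_ne h hx, proj_ne h (hT _ x hx), map_zero]
  | h0 => simp
  | hadd x y hx hy => rw [map_add, map_add, map_add, hx, hy, map_add]

/-- The matrix unit of weight `[a + m]` of the stabilizer dual: the counit on the eigenspace for
`[a + m]`, and zero on the other eigenspaces. -/
def psi (q : QParam) (a : ℝ) (m : ℤ) : Dual q :=
  .toConv ((counit (R := ℂ) (A := OqSU2 q)) ∘ₗ proj q a m)

lemma psi_apply (a : ℝ) (m : ℤ) (x : OqSU2 q) :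
    psi q a m x = counit (R := ℂ) (proj q a m x) := rfl

lemma psi_mem_stabDual (a : ℝ) (m : ℤ) : psi q a m ∈ stabDual q a := by
  intro b hb h0 c
  have := proj_comm (a := a) (LinearMap.mulLeft ℂ b) (fun m x hx => mul_mem_EE hb hx) m c
  simp only [LinearMap.mulLeft_apply] at this
  rw [psi_apply, this, Bialgebra.counit_mul, h0, zero_mul]

lemma lact_of_eq {a : ℝ} {y : Dual q} {m : ℤ} {c : ℂ}
    (h : ∀ x ∈ EE q a m, y x = c * counit (R := ℂ) x) {x : OqSU2 q} (hx : x ∈ EE q a m) :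
    lact y x = c • x := by
  rw [← sub_eq_zero]
  have H : ∀ g : Module.Dual ℂ (OqSU2 q), g (lact y x - c • x) = 0 := by
    intro g
    have h1 : g (lact y x) = y (ract (.toConv g) x) := apply_lact_eq (.toConv g) y x
    have h2 : counit (R := ℂ) (ract (.toConv g) x) = g x := counit_ract (.toConv g) x
    rw [map_sub, map_smul, h1, h _ (ract_mem_EE _ hx), h2, smul_eq_mul, sub_self]
  exact (Module.forall_dual_apply_eq_zero_iff ℂ _).1 H

lemma lact_psi (a : ℝ) (m : ℤ) (x : OqSU2 q) : lact (psi q a m) x = proj q a m x := by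
  induction x using EE_induction (a := a) with
  | h n x hx =>
    by_cases h : m = n
    · subst h
      rw [proj_same hx, lact_of_eq (c := 1) (fun x hx => ?_) hx, one_smul]
      rw [psi_apply, proj_same hx, one_mul]
    · rw [proj_ne h hx, lact_of_eq (c := 0) (fun x hx => ?_) hx, zero_smul]
      rw [psi_apply, proj_ne h hx, map_zero, zero_mul]
  | h0 => simp
  | hadd x y hx hy => rw [map_add, map_add, hx, hy]

lemma psi_isWeight (a : ℝ) (m : ℤ) : IsWeight q a m (psi q a m) := by
  constructor
  · refine dual_ext fun x => ?_
    rw [dual_mul_eq, lact_psi, dual_smul_apply, psi_apply, ← counit_lact,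
      lact_mem_EE (proj_mem a m x), map_smul, smul_eq_mul]
  · refine dual_ext fun x => ?_
    have := proj_comm (a := a) (lact (iBt q a)) (fun m x hx => by
      rw [lact_mem_EE hx]; exact Submodule.smul_mem _ _ hx) m x
    rw [dual_mul_eq, dual_smul_apply, psi_apply, this, lact_mem_EE (proj_mem a m x), map_smul,
      smul_eq_mul, psi_apply]

lemma psi_mem_Ic (a : ℝ) (m : ℤ) : psi q a m ∈ Ic q a :=
  Submodule.subset_span ⟨psi_mem_stabDual a m, m, psi_isWeight a m⟩

/-- `𝓘_c` is the span of the matrix units, since an element of the stabilizer dual of weight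
`[a + m]` is a multiple of the counit on one eigenspace and vanishes on the others. -/
lemma Ic_eq (a : ℝ) : Ic q a = Submodule.span ℂ (Set.range (psi q a)) := by
  refine le_antisymm (Submodule.span_le.2 ?_) (Submodule.span_le.2 ?_)
  · rintro y ⟨hy, m, hm⟩
    obtain ⟨c, hc⟩ := stab_EE hy m
    have : y = c • psi q a m := by
      refine dual_ext fun x => ?_
      induction x using EE_induction (a := a) with
      | h n x hx =>
        rw [dual_smul_apply, psi_apply]
        by_cases h : m = n
        · subst h; rw [hc x hx, proj_same hx]
        · rw [proj_ne h hx, map_zero, mul_zero]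
          have h1 : (y * iBt q a) x = (qn q (a + n) : ℂ) * y x := by
            rw [dual_mul_eq, lact_mem_EE hx, dual_map_smul]
          rw [hm.2, dual_smul_apply] at h1
          have h2 : ((qn q (a + m) : ℂ) - qn q (a + n)) * y x = 0 := by linear_combination h1
          exact (mul_eq_zero.1 h2).resolve_left
            (sub_ne_zero.2 fun h3 => h (qn_int_injective (q := q) a h3))
      | h0 => rw [dual_map_zero, dual_map_zero]
      | hadd x z hx hz => rw [dual_map_add, dual_map_add, hx, hz]
    rw [this]
    exact Submodule.smul_mem _ _ (Submodule.subset_span ⟨m, rfl⟩)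
  · rintro _ ⟨m, rfl⟩
    exact psi_mem_Ic a m

lemma Ic_le_stabDual (a : ℝ) : Ic q a ≤ stabDual q a :=
  Submodule.span_le.2 fun _ hy => hy.1

lemma Bt_mem_stabDual (a : ℝ) : Bt q a ∈ stabDual q a := by
  intro b hb h0 c
  rw [Bt_mul_apply, h0, ← counit_lact, mem_podles_iff.1 hb]
  simp [h0]

lemma iBt_mem_stabDual (a : ℝ) : iBt q a ∈ stabDual q a :=
  Submodule.smul_mem _ _ (Bt_mem_stabDual a)

/-! ### The involution on the matrix units -/

lemma star_S (x : OqSU2 q) : star (S q x) = Sinv q (star x) := by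
  induction x using OqSU2.induction with
  | hC c => rw [S_algebraMap, star_algebraMap, Sinv_algebraMap]
  | hx g =>
    rw [S_x, star_x, Sinv_x]
    cases g <;> simp [antipodeGen, antipodeInvGen, starGen, star_x, star_smul]
  | hmul a b ha hb => rw [S_mul, star_mul, ha, hb, star_mul, Sinv_mul]
  | hadd a b ha hb => simp only [map_add, star_add, ha, hb]

lemma dualStar_apply (h : Dual q) (x : OqSU2 q) : dualStar h x = conj (h (star (S q x))) := rfl

lemma dualStar_mul (h k : Dual q) : dualStar (h * k) = dualStar k * dualStar h := by
  refine dual_ext fun x => ?_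
  have key : ∀ X : OqSU2 q ⊗[ℂ] OqSU2 q,
      conj (LinearMap.mul' ℂ ℂ (TensorProduct.map h.ofConv k.ofConv
        (TensorProduct.map (Sinv q) (Sinv q) (TensorProduct.comm ℂ _ _ (star X))))) =
      LinearMap.mul' ℂ ℂ (TensorProduct.map (dualStar k).ofConv (dualStar h).ofConv X) := by
    intro X
    induction X with
    | zero => simp
    | add X Y hX hY => simp only [star_add, map_add, hX, hY]
    | tmul a b =>
      have h1 : (dualStar k).ofConv a = conj (k.ofConv (Sinv q (star a))) := by
        rw [← star_S]; rfl
      have h2 : (dualStar h).ofConv b = conj (h.ofConv (Sinv q (star b))) := by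
        rw [← star_S]; rfl
      simp [TensorProduct.star_tmul, h1, h2, mul_comm]
  have := key (comul x)
  rw [← comul_star] at this
  have e := comul_Sinv (star x)
  rw [dualStar_apply, star_S]
  refine Eq.trans ?_ this
  change conj (LinearMap.mul' ℂ ℂ (TensorProduct.map h.ofConv k.ofConv (comul _))) = _
  rw [e]

lemma dualStar_Bt (a : ℝ) : dualStar (Bt q a) = -Bt q a := by
  have hq := qc_ne q
  have hk (x : OqSU2 q) : conj (kinv q (star (S q x))) = kinv q x := by
    induction x using OqSU2.induction with
    | hC c => rw [S_algebraMap, star_algebraMap, kinv_algebraMap, kinv_algebraMap, Complex.conj_conj]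
    | hx g =>
      rw [S_x, kinv_x]
      cases g <;> simp [antipodeGen, star_x, starGen, kinv_x, kinvGen]
    | hmul b c hb hc => rw [S_mul, star_mul, kinv_mul, map_mul, hb, hc, kinv_mul]
    | hadd b c hb hc => rw [map_add, star_add, dual_map_add, map_add, hb, hc, dual_map_add]
  have he (x : OqSU2 q) : conj (counit (R := ℂ) (star (S q x))) = counit (R := ℂ) x := by
    rw [conj_counit_star]
    exact HopfAlgebra.counit_antipode x
  have neg_apply (x : OqSU2 q) : (-Bt q a) x = -(Bt q a x) := rfl
  have h10 : Bt q a (x q .ga) = 1 := by simpa [uMat] using Bt_uMat (q := q) a 1 0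
  have h01 : Bt q a (x q .gas) = (qc q)⁻¹ := by
    have h := Bt_uMat (q := q) a 0 1
    have e : uMat q 0 1 = -(qc q) • x q .gas := by simp [uMat]
    rw [e, dual_map_smul] at h
    simp only [Matrix.cons_val_zero, Matrix.cons_val_one, Matrix.cons_val_fin_one] at h
    field_simp
    linear_combination -h
  have h00 : Bt q a (x q .al) = -(kap q a * (qc q)⁻¹) := by
    simpa [uMat] using Bt_uMat (q := q) a 0 0
  have h11 : Bt q a (x q .als) = -(kap q a * qc q) := by
    simpa [uMat] using Bt_uMat (q := q) a 1 1
  have key (x : OqSU2 q) : dualStar (Bt q a) x = -(Bt q a x) := by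
    induction x using OqSU2.induction with
    | hC c =>
      rw [dualStar_apply, S_algebraMap, star_algebraMap, Algebra.algebraMap_eq_smul_one,
        Algebra.algebraMap_eq_smul_one, dual_map_smul, dual_map_smul, Bt_one]
      simp [conj_kap]
    | hx g =>
      rw [dualStar_apply, S_x]
      cases g
      · simp only [antipodeGen, star_x, starGen, h00]; simp [conj_kap]
      · simp only [antipodeGen, star_x, starGen, h11]; simp [conj_kap]
      · rw [antipodeGen, ← neg_smul, star_smul, star_x, dual_map_smul, starGen, h01, h10]
        simp [hq]
      · rw [antipodeGen, ← neg_smul, star_smul, star_x, dual_map_smul, starGen, h10, h01]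
        simp
    | hmul b c hb hc =>
      rw [dualStar_apply] at *
      rw [S_mul, star_mul, Bt_mul_apply, Bt_mul_apply]
      simp only [map_add, map_mul, hk, he, hb, hc, conj_kap]
      ring
    | hadd b c hb hc => rw [dual_map_add, dual_map_add, hb, hc]; ring
  exact dual_ext fun x => by rw [key, neg_apply]

lemma dualStar_iBt (a : ℝ) : dualStar (iBt q a) = iBt q a := by
  have h (x : OqSU2 q) : dualStar (Bt q a) x = -(Bt q a x) := by rw [dualStar_Bt]; rfl
  refine dual_ext fun x => ?_
  have h2 := h x
  rw [dualStar_apply] at h2 ⊢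
  rw [iBt, dual_smul_apply, dual_smul_apply, map_mul, h2]
  simp

lemma dualStar_one : dualStar (1 : Dual q) = 1 := by
  refine dual_ext fun x => ?_
  rw [dualStar_apply, dual_one_apply, dual_one_apply, conj_counit_star]
  exact HopfAlgebra.counit_antipode x

lemma dualStar_iBt_pow (a : ℝ) (n : ℕ) : dualStar (iBt q a ^ n) = iBt q a ^ n := by
  induction n with
  | zero => rw [pow_zero, dualStar_one]
  | succ n ih => rw [pow_succ, dualStar_mul, ih, dualStar_iBt, ← pow_succ', pow_succ]

lemma iBt_pow_apply (a : ℝ) (n : ℕ) {m : ℤ} {x : OqSU2 q} (hx : x ∈ EE q a m) :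
    (iBt q a ^ n) x = (qn q (a + m) : ℂ) ^ n * counit (R := ℂ) x := by
  induction n with
  | zero => rw [pow_zero, pow_zero, one_mul, dual_one_apply]
  | succ n ih => rw [pow_succ, dual_mul_eq, lact_mem_EE hx, dual_map_smul, ih]; ring

/-- The matrix units are self-adjoint: a finite sum of eigencomponents is separated by the powers
of `i B_t`, which are self-adjoint and have real eigenvalues. -/
lemma dualStar_psi (a : ℝ) (m : ℤ) : dualStar (psi q a m) = psi q a m := by
  classical
  refine dual_ext fun x => ?_
  obtain ⟨F₁, h₁⟩ := sum_proj a x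
  obtain ⟨F₂, h₂⟩ := sum_proj a (star (S q x))
  set F := insert m (F₁ ∪ F₂) with hF
  have hF₁ := h₁ F (fun i hi => by simp [hF, hi])
  have hF₂ := h₂ F (fun i hi => by simp [hF, hi])
  have hsum (y : OqSU2 q) (hy : ∑ j ∈ F, proj q a j y = y) (n : ℕ) :
      (iBt q a ^ n) y = ∑ j ∈ F, (qn q (a + j) : ℂ) ^ n * psi q a j y := by
    nth_rewrite 1 [← hy]
    have : (iBt q a ^ n) (∑ j ∈ F, proj q a j y) = ∑ j ∈ F, (iBt q a ^ n) (proj q a j y) :=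
      map_sum (iBt q a ^ n).ofConv _ _
    rw [this]
    exact Finset.sum_congr rfl fun j _ => iBt_pow_apply a n (proj_mem a j y)
  have hpow (n : ℕ) : ∑ j ∈ F, (qn q (a + j) : ℂ) ^ n *
      (dualStar (psi q a j) x - psi q a j x) = 0 := by
    have h3 : dualStar (iBt q a ^ n) x = (iBt q a ^ n) x := by rw [dualStar_iBt_pow]
    rw [dualStar_apply, hsum _ hF₁, hsum _ hF₂, map_sum] at h3
    simp only [mul_sub, Finset.sum_sub_distrib, sub_eq_zero]
    rw [← h3]
    refine Finset.sum_congr rfl fun j _ => ?_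
    rw [dualStar_apply, map_mul, map_pow, Complex.conj_ofReal]
  have hpoly (p : Polynomial ℂ) : ∑ j ∈ F, p.eval (qn q (a + j) : ℂ) *
      (dualStar (psi q a j) x - psi q a j x) = 0 := by
    induction p using Polynomial.induction_on' with
    | add p r hp hr => simp only [Polynomial.eval_add, add_mul, Finset.sum_add_distrib, hp, hr, add_zero]
    | monomial n c =>
      simp only [Polynomial.eval_monomial, mul_assoc, ← Finset.mul_sum, hpow, mul_zero]
  have h4 := hpoly (∏ j ∈ F.erase m, (Polynomial.X - Polynomial.C (qn q (a + j) : ℂ)))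
  have hm : m ∈ F := by simp [hF]
  rw [Finset.sum_eq_single_of_mem m hm] at h4
  · refine sub_eq_zero.1 ((mul_eq_zero.1 h4).resolve_left ?_)
    rw [Polynomial.eval_prod]
    refine Finset.prod_ne_zero_iff.2 fun j hj => ?_
    simp only [Polynomial.eval_sub, Polynomial.eval_X, Polynomial.eval_C]
    exact sub_ne_zero.2 fun h => (Finset.mem_erase.1 hj).1 (qn_int_injective (q := q) a h).symm
  · intro j hj hjm
    rw [Polynomial.eval_prod, Finset.prod_eq_zero (Finset.mem_erase.2 ⟨hjm, hj⟩) (by simp), zero_mul]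

/-! ### The action of the double on `O_q(SU(2))` -/

/-- The Podleś sphere is a left coideal. -/
lemma comul_mem_of_podles {a : ℝ} {b : OqSU2 q} (hb : b ∈ podles q a) :
    comul (R := ℂ) b ∈ Submodule.span ℂ {t : OqSU2 q ⊗[ℂ] OqSU2 q |
      ∃ u, ∃ v ∈ podles q a, t = u ⊗ₜ v} := by
  classical
  set B := Module.Basis.ofVectorSpace ℂ (OqSU2 q)
  set E := TensorProduct.equivFinsuppOfBasisLeft (N := OqSU2 q) B
  rw [← E.symm_apply_apply (comul b), TensorProduct.equivFinsuppOfBasisLeft_symm_apply]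
  refine Submodule.sum_mem _ fun i _ => Submodule.subset_span ⟨_, _, ?_, rfl⟩
  rw [TensorProduct.equivFinsuppOfBasisLeft_apply]
  exact ract_mem_podles (.toConv (B.coord i)) hb

/-- The map `b ⊗ h ↦ h(1) b` from the double to `O_q(SU(2))`. -/
def evE : OqSU2 q ⊗[ℂ] Dual q →ₗ[ℂ] OqSU2 q :=
  (TensorProduct.rid ℂ (OqSU2 q)).toLinearMap ∘ₗ TensorProduct.map LinearMap.id
    (LinearMap.applyₗ (1 : OqSU2 q) ∘ₗ (WithConv.linearEquiv ℂ _).toLinearMap)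

lemma evE_tmul (b : OqSU2 q) (h : Dual q) : evE (b ⊗ₜ h) = h 1 • b := by
  simp [evE]

lemma evE_rmulU (k : Dual q) (w : OqSU2 q ⊗[ℂ] Dual q) : evE (rmulU k w) = k 1 • evE w := by
  induction w with
  | zero => simp
  | add X Y hX hY => simp only [map_add, hX, hY, smul_add]
  | tmul b h => rw [rmulU_tmul, evE_tmul, evE_tmul, mul_apply_one, mul_comm, mul_smul]

/-- `evE` as a map on the double. -/
def evD : Double q →ₗ[ℂ] OqSU2 q := evE

lemma evD_mul_ofU (z : Double q) (k : Dual q) : evD (z * Double.ofU k) = k 1 • evD z := by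
  have : ∀ z : OqSU2 q ⊗[ℂ] Dual q, lmulD z (1 ⊗ₜ k) = rmulU k z := by
    intro z
    induction z with
    | zero => simp
    | add X Y hX hY => simp only [map_add, hX, hY, LinearMap.add_apply]
    | tmul b h => simp [lmulD_tmul, exch_one]
  exact (congrArg evE (this z)).trans (evE_rmulU k z)

lemma double_induction {P : Double q → Prop} (h0 : P 0) (hadd : ∀ z w, P z → P w → P (z + w))
    (hof : ∀ b h, P (Double.ofA b * Double.ofU h)) (z : Double q) : P z := by
  have : ∀ w : OqSU2 q ⊗[ℂ] Dual q, P w := by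
    intro w
    induction w with
    | zero => exact h0
    | add X Y hX hY => exact hadd X Y hX hY
    | tmul b h => rw [← Double.of, ← Double.ofA_mul_ofU]; exact hof b h
  exact this z

lemma evD_ofA (b : OqSU2 q) : evD (Double.ofA b) = b := by
  change evE (b ⊗ₜ 1) = b
  rw [evE_tmul, dual_one_apply]; simp

/-- The kernel of `evD` is a left ideal, so that the double acts on its quotient `O_q(SU(2))`. -/
lemma evD_mul (z w : Double q) : evD (z * w) = evD (z * Double.ofA (evD w)) := by
  induction w using double_induction with
  | h0 => simp
  | hadd X Y hX hY => rw [mul_add, map_add, hX, hY, map_add, map_add, mul_add, map_add]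
  | hof b k =>
    rw [← mul_assoc, evD_mul_ofU, evD_mul_ofU, evD_ofA, map_smul, mul_smul_comm, map_smul]

/-- The action of the double on `O_q(SU(2))`, induced from the counit of the dual. -/
def act : Double q →ₐ[ℂ] Module.End ℂ (OqSU2 q) :=
  AlgHom.ofLinearMap
    { toFun := fun z =>
        { toFun := fun c => evD (z * Double.ofA c)
          map_add' := fun c d => by rw [map_add, mul_add, map_add]
          map_smul' := fun r c => by rw [map_smul, mul_smul_comm, map_smul, RingHom.id_apply] }
      map_add' := fun z w => by
        ext c; simp [add_mul]
      map_smul' := fun r z => by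
        ext c; simp }
    (by
      ext c
      change evD (1 * Double.ofA c) = c
      rw [one_mul]
      change evE (c ⊗ₜ 1) = c
      rw [evE_tmul, dual_one_apply]; simp)
    (fun z w => by
      ext c
      change evD (z * w * Double.ofA c) = evD (z * Double.ofA (evD (w * Double.ofA c)))
      rw [mul_assoc, evD_mul])

lemma act_apply (z : Double q) (c : OqSU2 q) : act z c = evD (z * Double.ofA c) := rfl

lemma act_ofA (b c : OqSU2 q) : act (Double.ofA b) c = b * c := by
  rw [act_apply, ← map_mul, evD_ofA]

lemma counit_act_one (z : Double q) : counit (R := ℂ) (act z 1) = Double.counitD z := by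
  rw [act_apply, map_one, mul_one]
  induction z using double_induction with
  | h0 => simp
  | hadd X Y hX hY => simp only [map_add, hX, hY]
  | hof b h =>
    rw [evD_mul_ofU, evD_ofA, Double.ofA_mul_ofU, map_smul, smul_eq_mul, mul_comm]
    rfl

/-- For a functional in the stabilizer dual and an element of the Podleś sphere, the last leg
`c₍₃₎` of the exchange rule is replaced by its counit. -/
lemma exch_stab {a : ℝ} {h : Dual q} (hh : h ∈ stabDual q a) {c : OqSU2 q}
    (hc : c ∈ podles q a) : exch h c = sw (legs h) c 1 := by
  have h1 (u v : OqSU2 q) (hv : v ∈ podles q a) :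
      sw (legs h) u v = counit (R := ℂ) v • sw (legs h) u 1 := by
    have ht (y : OqSU2 q) : twist h y v = counit (R := ℂ) v • twist h y 1 := by
      refine dual_ext fun z => ?_
      rw [dual_smul_apply, twist_apply, twist_apply, stab_apply_mul hh hv, one_mul]
    rw [sw_repr _ (ℛ ℂ u)]
    simp only [LinearMap.sum_apply, legs_apply, ht, TensorProduct.tmul_smul, Finset.smul_sum]
  have h2 : ∀ X ∈ Submodule.span ℂ {t : OqSU2 q ⊗[ℂ] OqSU2 q | ∃ u, ∃ v ∈ podles q a, t = u ⊗ₜ v},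
      TensorProduct.lift (sw (legs h)) X =
        sw (legs h) (TensorProduct.rid ℂ _ ((counit (R := ℂ)).lTensor (OqSU2 q) X)) 1 := by
    intro X hX
    induction hX using Submodule.span_induction with
    | mem X hX =>
      obtain ⟨u, v, hv, rfl⟩ := hX
      simp [h1 u v hv]
    | zero => simp
    | add X Y _ _ hX hY => simp only [map_add, hX, hY, LinearMap.add_apply]
    | smul r X _ hX => simp only [map_smul, hX, LinearMap.smul_apply]
  rw [exch, ← sw_coassoc, sw_apply, h2 _ (comul_mem_of_podles hc), Coalgebra.lTensor_counit_comul,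
    TensorProduct.rid_tmul, one_smul]

/-- On the Podleś sphere the stabilizer dual acts by `c ↦ c ◁ S⁻¹(h)`. -/
lemma act_ofU {a : ℝ} {h : Dual q} (hh : h ∈ stabDual q a) {c : OqSU2 q}
    (hc : c ∈ podles q a) : act (Double.ofU h) c = ract (dualSinv h) c := by
  rw [act_apply, Double.ofU_mul_ofA]
  change evE (exch h c) = _
  rw [exch_stab hh hc, sw_repr _ (ℛ ℂ c), LinearMap.sum_apply, map_sum]
  have : ract (dualSinv h) c =
      ∑ i ∈ (ℛ ℂ c).index, dualSinv h ((ℛ ℂ c).left i) • (ℛ ℂ c).right i := by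
    nth_rewrite 1 [ract, LinearMap.comp_apply, LinearMap.comp_apply, ← (ℛ ℂ c).eq]
    simp
  rw [this]
  refine Finset.sum_congr rfl fun i _ => ?_
  rw [legs_apply, evE_tmul, twist_apply, one_mul, one_mul, dualSinv_apply]

/-- The exchange rule of the double between `B_t` and the Podleś sphere. -/
lemma ofU_Bt_mul {a : ℝ} {b : OqSU2 q} (hb : b ∈ podles q a) :
    Double.ofU (Bt q a) * Double.ofA b =
      Double.ofA (ract (k q) b) * (Double.ofU (Bt q a) + algebraMap ℂ _ (kap q a)) +
        Double.ofA (ract (dualSinv (Bt q a)) b) := by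
  have h1 (h : Dual q) : ract h b =
      ∑ i ∈ (ℛ ℂ b).index, h ((ℛ ℂ b).left i) • (ℛ ℂ b).right i := by
    nth_rewrite 1 [ract, LinearMap.comp_apply, LinearMap.comp_apply, ← (ℛ ℂ b).eq]
    simp
  have h2 (y : OqSU2 q) : twist (Bt q a) y 1 =
      k q y • (Bt q a + kap q a • 1) + dualSinv (Bt q a) y • 1 := by
    refine dual_ext fun z => ?_
    rw [twist_apply, one_mul, Bt_mul_apply, kinv_Sinv, dual_add_apply, dual_smul_apply,
      dual_add_apply, dual_smul_apply, dual_smul_apply, dual_one_apply, dualSinv_apply]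
    ring
  have h3 : algebraMap ℂ (Double q) (kap q a) = Double.ofU (kap q a • 1) := by
    rw [map_smul, map_one, Algebra.algebraMap_eq_smul_one]
  have key : (∑ i ∈ (ℛ ℂ b).index, legs (Bt q a) ((ℛ ℂ b).left i) ((ℛ ℂ b).right i) 1 :
        OqSU2 q ⊗[ℂ] Dual q) =
      (∑ i ∈ (ℛ ℂ b).index, k q ((ℛ ℂ b).left i) • (ℛ ℂ b).right i) ⊗ₜ[ℂ] (Bt q a + kap q a • 1) +
      (∑ i ∈ (ℛ ℂ b).index, dualSinv (Bt q a) ((ℛ ℂ b).left i) • (ℛ ℂ b).right i) ⊗ₜ[ℂ] 1 := by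
    rw [TensorProduct.sum_tmul, TensorProduct.sum_tmul, ← Finset.sum_add_distrib]
    refine Finset.sum_congr rfl fun i _ => ?_
    rw [legs_apply, h2, TensorProduct.tmul_add, TensorProduct.tmul_smul, TensorProduct.tmul_smul,
      TensorProduct.smul_tmul', TensorProduct.smul_tmul']
  rw [Double.ofU_mul_ofA, exch_stab (Bt_mem_stabDual a) hb, h3, ← map_add, Double.ofA_mul_ofU,
    sw_repr _ (ℛ ℂ b), LinearMap.sum_apply, h1, h1]
  exact key

/-- The exchange rule inside `U_q(sl(2,ℝ)_t)`. -/
lemma iBU_mul_bU {a : ℝ} (b : podles q a) : iBU q a * bU b =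
    bU ⟨ract (k q) b, ract_mem_podles _ b.2⟩ *
      (iBU q a + algebraMap ℂ _ (Complex.I * kap q a)) +
    bU (Complex.I • ⟨ract (dualSinv (Bt q a)) b, ract_mem_podles _ b.2⟩) := by
  ext1
  change Double.ofU (Complex.I • Bt q a) * Double.ofA (b : OqSU2 q) =
    Double.ofA (ract (k q) b) * (Double.ofU (Complex.I • Bt q a) +
      algebraMap ℂ (Double q) (Complex.I * kap q a)) +
    Double.ofA (Complex.I • ract (dualSinv (Bt q a)) (b : OqSU2 q))
  rw [map_smul, map_smul, smul_mul_assoc, ofU_Bt_mul b.2, map_mul, ← Algebra.smul_def, ← smul_add,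
    mul_smul_comm, smul_add]

lemma wop_mem {a : ℝ} (μ : ℂ) {b : OqSU2 q} (hb : b ∈ podles q a) : wop q a μ b ∈ podles q a := by
  rw [wop]
  exact add_mem (Subalgebra.smul_mem _ (ract_mem_podles _ hb) _) (ract_mem_podles _ hb)

lemma qn_eq_mu (c : ℝ) : (qn q c : ℂ) = Complex.I * mu q (qpow q c) := by
  rw [mu, qn_eq, mul_neg, ← mul_assoc, Complex.I_mul_I]; ring

section modules
variable {a : ℝ} {V : Type*} [AddCommGroup V] [Module ℂ V] [Module (UqSL q a) V]
  [IsScalarTower ℂ (UqSL q a) V]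

lemma algebraMap_smul_UqSL (r : ℂ) (v : V) : (algebraMap ℂ (UqSL q a) r) • v = r • v :=
  algebraMap_smul _ r v

lemma bU_smul_smul (r : ℂ) (b : podles q a) (v : V) : bU (r • b) • v = r • (bU b • v) := by
  rw [map_smul, smul_assoc]

lemma bU_algebraMap_smul (r : ℂ) (v : V) : bU (algebraMap ℂ (podles q a) r) • v = r • v := by
  rw [AlgHom.commutes, algebraMap_smul_UqSL]

/-- The action of `i B_t` on `b v`, for `v` of weight `[c]`. -/
lemma iBU_smul_bU_smul {c : ℝ} {v : V} (hv : iBU q a • v = (qn q c : ℂ) • v) (b : podles q a) :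
    iBU q a • (bU b • v) =
      Complex.I • (bU ⟨wop q a (mu q (qpow q c)) b, wop_mem _ b.2⟩ • v) := by
  have e : (⟨wop q a (mu q (qpow q c)) b, wop_mem _ b.2⟩ : podles q a) =
      (mu q (qpow q c) + kap q a) • ⟨ract (k q) b, ract_mem_podles _ b.2⟩ +
        ⟨ract (dualSinv (Bt q a)) b, ract_mem_podles _ b.2⟩ := by
    ext1; simp [wop]
  rw [smul_smul, iBU_mul_bU, add_smul, mul_smul, add_smul, hv, algebraMap_smul_UqSL, e, map_add,
    add_smul, bU_smul_smul, bU_smul_smul, ← add_smul, qn_eq_mu, ← mul_add, smul_add, smul_comm,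
    smul_smul]

end modules

/-! ### Generators of the Podleś sphere in terms of `T_c^±` and `A_c` -/

/-- The generators `X`, `X*` and `Z` generate the Podleś sphere as an algebra. -/
lemma podles_induction {a : ℝ} {P : podles q a → Prop} (hX : P (PX q a)) (hY : P (PY q a))
    (hZ : P (PZ q a)) (hC : ∀ r : ℂ, P (algebraMap ℂ _ r)) (hadd : ∀ b c, P b → P c → P (b + c))
    (hmul : ∀ b c, P b → P c → P (b * c)) (b : podles q a) : P b := by
  have hq := qc_ne q
  have hsmul (r : ℂ) (b : podles q a) (hb : P b) : P (r • b) := by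
    rw [Algebra.smul_def]; exact hmul _ _ (hC r) hb
  have h00 : P ⟨GG q a 0 0, GG_mem a _ _⟩ := hX
  have h11 : P ⟨GG q a 1 1, GG_mem a _ _⟩ := by
    have := hsmul (qc q)⁻¹ _ hY
    rwa [PY, smul_smul, inv_mul_cancel₀ hq, one_smul] at this
  have h10 : P ⟨GG q a 1 0, GG_mem a _ _⟩ := by
    have := hsmul (Complex.I * qc q)⁻¹ _ (hadd _ _ hZ (hC (-(qc q * sa1 q a / s1 q))))
    rwa [PZ, map_neg, add_neg_cancel_right, smul_smul,
      inv_mul_cancel₀ (mul_ne_zero Complex.I_ne_zero hq), one_smul] at this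
  have h01 : P ⟨GG q a 0 1, GG_mem a _ _⟩ := by
    have e : (⟨GG q a 0 1, GG_mem a _ _⟩ : podles q a) =
        qc q • ⟨GG q a 1 0, GG_mem a _ _⟩ + algebraMap ℂ _ (-(Complex.I * sa1 q a)) := by
      ext1
      change row q _ 0 * row q _ 1 = qc q • (row q _ 1 * row q _ 0) + algebraMap ℂ _ _
      rw [row_zero_mul_row_one, sa1]
      congr 2
      ring
    rw [e]
    exact hadd _ _ (hsmul _ _ h10) (hC _)
  obtain ⟨b, hb⟩ := b
  have hb' : b ∈ GB q a := podles_eq_GB (q := q) a ▸ hb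
  have key : ∀ x ∈ GB q a, ∃ hx : x ∈ podles q a, P ⟨x, hx⟩ := by
    intro x hx
    induction hx using Algebra.adjoin_induction with
    | mem x hx =>
      obtain ⟨i, j, rfl⟩ := hx
      exact ⟨GG_mem a i j, by fin_cases i <;> fin_cases j <;> assumption⟩
    | algebraMap r => exact ⟨Subalgebra.algebraMap_mem _ r, hC r⟩
    | add x y _ _ hx hy => exact ⟨add_mem hx.1 hy.1, hadd _ _ hx.2 hy.2⟩
    | mul x y _ _ hx hy => exact ⟨mul_mem hx.1 hy.1, hmul _ _ hx.2 hy.2⟩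
  exact (key b hb').2

/-- The number `{c}` for `C = q^c`. -/
def br (C : ℂ) : ℂ := C + C⁻¹

lemma br_ne (c : ℝ) : br (qpow q c) ≠ 0 := qpow_add_inv_ne c

lemma br_add_one_ne (c : ℝ) : br (qc q * qpow q c) ≠ 0 := by
  rw [← qpow_add_one]; exact br_ne _

section combos
variable (a c : ℝ)

lemma sq_ne_facts : qpow q c ^ 2 + 1 ≠ 0 ∧ qc q ^ 2 * qpow q c ^ 2 + 1 ≠ 0 ∧
    qpow q c ^ 2 + qc q ^ 2 ≠ 0 := by
  have hq := qc_ne q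
  have hC := qpow_ne q c
  refine ⟨qpow_sq_add_one_ne c, ?_, ?_⟩
  · have := qpow_sq_add_one_ne (q := q) (c + 1)
    rwa [qpow_add_one, mul_pow] at this
  · have := qpow_sq_add_one_ne (q := q) (c - 1)
    rw [qpow_sub_one] at this
    intro h
    apply this
    field_simp
    rw [h, mul_zero]

/-- The generator `X` as an affine combination of `T_c^+`, `T_c^-` and `A_c`, for every `c`. -/
lemma PX_eq : PX q a =
    (qc q * qpow q c ^ 2 / (br (qpow q c) * br (qc q * qpow q c))) • Tp q a (qpow q c) +
    (qc q / (qpow q c ^ 2 * (br (qpow q c) * br (qpow q c / qc q)))) • Tm q a (qpow q c) +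
    (s1 q / (qc q * (br (qc q * qpow q c) * br (qpow q c / qc q)))) •
      (At q a (qpow q c) - algebraMap ℂ _ (atc q a (qpow q c))) := by
  have hq := qc_ne q
  have hC := qpow_ne q c
  obtain ⟨h1, h2, h3⟩ := sq_ne_facts (q := q) c
  have h4 : qpow q c ^ 2 * qc q ^ 2 + 1 ≠ 0 := by rwa [mul_comm]
  rw [Tp_eq a hC, Tm_eq a hC, At_eq a hC, add_sub_cancel_right, br, br, br, s1]
  match_scalars <;> field_simp <;> ring

/-- The generator `X*` as an affine combination of `T_c^+`, `T_c^-` and `A_c`, for every `c`. -/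
lemma PY_eq : PY q a =
    (-(qc q * (br (qpow q c) * br (qc q * qpow q c)))⁻¹) • Tp q a (qpow q c) +
    (-(qc q * (br (qpow q c) * br (qpow q c / qc q)))⁻¹) • Tm q a (qpow q c) +
    (s1 q / (qc q * (br (qc q * qpow q c) * br (qpow q c / qc q)))) •
      (At q a (qpow q c) - algebraMap ℂ _ (atc q a (qpow q c))) := by
  have hq := qc_ne q
  have hC := qpow_ne q c
  obtain ⟨h1, h2, h3⟩ := sq_ne_facts (q := q) c
  have h4 : qpow q c ^ 2 * qc q ^ 2 + 1 ≠ 0 := by rwa [mul_comm]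
  rw [Tp_eq a hC, Tm_eq a hC, At_eq a hC, add_sub_cancel_right, br, br, br, s1]
  match_scalars <;> field_simp <;> ring

/-- The self-adjoint generator as an affine combination of `T_c^+`, `T_c^-` and `A_c`, for every
`c`. -/
lemma PZ_eq : PZ q a =
    (qpow q c / (br (qpow q c) * br (qc q * qpow q c))) • Tp q a (qpow q c) +
    (-(qpow q c * (br (qpow q c) * br (qpow q c / qc q)))⁻¹) • Tm q a (qpow q c) +
    (-((qpow q c - (qpow q c)⁻¹) / (qc q * (br (qc q * qpow q c) * br (qpow q c / qc q))))) •
      (At q a (qpow q c) - algebraMap ℂ _ (atc q a (qpow q c))) := by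
  have hq := qc_ne q
  have hC := qpow_ne q c
  obtain ⟨h1, h2, h3⟩ := sq_ne_facts (q := q) c
  have h4 : qpow q c ^ 2 * qc q ^ 2 + 1 ≠ 0 := by rwa [mul_comm]
  rw [Tp_eq a hC, Tm_eq a hC, At_eq a hC, add_sub_cancel_right, br, br, br, s1]
  match_scalars <;> field_simp <;> ring

end combos

/-! ### Basic vectors and strings -/

/-- The eigenvalue `q ({1} + {a + c + 1})` of `At` on the basic vectors of weight `c`, where
`C = q^c`. -/
def alf (q : QParam) (a : ℝ) (C : ℂ) : ℂ := qc q * (s1 q + br (qc q * qpow q a * C))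

/-- The eigenvalue `q² ({1} + {c + a + 1}) ({1} - {c - a + 1})` of `T_{c+2}^- T_c^+`, up to
normalization, where `C = q^c`. -/
def ta (q : QParam) (a : ℝ) (C : ℂ) : ℂ :=
  qc q ^ 2 * ((s1 q + br (qc q * qpow q a * C)) * (s1 q - br (qc q * C / qpow q a)))

section strings
variable {a : ℝ} {V : Type*} [AddCommGroup V] [Module ℂ V] [Module (UqSL q a) V]
  [IsScalarTower ℂ (UqSL q a) V]

/-- A vector `v` with `i B_t v = [c] v` and `A_c v = (q + q⁻¹) v`, the latter expressed in terms of
`At`. -/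
def IsBasic (c : ℝ) (v : V) : Prop :=
  iBU q a • v = (qn q c : ℂ) • v ∧ bU (At q a (qpow q c)) • v = alf q a (qpow q c) • v

lemma lam0_eq : ((lam0 q : ℝ) : ℂ) = s1 q := by rw [lam0, s1, qc]; push_cast; rfl

lemma isBasic_iff {c : ℝ} {v : V} : IsBasic (q := q) (a := a) c v ↔
    iBU q a • v = (qn q c : ℂ) • v ∧ bU (Ac q a c) • v = (lam0 q : ℂ) • v := by
  have hq := qc_ne q
  rw [IsBasic, Ac_eq, map_sub, sub_smul, bU_smul_smul, bU_algebraMap_smul, lam0_eq, alf, br]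
  refine and_congr_right fun _ => ?_
  rw [sub_eq_iff_eq_add, ← add_smul, inv_smul_eq_iff₀ hq, smul_smul]

lemma IsBasic.Tp {c : ℝ} {v : V} (hv : IsBasic (q := q) (a := a) c v) :
    IsBasic (q := q) (a := a) (c + 2) (bU (Tp q a (qpow q c)) • v) := by
  have hq := qc_ne q
  have hr := qpow_ne q a
  have hC := qpow_ne q c
  constructor
  · rw [iBU_smul_bU_smul hv.1]
    have e : (⟨wop q a (mu q (qpow q c)) (SLqR.Tp q a (qpow q c)), wop_mem _ (SLqR.Tp q a _).2⟩ :
        podles q a) = mu q (qpow q (c + 2)) • SLqR.Tp q a (qpow q c) := by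
      ext1
      rw [qpow_add_two]
      exact wop_Tp a hC
    rw [e, bU_smul_smul, smul_smul, qn_eq_mu]
  · rw [qpow_add_two, ← mul_smul, ← map_mul, At_mul_Tp a hC, map_add, add_smul, map_mul, mul_smul,
      hv.2, bU_smul_smul, smul_comm, ← add_smul]
    congr 1
    rw [alf, alf, br, br, s1, sa1, sa]
    field_simp
    ring

lemma IsBasic.Tm {c : ℝ} {v : V} (hv : IsBasic (q := q) (a := a) c v) :
    IsBasic (q := q) (a := a) (c - 2) (bU (Tm q a (qpow q c)) • v) := by
  have hq := qc_ne q
  have hr := qpow_ne q a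
  have hC := qpow_ne q c
  constructor
  · rw [iBU_smul_bU_smul hv.1]
    have e : (⟨wop q a (mu q (qpow q c)) (SLqR.Tm q a (qpow q c)), wop_mem _ (SLqR.Tm q a _).2⟩ :
        podles q a) = mu q (qpow q (c - 2)) • SLqR.Tm q a (qpow q c) := by
      ext1
      rw [qpow_sub_two]
      exact wop_Tm a hC
    rw [e, bU_smul_smul, smul_smul, qn_eq_mu]
  · rw [qpow_sub_two, ← mul_smul, ← map_mul, At_mul_Tm a hC, map_mul, mul_smul, map_add, map_sub,
      add_smul, sub_smul, hv.2, bU_algebraMap_smul, bU_algebraMap_smul, ← sub_smul, ← add_smul,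
      smul_comm]
    congr 1
    rw [alf, alf, br, br, s1, sa1, sa]
    field_simp
    ring

lemma IsBasic.Tm_Tp {c : ℝ} {v : V} (hv : IsBasic (q := q) (a := a) c v) :
    bU (SLqR.Tm q a (qpow q (c + 2))) • (bU (SLqR.Tp q a (qpow q c)) • v) =
      ta q a (qpow q c) • v := by
  have hq := qc_ne q
  have hr := qpow_ne q a
  have hC := qpow_ne q c
  rw [qpow_add_two, ← mul_smul, ← map_mul, Tm_mul_Tp a hC, map_sub, sub_smul, map_mul, mul_smul,
    bU_smul_smul, hv.2, smul_comm, hv.2, smul_smul, smul_smul, ← sub_smul]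
  congr 1
  rw [alf, ta, br, br, s1, sa]
  field_simp
  ring

lemma IsBasic.Tp_Tm {c : ℝ} {v : V} (hv : IsBasic (q := q) (a := a) c v) :
    bU (SLqR.Tp q a (qpow q (c - 2))) • (bU (SLqR.Tm q a (qpow q c)) • v) =
      ta q a (qpow q (c - 2)) • v := by
  have hq := qc_ne q
  have hr := qpow_ne q a
  have hC := qpow_ne q c
  have h1 (r : ℂ) : bU (At q a (qpow q c) - algebraMap ℂ _ r) • v =
      (alf q a (qpow q c) - r) • v := by
    rw [map_sub, sub_smul, hv.2, bU_algebraMap_smul, sub_smul]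
  rw [qpow_sub_two, ← mul_smul, ← map_mul, Tp_mul_Tm a hC, map_mul, mul_smul, map_add,
    add_smul, h1, bU_algebraMap_smul, ← add_smul, smul_comm, h1, smul_smul]
  congr 1
  simp only [alf, ta, br, s1, sa, sa1]
  field_simp
  ring

lemma IsBasic.smul {c : ℝ} {v : V} (hv : IsBasic (q := q) (a := a) c v) (r : ℂ) :
    IsBasic (q := q) (a := a) c (r • v) :=
  ⟨by rw [smul_comm, hv.1, smul_comm], by rw [smul_comm, hv.2, smul_comm]⟩

/-- A family of basic vectors of weights `c + 2 n` on which `T^±` act as shifts with coefficients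
`p` and `m`. -/
def IsString (c : ℝ) (p m : ℤ → ℂ) (f : ℤ → V) : Prop :=
  ∀ n : ℤ, IsBasic (q := q) (a := a) (c + 2 * n) (f n) ∧
    bU (Tp q a (qpow q (c + 2 * n))) • f n = p n • f (n + 1) ∧
    bU (Tm q a (qpow q (c + 2 * n))) • f n = m n • f (n - 1)

variable {c : ℝ} {p m : ℤ → ℂ} {f : ℤ → V}

/-- The generators act on a string by tridiagonal operators. -/
lemma IsString.combo (hf : IsString (q := q) (a := a) c p m f) (n : ℤ) (x y z : ℂ) :
    bU (x • Tp q a (qpow q (c + 2 * n)) + y • Tm q a (qpow q (c + 2 * n)) +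
      z • (At q a (qpow q (c + 2 * n)) - algebraMap ℂ _ (atc q a (qpow q (c + 2 * n))))) • f n =
    (x * p n) • f (n + 1) + (y * m n) • f (n - 1) +
      (z * (alf q a (qpow q (c + 2 * n)) - atc q a (qpow q (c + 2 * n)))) • f n := by
  rw [map_add, map_add, add_smul, add_smul, bU_smul_smul, bU_smul_smul, bU_smul_smul, map_sub,
    sub_smul, bU_algebraMap_smul, (hf n).1.2, (hf n).2.1, (hf n).2.2, ← sub_smul, smul_smul,
    smul_smul, smul_smul]

lemma IsString.smul_mem_span (hf : IsString (q := q) (a := a) c p m f) (x : UqSL q a) {v : V}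
    (hv : v ∈ Submodule.span ℂ (Set.range f)) : x • v ∈ Submodule.span ℂ (Set.range f) := by
  have hmem (n : ℤ) (s : ℂ) : s • f n ∈ Submodule.span ℂ (Set.range f) :=
    Submodule.smul_mem _ _ (Submodule.subset_span ⟨n, rfl⟩)
  have of_basis (x : UqSL q a) (h : ∀ n, x • f n ∈ Submodule.span ℂ (Set.range f)) {v : V}
      (hv : v ∈ Submodule.span ℂ (Set.range f)) : x • v ∈ Submodule.span ℂ (Set.range f) := by
    induction hv using Submodule.span_induction with
    | mem v hv => obtain ⟨n, rfl⟩ := hv; exact h n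
    | zero => rw [smul_zero]; exact zero_mem _
    | add v w _ _ hv hw => rw [smul_add]; exact add_mem hv hw
    | smul r v _ hv => rw [smul_comm]; exact Submodule.smul_mem _ _ hv
  induction x using UqSL_induction generalizing v with
  | hb b =>
    induction b using podles_induction generalizing v with
    | hX =>
      refine of_basis _ (fun n => ?_) hv
      rw [PX_eq a (c + 2 * n), hf.combo]
      exact add_mem (add_mem (hmem _ _) (hmem _ _)) (hmem _ _)
    | hY =>
      refine of_basis _ (fun n => ?_) hv
      rw [PY_eq a (c + 2 * n), hf.combo]
      exact add_mem (add_mem (hmem _ _) (hmem _ _)) (hmem _ _)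
    | hZ =>
      refine of_basis _ (fun n => ?_) hv
      rw [PZ_eq a (c + 2 * n), hf.combo]
      exact add_mem (add_mem (hmem _ _) (hmem _ _)) (hmem _ _)
    | hC r => rw [bU_algebraMap_smul]; exact Submodule.smul_mem _ _ hv
    | hadd b b' h h' => rw [map_add, add_smul]; exact add_mem (h hv) (h' hv)
    | hmul b b' h h' => rw [map_mul, mul_smul]; exact h (h' hv)
  | hB => exact of_basis _ (fun n => by rw [(hf n).1.1]; exact hmem _ _) hv
  | hc r => rw [algebraMap_smul_UqSL]; exact Submodule.smul_mem _ _ hv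
  | hadd x y h h' => rw [add_smul]; exact add_mem (h hv) (h' hv)
  | hmul x y h h' => rw [mul_smul]; exact h (h' hv)

/-- The string through a basic vector, obtained by applying `T^+` upwards and `T^-` downwards. -/
def str (q : QParam) (a c : ℝ) (v : V) [Module (UqSL q a) V] : ℤ → V
  | Int.ofNat n => n.rec v fun k w => bU (Tp q a (qpow q (c + 2 * k))) • w
  | Int.negSucc n => n.rec (bU (Tm q a (qpow q c)) • v)
      fun k w => bU (Tm q a (qpow q (c - 2 * (k + 1)))) • w

lemma str_zero (v : V) : str q a c v 0 = v := rfl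

lemma str_add_one (v : V) {n : ℤ} (hn : 0 ≤ n) :
    str q a c v (n + 1) = bU (Tp q a (qpow q (c + 2 * n))) • str q a c v n := by
  lift n to ℕ using hn
  rfl

lemma str_sub_one (v : V) {n : ℤ} (hn : n ≤ 0) :
    str q a c v (n - 1) = bU (Tm q a (qpow q (c + 2 * n))) • str q a c v n := by
  obtain ⟨k, rfl⟩ : ∃ k : ℕ, n = -k := ⟨n.natAbs, by omega⟩
  cases k with
  | zero => simp; rfl
  | succ k =>
    rw [show (-((k + 1 : ℕ) : ℤ) - 1) = Int.negSucc (k + 1) by omega,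
      show (-((k + 1 : ℕ) : ℤ)) = Int.negSucc k by omega]
    have e : c + 2 * ((Int.negSucc k : ℤ) : ℝ) = c - 2 * ((k : ℝ) + 1) := by
      rw [Int.negSucc_eq]; push_cast; ring
    rw [e]
    rfl

/-- The coefficients of `T^+` on a string. -/
def strP (q : QParam) (a c : ℝ) (n : ℤ) : ℂ := if 0 ≤ n then 1 else ta q a (qpow q (c + 2 * n))

/-- The coefficients of `T^-` on a string. -/
def strM (q : QParam) (a c : ℝ) (n : ℤ) : ℂ :=
  if n ≤ 0 then 1 else ta q a (qpow q (c + 2 * (n - 1 : ℤ)))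

lemma isString_str {v : V} (hv : IsBasic (q := q) (a := a) c v) :
    IsString (q := q) (a := a) c (strP q a c) (strM q a c) (str q a c v) := by
  have hb (n : ℤ) : IsBasic (q := q) (a := a) (c + 2 * n) (str q a c v n) := by
    induction n using Int.induction_on with
    | zero => simpa [str_zero] using hv
    | succ n ih =>
      rw [str_add_one v (by omega)]
      convert ih.Tp using 1
      push_cast; ring
    | pred n ih =>
      rw [str_sub_one v (by omega)]
      convert ih.Tm using 1
      push_cast; ring
  refine fun n => ⟨hb n, ?_, ?_⟩
  · rw [strP]
    split_ifs with h
    · rw [str_add_one v h, one_smul]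
    · have h1 := (hb (n + 1)).Tp_Tm
      rw [← str_sub_one v (by omega), add_sub_cancel_right,
        show c + 2 * ((n + 1 : ℤ) : ℝ) - 2 = c + 2 * n by push_cast; ring] at h1
      exact h1
  · rw [strM]
    split_ifs with h
    · rw [str_sub_one v h, one_smul]
    · have h1 := (hb (n - 1)).Tm_Tp
      rw [← str_add_one v (by omega), sub_add_cancel,
        show c + 2 * ((n - 1 : ℤ) : ℝ) + 2 = c + 2 * n by push_cast; ring] at h1
      exact h1

end strings

/-! ### Instances on the modules `M_{λ,b}` and `L_{λ,b}` -/

-- Direct names for instances that are otherwise found by a long search through the scalar actions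
-- of subalgebras on quotients; they are used as local instances only.

section shortcuts
variable (q : QParam) (a lam b : ℝ)

/-- The additive group of `M_{λ,b}`. -/
abbrev addCommGroupMmod : AddCommGroup (Mmod q a lam b) := inferInstance
/-- `M_{λ,b}` as a module over `U_q(sl(2,ℝ)_t)`. -/
abbrev moduleMmod : Module (UqSL q a) (Mmod q a lam b) := inferInstance
/-- The scalar multiplication of `U_q(sl(2,ℝ)_t)` on `M_{λ,b}`. -/
abbrev smulMmod : SMul (UqSL q a) (Mmod q a lam b) := inferInstance
/-- `M_{λ,b}` as a complex vector space. -/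
abbrev moduleComplexMmod : Module ℂ (Mmod q a lam b) := inferInstance
/-- The addition of `M_{λ,b}`. -/
abbrev addMmod : Add (Mmod q a lam b) := inferInstance
lemma isScalarTowerMmod : IsScalarTower ℂ (UqSL q a) (Mmod q a lam b) := inferInstance
set_option synthInstance.maxHeartbeats 80000 in
lemma smulCommClassMmod : SMulCommClass (UqSL q a) ℂ (Mmod q a lam b) := inferInstance
/-- The additive group of `L_{λ,b}`. -/
abbrev addCommGroupLmod : AddCommGroup (Lmod q a lam b) := inferInstance
/-- `L_{λ,b}` as a module over `U_q(sl(2,ℝ)_t)`. -/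
abbrev moduleLmod : Module (UqSL q a) (Lmod q a lam b) := inferInstance
/-- The scalar multiplication of `U_q(sl(2,ℝ)_t)` on `L_{λ,b}`. -/
abbrev smulLmod : SMul (UqSL q a) (Lmod q a lam b) := inferInstance
/-- `L_{λ,b}` as a complex vector space. -/
abbrev moduleComplexLmod : Module ℂ (Lmod q a lam b) := inferInstance
lemma isScalarTowerLmod : IsScalarTower ℂ (UqSL q a) (Lmod q a lam b) := inferInstance
set_option synthInstance.maxHeartbeats 80000 in
/-- The scalar multiplication of `U_q(sl(2,ℝ)_t)` on `D_2^+ ⊕ D_2^-`. -/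
abbrev smulDD : SMul (UqSL q a) (DD q a) := inferInstance
/-- `D_2^+ ⊕ D_2^-` as a complex vector space. -/
abbrev moduleComplexDD : Module ℂ (DD q a) := inferInstance

end shortcuts

attribute [local instance] addCommGroupMmod moduleMmod smulMmod moduleComplexMmod addMmod
  isScalarTowerMmod smulCommClassMmod addCommGroupLmod moduleLmod smulLmod
  moduleComplexLmod isScalarTowerLmod smulDD moduleComplexDD

/-! ### The action of `O_q(S_t²) ⋈ 𝓘_c` on the Podleś sphere -/

/-- Evaluate `b₍₂₎ S⁻¹(b₍₁₎) = ε(b)` using that the second leg lies in the Podleś sphere. -/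
lemma apply_Sinv_stab {a : ℝ} {y : Dual q} (hy : y ∈ stabDual q a) {b : OqSU2 q}
    (hb : b ∈ podles q a) : y (Sinv q b) = counit (R := ℂ) b * y 1 := by
  set L : OqSU2 q ⊗[ℂ] OqSU2 q →ₗ[ℂ] OqSU2 q :=
    LinearMap.mul' ℂ _ ∘ₗ (TensorProduct.comm ℂ _ _).toLinearMap ∘ₗ (Sinv q).rTensor _ with hL
  have h1 : ∀ X ∈ Submodule.span ℂ {t : OqSU2 q ⊗[ℂ] OqSU2 q | ∃ u, ∃ v ∈ podles q a, t = u ⊗ₜ v},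
      y (L X) = y (Sinv q (TensorProduct.rid ℂ _ ((counit (R := ℂ)).lTensor (OqSU2 q) X))) := by
    intro X hX
    induction hX using Submodule.span_induction with
    | mem X hX =>
      obtain ⟨u, v, hv, rfl⟩ := hX
      simp only [hL, LinearMap.comp_apply, LinearMap.rTensor_tmul, LinearEquiv.coe_coe,
        TensorProduct.comm_tmul, LinearMap.mul'_apply, LinearMap.lTensor_tmul,
        TensorProduct.rid_tmul, map_smul, dual_map_smul, stab_apply_mul hy hv, smul_eq_mul]
    | zero => simp
    | add X Y _ _ hX hY => simp only [map_add, dual_map_add, hX, hY]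
    | smul r X _ hX => simp only [map_smul, dual_map_smul, hX]
  have h2 : ∀ X : OqSU2 q ⊗[ℂ] OqSU2 q, S q (L X) = LinearMap.mul' ℂ _ ((S q).lTensor _ X) := by
    intro X
    induction X with
    | zero => simp
    | add X Y hX hY => simp only [map_add, hX, hY]
    | tmul u v => simp [hL, S_mul, S_Sinv]
  have h3 : L (comul b) = algebraMap ℂ _ (counit (R := ℂ) b) := by
    rw [← Sinv_S (L (comul b)), h2]
    have : LinearMap.mul' ℂ _ ((S q).lTensor _ (comul b)) =
      algebraMap ℂ (OqSU2 q) (counit (R := ℂ) b) := HopfAlgebra.mul_antipode_lTensor_comul_apply b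
    rw [this, Sinv_algebraMap]
  have h4 := h1 _ (comul_mem_of_podles hb)
  rw [h3, Coalgebra.lTensor_counit_comul, TensorProduct.rid_tmul, one_smul,
    Algebra.algebraMap_eq_smul_one, dual_map_smul] at h4
  exact h4.symm

lemma act_mem_podles {a : ℝ} {z : Double q} (hz : z ∈ DCoid q a) {b : OqSU2 q}
    (hb : b ∈ podles q a) : act z b ∈ podles q a := by
  induction hz using Algebra.adjoin_induction generalizing b with
  | mem z hz =>
    rcases hz with ⟨c, hc, rfl⟩ | ⟨y, hy, rfl⟩
    · rw [act_ofA]; exact mul_mem hc hb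
    · rw [act_ofU (Ic_le_stabDual a hy) hb]; exact ract_mem_podles _ hb
  | algebraMap r =>
    rw [AlgHom.commutes, Module.algebraMap_end_apply]; exact Subalgebra.smul_mem _ hb r
  | add z w _ _ hz hw => rw [map_add]; exact add_mem (hz hb) (hw hb)
  | mul z w _ _ hz hw => rw [map_mul]; exact hz (hw hb)

/-- The one-dimensional representation `ε` of `O_q(S_t²) ⋈ 𝓘_c` is a quotient of its representation on
the Podleś sphere. -/
lemma counit_act {a : ℝ} {z : Double q} (hz : z ∈ DCoid q a) {b : OqSU2 q}
    (hb : b ∈ podles q a) :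
    counit (R := ℂ) (act z b) = Double.counitD z * counit (R := ℂ) b := by
  rw [← counit_act_one]
  induction hz using Algebra.adjoin_induction generalizing b with
  | mem z hz =>
    rcases hz with ⟨c, hc, rfl⟩ | ⟨y, hy, rfl⟩
    · rw [act_ofA, act_ofA, mul_one, Bialgebra.counit_mul]
    · have hy' := Ic_le_stabDual a hy
      have h (c : OqSU2 q) (hc : c ∈ podles q a) :
          counit (R := ℂ) (act (Double.ofU y) c) = counit (R := ℂ) c * y 1 := by
        rw [act_ofU hy' hc, counit_ract, dualSinv_apply, apply_Sinv_stab hy' hc]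
      rw [h b hb, h 1 (one_mem _), Bialgebra.counit_one]
      ring
  | algebraMap r => simp [Module.algebraMap_end_apply]
  | add z w _ _ hz hw =>
    rw [map_add, LinearMap.add_apply, LinearMap.add_apply, map_add, map_add, hz hb, hw hb, add_mul]
  | mul z w _ hw' hz hw =>
    rw [map_mul, Module.End.mul_apply, Module.End.mul_apply, hz (act_mem_podles hw' hb), hw hb,
      hz (act_mem_podles hw' (one_mem _)), mul_assoc]

/-- The action of `O_q(S_t²) ⋈ 𝓘_c` on the Podleś sphere. -/
def actD (q : QParam) (a : ℝ) : DCoid q a →ₐ[ℂ] Module.End ℂ (podles q a) :=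
  AlgHom.ofLinearMap
    { toFun := fun z =>
        { toFun := fun b => ⟨act (z : Double q) b, act_mem_podles z.2 b.2⟩
          map_add' := fun b c => by ext1; simp
          map_smul' := fun r b => by ext1; simp }
      map_add' := fun z w => by ext b; simp
      map_smul' := fun r z => by ext b; simp }
    (by ext b; simp)
    (fun z w => by ext b; simp)

lemma actD_coe {a : ℝ} (z : DCoid q a) (b : podles q a) :
    (actD q a z b : OqSU2 q) = act (z : Double q) b := rfl

lemma actD_bD {a : ℝ} (b c : podles q a) : actD q a (bD b) c = b * c :=
  Subtype.ext (act_ofA _ _)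

/-- The element `ψ_m` of `O_q(S_t²) ⋈ 𝓘_c`. -/
def psiD (q : QParam) (a : ℝ) (m : ℤ) : DCoid q a := yD (psi q a m) (psi_mem_Ic a m)

lemma DCoid_induction {a : ℝ} {P : DCoid q a → Prop} (hb : ∀ b, P (bD b)) (hp : ∀ m, P (psiD q a m))
    (hc : ∀ r, P (algebraMap ℂ _ r)) (hadd : ∀ z w, P z → P w → P (z + w))
    (hmul : ∀ z w, P z → P w → P (z * w)) (z : DCoid q a) : P z := by
  obtain ⟨z, hz⟩ := z
  induction hz using Algebra.adjoin_induction with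
  | mem z hz =>
    rcases hz with ⟨c, hc, rfl⟩ | ⟨y, hy, rfl⟩
    · exact hb ⟨c, hc⟩
    · have key : ∀ y ∈ Submodule.span ℂ (Set.range (psi q a)),
          ∃ h : Double.ofU y ∈ DCoid q a, P ⟨_, h⟩ := by
        intro y hy
        induction hy using Submodule.span_induction with
        | mem y hy =>
          obtain ⟨m, rfl⟩ := hy
          exact ⟨_, hp m⟩
        | zero =>
          refine ⟨by rw [map_zero]; exact zero_mem _, ?_⟩
          convert hc 0 using 1
          ext1; simp
        | add y y' _ _ h h' =>
          refine ⟨by rw [map_add]; exact add_mem h.1 h'.1, ?_⟩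
          convert hadd _ _ h.2 h'.2 using 1
          ext1; simp
        | smul r y _ h =>
          refine ⟨by rw [map_smul]; exact Subalgebra.smul_mem _ h.1 r, ?_⟩
          convert hmul _ _ (hc r) h.2 using 1
          rw [← Algebra.smul_def]
          ext1; simp
      exact (key y (Ic_eq (q := q) a ▸ hy)).2
  | algebraMap r => exact hc r
  | add z w hz hw h h' => exact hadd ⟨z, hz⟩ ⟨w, hw⟩ h h'
  | mul z w hz hw h h' => exact hmul ⟨z, hz⟩ ⟨w, hw⟩ h h'

/-- The operator `i B_t` on the Podleś sphere. -/
def tauB (q : QParam) (a : ℝ) : podles q a →ₗ[ℂ] podles q a where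
  toFun b := ⟨ract (dualSinv (iBt q a)) b, ract_mem_podles _ b.2⟩
  map_add' b c := by ext1; simp
  map_smul' r b := by ext1; simp

lemma actD_yD {a : ℝ} {y : Dual q} (hy : y ∈ Ic q a) (b : podles q a) :
    (actD q a (yD y hy) b : OqSU2 q) = ract (dualSinv y) b :=
  act_ofU (Ic_le_stabDual a hy) b.2

lemma tauB_coe {a : ℝ} (b : podles q a) :
    (tauB q a b : OqSU2 q) = act (Double.ofU (iBt q a)) b :=
  (act_ofU (iBt_mem_stabDual a) b.2).symm

lemma actD_iBt_mul {a : ℝ} {y : Dual q} (hy : y ∈ Ic q a) (b : podles q a) :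
    actD q a (yD (iBt q a * y) (iBt_mul_mem hy)) b = tauB q a (actD q a (yD y hy) b) := by
  ext1
  rw [tauB_coe, actD_coe, actD_coe, ← Module.End.mul_apply, ← map_mul]
  congr 3
  exact map_mul Double.ofU (iBt q a) y

lemma tauB_psiD {a : ℝ} (m : ℤ) (b : podles q a) :
    tauB q a (actD q a (psiD q a m) b) = (qn q (a + m) : ℂ) • actD q a (psiD q a m) b := by
  rw [psiD, ← actD_iBt_mul]
  ext1
  rw [actD_yD, Subalgebra.coe_smul, actD_yD, (psi_isWeight a m).1]
  exact ract_smul (qn q (a + m) : ℂ) (dualSinv (psi q a m)) _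

lemma psiD_tauB {a : ℝ} (m : ℤ) (b : podles q a) :
    actD q a (psiD q a m) (tauB q a b) = (qn q (a + m) : ℂ) • actD q a (psiD q a m) b := by
  ext1
  have h : Double.ofU (psi q a m) * Double.ofU (iBt q a) =
      (qn q (a + m) : ℂ) • Double.ofU (psi q a m) := by
    rw [← map_mul, (psi_isWeight a m).2, map_smul]
  rw [Subalgebra.coe_smul, actD_coe, actD_coe, tauB_coe, ← Module.End.mul_apply, ← map_mul]
  change act (Double.ofU (psi q a m) * _) _ = _ • act (Double.ofU (psi q a m)) _
  rw [h, map_smul, LinearMap.smul_apply]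

lemma sum_psiD {a : ℝ} (b : podles q a) : ∃ F : Finset ℤ, ∀ F' : Finset ℤ, F ⊆ F' →
    ∑ m ∈ F', actD q a (psiD q a m) b = b := by
  classical
  set r := ℛ ℂ (b : OqSU2 q) with hr
  choose G hG using fun x : OqSU2 q => sum_proj a x
  refine ⟨r.index.biUnion fun i => G (Sinv q (r.left i)), fun F' hF => ?_⟩
  ext1
  have h1 (h : Dual q) : ract h (b : OqSU2 q) = ∑ i ∈ r.index, h (r.left i) • r.right i := by
    nth_rewrite 1 [ract, LinearMap.comp_apply, LinearMap.comp_apply, ← r.eq]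
    simp
  rw [AddSubmonoidClass.coe_finsetSum]
  have h2 : ∀ m, ((actD q a (psiD q a m) b : podles q a) : OqSU2 q) =
      ∑ i ∈ r.index, psi q a m (Sinv q (r.left i)) • r.right i := fun m => by
    rw [psiD, actD_yD, h1]; rfl
  rw [Finset.sum_congr rfl fun m _ => h2 m, Finset.sum_comm]
  have h3 := h1 1
  simp only [ract_one, dual_one_apply] at h3
  refine Eq.trans (Finset.sum_congr rfl fun i hi => ?_) h3.symm
  rw [← Finset.sum_smul]
  congr 1
  have h4 := hG (Sinv q (r.left i)) F' ((Finset.subset_biUnion_of_mem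
    (fun i => G (Sinv q (r.left i))) hi).trans hF)
  rw [← counit_Sinv, ← h4, map_sum, h4]
  rfl

/-- Projections that split an operator into scalars `lam m` are determined on its eigenvectors. -/
lemma projection_eigenvector {ι V : Type*} [DecidableEq ι] [AddCommGroup V] [Module ℂ V]
    {P : ι → V →ₗ[ℂ] V}
    {T : V →ₗ[ℂ] V} {lam : ι → ℂ} (hlam : Function.Injective lam)
    (hPT : ∀ m v, P m (T v) = lam m • P m v)
    (hsum : ∀ v, ∃ F : Finset ι, ∀ F' : Finset ι, F ⊆ F' → ∑ m ∈ F', P m v = v)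
    {j : ι} {v : V} (hv : T v = lam j • v) (m : ι) : P m v = if m = j then v else 0 := by
  have h0 (m : ι) (hm : m ≠ j) : P m v = 0 := by
    have h := hPT m v
    rw [hv, map_smul, ← sub_eq_zero, ← sub_smul] at h
    exact (smul_eq_zero.1 h).resolve_left (sub_ne_zero.2 fun h' => hm (hlam h').symm)
  split_ifs with h
  · subst h
    obtain ⟨F, hF⟩ := hsum v
    have h1 := hF (insert m F) (Finset.subset_insert _ _)
    rwa [Finset.sum_eq_single_of_mem m (Finset.mem_insert_self _ _) fun i _ hi => h0 i hi] at h1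
  · exact h0 m h

/-! ### The module `M_{q+q⁻¹,a}` as a quotient of the Podleś sphere -/

/-- The element `A_a - (q + q⁻¹)`, which generates the left ideal of `O_q(S_t²)` that kills
`e_a`. -/
def c0 (q : QParam) (a : ℝ) : podles q a := Ac q a a - algebraMap ℂ _ (lam0 q : ℂ)

lemma c0_eq (a : ℝ) : c0 q a = (qc q)⁻¹ • At q a (qpow q a) -
    algebraMap ℂ _ ((qc q)⁻¹ * alf q a (qpow q a)) := by
  have hq := qc_ne q
  rw [c0, Ac_eq, sub_sub, ← map_add, lam0_eq]
  congr 2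
  rw [alf, br]
  field_simp
  ring

lemma tauB_eq {a : ℝ} (b : podles q a) :
    (tauB q a b : OqSU2 q) = Complex.I • wop q a (mu q (qpow q a)) b := by
  have h : mu q (qpow q a) + kap q a = 0 := by
    rw [kap_eq, qn_eq_mu, ← mul_assoc, Complex.I_mul_I]; ring
  have h2 : (tauB q a b : OqSU2 q) = Complex.I • ract (dualSinv (Bt q a)) b :=
    ract_smul Complex.I (dualSinv (Bt q a)) _
  rw [h2, wop, h, zero_smul, zero_add]

/-- As `A_a` preserves the weight `[a]`, right multiplication by `A_a - (q + q⁻¹)` commutes with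
`i B_t`. -/
lemma tauB_mul_c0 {a : ℝ} (b : podles q a) : tauB q a (b * c0 q a) = tauB q a b * c0 q a := by
  have h1 (h : Dual q) : ract h 1 = h 1 • 1 := by
    simp [ract, Algebra.TensorProduct.one_def]
  have h2 : wop q a (mu q (qpow q a)) 1 = mu q (qpow q a) • 1 := by
    have e1 : k q 1 = 1 := by simpa using k_algebraMap (q := q) 1
    have e2 : dualSinv (Bt q a) 1 = -kap q a := by rw [dualSinv_apply, Sinv_one, Bt_one]
    rw [wop, LinearMap.add_apply, LinearMap.smul_apply, h1, h1, e1, e2]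
    module
  have h3 : wop q a (mu q (qpow q a)) (c0 q a) = mu q (qpow q a) • (c0 q a : OqSU2 q) := by
    rw [c0_eq, Subalgebra.coe_sub, Subalgebra.coe_smul, Subalgebra.coe_algebraMap,
      Algebra.algebraMap_eq_smul_one, map_sub, map_smul, map_smul, h2, wop_At a (qpow_ne q a)]
    module
  ext1
  rw [tauB_eq, Subalgebra.coe_mul, wop_mul h3, Subalgebra.coe_mul, tauB_eq, smul_mul_assoc]

/-- The matrix units are the eigenprojections of `i B_t`, so they also commute with right
multiplication by `A_a - (q + q⁻¹)`. -/
lemma psiD_mul_c0 {a : ℝ} (m : ℤ) (b : podles q a) :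
    actD q a (psiD q a m) (b * c0 q a) = actD q a (psiD q a m) b * c0 q a := by
  classical
  obtain ⟨F, hF⟩ := sum_psiD b
  have h1 := hF (insert m F) (Finset.subset_insert _ _)
  have h2 (j : ℤ) : actD q a (psiD q a m) (actD q a (psiD q a j) b * c0 q a) =
      if m = j then actD q a (psiD q a j) b * c0 q a else 0 := by
    refine projection_eigenvector (lam := fun m : ℤ => (qn q (a + m) : ℂ)) (qn_int_injective a)
      (P := fun m => actD q a (psiD q a m)) (T := tauB q a) psiD_tauB sum_psiD ?_ m
    rw [tauB_mul_c0, tauB_psiD, smul_mul_assoc]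
  nth_rewrite 1 [← h1]
  rw [Finset.sum_mul, map_sum, Finset.sum_congr rfl fun j _ => h2 j, Finset.sum_ite_eq,
    if_pos (Finset.mem_insert_self _ _)]

lemma actD_mul_c0 {a : ℝ} (z : DCoid q a) (b : podles q a) :
    actD q a z (b * c0 q a) = actD q a z b * c0 q a := by
  induction z using DCoid_induction generalizing b with
  | hb c => rw [actD_bD, actD_bD, mul_assoc]
  | hp m => exact psiD_mul_c0 m b
  | hc r => rw [AlgHom.commutes, Module.algebraMap_end_apply, Module.algebraMap_end_apply,
      smul_mul_assoc]
  | hadd z w hz hw => rw [map_add, LinearMap.add_apply, hz, hw, LinearMap.add_apply, add_mul]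
  | hmul z w hz hw =>
    rw [map_mul (actD q a), Module.End.mul_apply, hw, hz, Module.End.mul_apply]

/-- The map `b ↦ b e_a`. -/
def theta (q : QParam) (a : ℝ) : podles q a →ₗ[ℂ] MM q a where
  toFun b := bU b • ea q a
  map_add' b c := by rw [map_add, add_smul]
  map_smul' r b := bU_smul_smul r b _

lemma theta_apply {a : ℝ} (b : podles q a) : theta q a b = bU b • ea q a := rfl

lemma theta_one (a : ℝ) : theta q a 1 = ea q a := by rw [theta_apply, map_one, one_smul]

lemma cyc_eq_zero (a lam b : ℝ) {x : UqSL q a} :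
    x • Mmod.cyc q a lam b = 0 ↔ x ∈ basicIdeal q a lam b := by
  rw [Mmod.cyc, ← Submodule.Quotient.mk_smul, smul_eq_mul, mul_one,
    Submodule.Quotient.mk_eq_zero]

lemma isBasic_cyc (a b : ℝ) : IsBasic (q := q) (a := a) b (Mmod.cyc q a (lam0 q) b) := by
  rw [isBasic_iff]
  constructor
  · rw [← sub_eq_zero, ← algebraMap_smul_UqSL (q := q) (a := a) (qn q b : ℂ), ← sub_smul,
      cyc_eq_zero]
    exact Submodule.subset_span (by simp)
  · rw [← sub_eq_zero, ← algebraMap_smul_UqSL (q := q) (a := a) (lam0 q : ℂ), ← sub_smul,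
      cyc_eq_zero]
    exact Submodule.subset_span (by simp)

lemma iBU_smul_theta {a : ℝ} (b : podles q a) : iBU q a • theta q a b = theta q a (tauB q a b) := by
  rw [theta_apply, ea, iBU_smul_bU_smul (isBasic_cyc (q := q) a a).1, ← bU_smul_smul]
  congr 2
  ext1
  rw [tauB_eq]
  rfl

lemma theta_surjective (a : ℝ) : Function.Surjective (theta q a) := by
  have h : ∀ (x : UqSL q a) (v : MM q a), v ∈ LinearMap.range (theta q a) →
      x • v ∈ LinearMap.range (theta q a) := by
    intro x
    induction x using UqSL_induction with
    | hb b => rintro _ ⟨c, rfl⟩; exact ⟨b * c, by rw [theta_apply, map_mul, mul_smul]; rfl⟩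
    | hB => rintro _ ⟨c, rfl⟩; exact ⟨tauB q a c, (iBU_smul_theta c).symm⟩
    | hc r => intro v hv; rw [algebraMap_smul_UqSL]; exact Submodule.smul_mem _ _ hv
    | hadd x y hx hy => intro v hv; rw [add_smul]; exact add_mem (hx v hv) (hy v hv)
    | hmul x y hx hy => intro v hv; rw [mul_smul]; exact hx _ (hy v hv)
  intro v
  obtain ⟨x, rfl⟩ := Submodule.Quotient.mk_surjective _ v
  have := h x (ea q a) ⟨1, theta_one a⟩
  rwa [ea, Mmod.cyc, ← Submodule.Quotient.mk_smul, smul_eq_mul, mul_one] at this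

/-- `M_{q+q⁻¹,a}` is the quotient of the Podleś sphere by the left ideal generated by
`A_a - (q + q⁻¹)`. -/
lemma theta_eq_zero {a : ℝ} {b : podles q a} : theta q a b = 0 ↔ ∃ b', b = b' * c0 q a := by
  constructor
  · intro h
    rw [theta_apply, ea, cyc_eq_zero] at h
    -- `x ↦ x • 1 ∈ O_q(S_t²)` maps the left ideal of `e_a` to the multiples of `c0`
    have key : ∀ (x : UqSL q a) (b : podles q a),
        ∃ b' : podles q a, act (x : Double q) (b * c0 q a : podles q a) = (b' * c0 q a : podles q a) := by
      intro x
      induction x using UqSL_induction with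
      | hb c =>
        intro b
        refine ⟨c * b, ?_⟩
        rw [mul_assoc]
        exact act_ofA _ _
      | hB =>
        intro b
        refine ⟨tauB q a b, ?_⟩
        rw [← tauB_mul_c0, tauB_coe]
        rfl
      | hc r =>
        intro b
        refine ⟨r • b, ?_⟩
        rw [Subalgebra.coe_algebraMap, AlgHom.commutes, Module.algebraMap_end_apply,
          smul_mul_assoc]
        rfl
      | hadd x y hx hy =>
        intro b
        obtain ⟨b₁, h₁⟩ := hx b
        obtain ⟨b₂, h₂⟩ := hy b
        refine ⟨b₁ + b₂, ?_⟩
        rw [Subalgebra.coe_add, map_add, LinearMap.add_apply, h₁, h₂, add_mul]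
        rfl
      | hmul x y hx hy =>
        intro b
        obtain ⟨b₁, h₁⟩ := hy b
        obtain ⟨b₂, h₂⟩ := hx b₁
        exact ⟨b₂, by rw [Subalgebra.coe_mul, map_mul, Module.End.mul_apply, h₁, h₂]⟩
    have key2 : ∀ x ∈ basicIdeal q a (lam0 q) a,
        ∃ b' : podles q a, act (x : Double q) 1 = (b' * c0 q a : podles q a) := by
      intro x hx
      induction hx using Submodule.span_induction with
      | mem x hx =>
        rcases hx with rfl | rfl
        · refine ⟨0, ?_⟩
          have h1 : act (iBU q a : Double q) 1 = (qn q a : ℂ) • 1 := by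
            have e1 : dualSinv (iBt q a) 1 = qn q a := by
              rw [dualSinv_apply, Sinv_one, iBt, dual_smul_apply, Bt_one, kap_eq, mul_neg,
                ← mul_assoc, Complex.I_mul_I]
              ring
            have e2 : act (iBU q a : Double q) 1 = ract (dualSinv (iBt q a)) 1 :=
              act_ofU (iBt_mem_stabDual a) (one_mem _)
            rw [e2, ← e1]
            simp [ract, Algebra.TensorProduct.one_def]
          rw [Subalgebra.coe_sub, map_sub, LinearMap.sub_apply, h1, Subalgebra.coe_algebraMap,
            AlgHom.commutes, Module.algebraMap_end_apply, sub_self, zero_mul]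
          rfl
        · refine ⟨1, ?_⟩
          rw [one_mul, c0, Subalgebra.coe_sub, map_sub, LinearMap.sub_apply,
            Subalgebra.coe_algebraMap, AlgHom.commutes, Module.algebraMap_end_apply,
            Subalgebra.coe_sub, Subalgebra.coe_algebraMap, Algebra.algebraMap_eq_smul_one]
          congr 1
          exact (act_ofA _ _).trans (mul_one _)
      | zero => exact ⟨0, by simp⟩
      | add x y _ _ hx hy =>
        obtain ⟨b₁, h₁⟩ := hx
        obtain ⟨b₂, h₂⟩ := hy
        refine ⟨b₁ + b₂, ?_⟩
        rw [Subalgebra.coe_add, map_add, LinearMap.add_apply, h₁, h₂, add_mul]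
        rfl
      | smul x y _ hy =>
        obtain ⟨b₁, h₁⟩ := hy
        obtain ⟨b₂, h₂⟩ := key x b₁
        exact ⟨b₂, by rw [smul_eq_mul, Subalgebra.coe_mul, map_mul, Module.End.mul_apply, h₁, h₂]⟩
    obtain ⟨b', hb'⟩ := key2 _ h
    refine ⟨b', Subtype.ext ?_⟩
    rw [← hb']
    exact ((act_ofA _ _).trans (mul_one _)).symm
  · rintro ⟨b', rfl⟩
    have h := (isBasic_iff.1 (isBasic_cyc (q := q) a a)).2
    rw [theta_apply, map_mul, mul_smul, c0, map_sub, sub_smul, ea, h, bU_algebraMap_smul, sub_self,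
      smul_zero]

/-! ### The representation of `O_q(S_t²) ⋈ 𝓘_c` on `M_{q+q⁻¹,a}` -/

lemma exists_lift_of_surjective {U V W : Type*} [AddCommGroup U] [Module ℂ U] [AddCommGroup V]
    [Module ℂ V] [AddCommGroup W] [Module ℂ W] (T : V →ₗ[ℂ] W) (hT : Function.Surjective T)
    (f : V →ₗ[ℂ] U) (h : ∀ v, T v = 0 → f v = 0) : ∃ g : W →ₗ[ℂ] U, ∀ v, g (T v) = f v := by
  refine ⟨(LinearMap.ker T).liftQ f (fun v hv => h v hv) ∘ₗ
    (T.quotKerEquivOfSurjective hT).symm.toLinearMap, fun v => ?_⟩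
  have : (T.quotKerEquivOfSurjective hT).symm (T v) = Submodule.Quotient.mk v := by
    rw [LinearEquiv.symm_apply_eq]; rfl
  rw [LinearMap.comp_apply, LinearEquiv.coe_coe, this]
  rfl

lemma exists_descent {D V W : Type*} [Ring D] [Algebra ℂ D] [AddCommGroup V] [Module ℂ V]
    [AddCommGroup W] [Module ℂ W] (ρ : D →ₐ[ℂ] Module.End ℂ V) (T : V →ₗ[ℂ] W)
    (hT : Function.Surjective T) (h : ∀ z v, T v = 0 → T (ρ z v) = 0) :
    ∃ π : D →ₐ[ℂ] Module.End ℂ W, ∀ z v, π z (T v) = T (ρ z v) := by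
  choose g hg using fun z => exists_lift_of_surjective T hT (T ∘ₗ ρ z) (h z)
  have hext {x y : Module.End ℂ W} (h : ∀ v, x (T v) = y (T v)) : x = y := by
    ext w
    obtain ⟨v, rfl⟩ := hT w
    exact h v
  refine ⟨AlgHom.ofLinearMap
    { toFun := g
      map_add' := fun z w => hext fun b => by simp [hg]
      map_smul' := fun r z => hext fun b => by simp [hg] }
    (hext fun b => ?_) (fun z w => hext fun b => ?_), hg⟩
  · simp [hg]
  · simp [hg]

lemma exists_piM (q : QParam) (a : ℝ) : ∃ π : DCoid q a →ₐ[ℂ] Module.End ℂ (MM q a),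
    ∀ z b, π z (theta q a b) = theta q a (actD q a z b) := by
  refine exists_descent (actD q a) (theta q a) (theta_surjective a) fun z b hb => ?_
  obtain ⟨b', rfl⟩ := theta_eq_zero.1 hb
  rw [actD_mul_c0]
  exact theta_eq_zero.2 ⟨_, rfl⟩

/-- The representation of `O_q(S_t²) ⋈ 𝓘_c` on `M_{q+q⁻¹,a}`. -/
def piM (q : QParam) (a : ℝ) : DCoid q a →ₐ[ℂ] Module.End ℂ (MM q a) := (exists_piM q a).choose

lemma piM_theta {a : ℝ} (z : DCoid q a) (b : podles q a) :
    piM q a z (theta q a b) = theta q a (actD q a z b) := (exists_piM q a).choose_spec z b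

lemma theta_induction {a : ℝ} {P : MM q a → Prop} (h : ∀ b, P (theta q a b)) (v : MM q a) : P v := by
  obtain ⟨b, rfl⟩ := theta_surjective a v
  exact h b

lemma piM_bD {a : ℝ} (b : podles q a) (v : MM q a) : piM q a (bD b) v = bU b • v := by
  induction v using theta_induction with
  | h c => rw [piM_theta, actD_bD, theta_apply, theta_apply, map_mul, mul_smul]

lemma piM_iBt_mul {a : ℝ} {y : Dual q} (hy : y ∈ Ic q a) (v : MM q a) :
    piM q a (yD (iBt q a * y) (iBt_mul_mem hy)) v = iBU q a • piM q a (yD y hy) v := by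
  induction v using theta_induction with
  | h c => rw [piM_theta, piM_theta, actD_iBt_mul, iBU_smul_theta]

lemma piM_psiD_iBU {a : ℝ} (m : ℤ) (v : MM q a) :
    piM q a (psiD q a m) (iBU q a • v) = (qn q (a + m) : ℂ) • piM q a (psiD q a m) v := by
  induction v using theta_induction with
  | h c => rw [iBU_smul_theta, piM_theta, psiD_tauB, piM_theta, map_smul]

lemma sum_piM_psiD {a : ℝ} (v : MM q a) : ∃ F : Finset ℤ, ∀ F' : Finset ℤ, F ⊆ F' →
    ∑ m ∈ F', piM q a (psiD q a m) v = v := by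
  induction v using theta_induction with
  | h c =>
    obtain ⟨F, hF⟩ := sum_psiD c
    refine ⟨F, fun F' h => ?_⟩
    nth_rewrite 2 [← hF F' h]
    rw [map_sum]
    exact Finset.sum_congr rfl fun m _ => piM_theta _ _

lemma piM_psiD_of_eigen {a : ℝ} {j : ℤ} {v : MM q a}
    (hv : iBU q a • v = (qn q (a + j) : ℂ) • v) (m : ℤ) :
    piM q a (psiD q a m) v = if m = j then v else 0 := by
  refine projection_eigenvector (lam := fun m : ℤ => (qn q (a + m) : ℂ)) (qn_int_injective a)
    (P := fun m => piM q a (psiD q a m)) (T := Module.toModuleEnd ℂ (MM q a) (iBU q a))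
    piM_psiD_iBU sum_piM_psiD hv m

lemma correspondsTo_piM (q : QParam) (a : ℝ) : CorrespondsTo (piM q a) := by
  refine ⟨piM_bD, fun y hy v => piM_iBt_mul hy v, ?_⟩
  refine eq_top_iff.2 fun v _ => ?_
  obtain ⟨F, hF⟩ := sum_piM_psiD v
  rw [← hF F subset_rfl]
  exact Submodule.sum_mem _ fun m _ => Submodule.subset_span ⟨psi q a m, psi_mem_Ic a m, v, rfl⟩

lemma counit_c0 (a : ℝ) : counit (R := ℂ) (c0 q a : OqSU2 q) = 0 := by
  have hq := qc_ne q
  have hr := qpow_ne q a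
  have hrow (z : ℂ) : counit (R := ℂ) (row q z 0) = 1 ∧
      counit (R := ℂ) (row q z 1) = Complex.I * z := by
    constructor <;> simp [row, uMat, counit_x, counitGen]
  have hlin (W z : ℂ) : counit (R := ℂ) (lin q W z) = 1 - W * z := by
    rw [lin, map_add, map_smul, (hrow z).1, (hrow z).2, smul_eq_mul]
    linear_combination W * z * Complex.I_sq
  have h1 : counit (R := ℂ) (At q a (qpow q a) : OqSU2 q) =
      counit (R := ℂ) (lin q (-(qc q ^ 2 * qpow q a)) (qpow q a) *
        lin q (qc q / qpow q a) (-(qc q * qpow q a)⁻¹)) := rfl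
  rw [c0_eq, Subalgebra.coe_sub, Subalgebra.coe_smul, Subalgebra.coe_algebraMap, map_sub, map_smul,
    h1, Bialgebra.counit_mul, hlin, hlin, Bialgebra.counit_algebraMap, alf, br, s1, smul_eq_mul]
  field_simp
  ring

lemma exists_pM (q : QParam) (a : ℝ) : ∃ p : MM q a →ₗ[ℂ] ℂ,
    ∀ b : podles q a, p (theta q a b) = counit (R := ℂ) (b : OqSU2 q) := by
  refine exists_lift_of_surjective _ (theta_surjective a)
    (counit (R := ℂ) ∘ₗ (podles q a).val.toLinearMap) fun b hb => ?_
  obtain ⟨b', rfl⟩ := theta_eq_zero.1 hb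
  change counit (R := ℂ) ((b' : OqSU2 q) * c0 q a) = 0
  rw [Bialgebra.counit_mul, counit_c0, mul_zero]

/-- The quotient map `p` from `M_{q+q⁻¹,a}` to the counit representation. -/
def pM (q : QParam) (a : ℝ) : MM q a →ₗ[ℂ] ℂ := (exists_pM q a).choose

lemma pM_theta {a : ℝ} (b : podles q a) :
    pM q a (theta q a b) = counit (R := ℂ) (b : OqSU2 q) := (exists_pM q a).choose_spec b

lemma pM_ea (a : ℝ) : pM q a (ea q a) = 1 := by
  rw [← theta_one, pM_theta]; exact Bialgebra.counit_one

lemma pM_piM {a : ℝ} (z : DCoid q a) (v : MM q a) : pM q a (piM q a z v) = epsD z * pM q a v := by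
  induction v using theta_induction with
  | h b => rw [piM_theta, pM_theta, pM_theta, actD_coe, counit_act z.2 b.2]; rfl

lemma pM_bU {a : ℝ} (b : podles q a) (v : MM q a) :
    pM q a (bU b • v) = counit (R := ℂ) (b : OqSU2 q) * pM q a v := by
  induction v using theta_induction with
  | h c =>
    rw [theta_apply, ← mul_smul, ← map_mul, ← theta_apply, ← theta_apply, pM_theta, pM_theta]
    exact Bialgebra.counit_mul _ _

lemma counit_tauB {a : ℝ} (b : podles q a) : counit (R := ℂ) (tauB q a b : OqSU2 q) =
    (qn q a : ℂ) * counit (R := ℂ) (b : OqSU2 q) := by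
  have h : counit (R := ℂ) (tauB q a b : OqSU2 q) = _ := counit_ract (dualSinv (iBt q a)) b
  rw [h, dualSinv_apply, apply_Sinv_stab (iBt_mem_stabDual a) b.2, iBt, dual_smul_apply, Bt_one,
    kap_eq, mul_neg, ← mul_assoc, Complex.I_mul_I]
  ring

lemma pM_iBU {a : ℝ} (v : MM q a) : pM q a (iBU q a • v) = (qn q a : ℂ) * pM q a v := by
  induction v using theta_induction with
  | h c => rw [iBU_smul_theta, pM_theta, pM_theta, counit_tauB]

lemma pM_smul_eq_zero {a : ℝ} (x : UqSL q a) {v : MM q a} (hv : pM q a v = 0) :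
    pM q a (x • v) = 0 := by
  induction x using UqSL_induction generalizing v with
  | hb b => rw [pM_bU, hv, mul_zero]
  | hB => rw [pM_iBU, hv, mul_zero]
  | hc r => rw [algebraMap_smul_UqSL, map_smul, hv, smul_zero]
  | hadd x y hx hy => rw [add_smul, map_add, hx hv, hy hv, add_zero]
  | hmul x y hx hy => rw [mul_smul]; exact hx (hy hv)

/-! ### The vectors `T_a^± e_a` do not vanish -/

/-- The derivation of `O_q(SU(2))` at the counit along the diagonal torus. -/
lemma exists_torus_derivation (q : QParam) : ∃ δ : OqSU2 q →ₗ[ℂ] ℂ,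
    (∀ x y, δ (x * y) = δ x * counit (R := ℂ) y + counit (R := ℂ) x * δ y) ∧ δ 1 = 0 ∧
    ∀ W z, δ (lin q W z) = 1 + W * z ∧ counit (R := ℂ) (lin q W z) = 1 - W * z := by
  set g : Gen → DualNumber ℂ := fun i => match i with
    | .al => 1 + DualNumber.eps
    | .als => 1 - DualNumber.eps
    | .ga => 0
    | .gas => 0 with hg
  have he : (DualNumber.eps : DualNumber ℂ) * DualNumber.eps = 0 := DualNumber.eps_mul_eps
  set D : OqSU2 q →ₐ[ℂ] DualNumber ℂ := OqSU2.lift g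
    (by simp only [hg, mul_zero]; linear_combination -he)
    (by simp only [hg, mul_zero, smul_zero]; linear_combination -he)
    (by simp [hg]) (by simp [hg]) (by simp [hg]) (by simp [hg]) (by simp [hg]) with hD
  have hD1 : (TrivSqZeroExt.fstHom ℂ ℂ ℂ).comp D = Bialgebra.counitAlgHom ℂ (OqSU2 q) := by
    refine algHom_ext fun i => ?_
    have : D (x q i) = g i := lift_x _ _ _ _ _ _ _ _ i
    rw [AlgHom.comp_apply, this]
    refine Eq.trans ?_ (counit_x i).symm
    cases i <;> simp [hg, counitGen]
  have hfst (y : OqSU2 q) : (D y).fst = counit (R := ℂ) y := DFunLike.congr_fun hD1 y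
  refine ⟨TrivSqZeroExt.sndHom ℂ ℂ ∘ₗ D.toLinearMap, fun y z => ?_, ?_, fun W z => ?_⟩
  · change (D (y * z)).snd = (D y).snd * _ + _ * (D z).snd
    rw [map_mul, TrivSqZeroExt.snd_mul, hfst, hfst, smul_eq_mul, MulOpposite.smul_eq_mul_unop,
      MulOpposite.unop_op]
    ring
  · change (D 1).snd = 0
    rw [map_one, TrivSqZeroExt.snd_one]
  · have hx (i : Gen) : D (x q i) = g i := lift_x _ _ _ _ _ _ _ _ i
    have h : D (lin q W z) = TrivSqZeroExt.inl (1 - W * z) + (1 + W * z) • DualNumber.eps := by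
      simp only [lin, row, uMat, Matrix.cons_val_zero, Matrix.cons_val_one,
        Matrix.cons_val_fin_one, map_add, map_smul, map_neg, hx, hg, smul_zero, neg_zero, add_zero,
        zero_add, smul_smul]
      rw [show Complex.I * W * (Complex.I * z) = -(W * z) by
        linear_combination W * z * Complex.I_sq]
      ext <;> simp <;> ring
    constructor
    · change (D (lin q W z)).snd = _
      rw [h]; simp
    · rw [← hfst, h]; simp

lemma Tm_mul_Tp_self (a : ℝ) : Tm q a (qc q ^ 2 * qpow q a) * Tp q a (qpow q a) =
    qc q • (At q a (qpow q a) * c0 q a) := by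
  have hq := qc_ne q
  have hr := qpow_ne q a
  rw [Tm_mul_Tp a hr, c0_eq, mul_sub, smul_sub, mul_smul_comm, smul_smul, mul_inv_cancel₀ hq,
    one_smul, ← Algebra.commutes, ← Algebra.smul_def, smul_smul]
  congr 2
  rw [sa, alf, br, s1]
  field_simp
  ring

lemma Tp_mul_Tm_self (a : ℝ) : Tp q a (qpow q a / qc q ^ 2) * Tm q a (qpow q a) =
    (qc q • c0 q a) * (qc q • c0 q a +
      algebraMap ℂ _ ((qpow q a + qc q ^ 2 * (qpow q a)⁻¹) * sa q a)) := by
  have hq := qc_ne q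
  have hr := qpow_ne q a
  have h : qc q • c0 q a =
      At q a (qpow q a) - algebraMap ℂ _ (qc q * (qpow q a + (qpow q a)⁻¹) * sa1 q a) := by
    rw [c0_eq, smul_sub, smul_smul, mul_inv_cancel₀ hq, one_smul, Algebra.algebraMap_eq_smul_one,
      smul_smul, Algebra.algebraMap_eq_smul_one]
    congr 2
    rw [sa1, alf, br, s1]
    field_simp
    ring
  rw [h, Tp_mul_Tm a hr]

/-- If `T_a^±` were a multiple `b (A_a - (q + q⁻¹))`, then applying the torus derivation to the
eigenvector equation would give `ε(b) = 0`, and applying it to `T_{a±2}^∓ T_a^±` would give a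
contradiction. -/
lemma theta_Tp_Tm_ne_zero (a : ℝ) : theta q a (Tp q a (qpow q a)) ≠ 0 ∧
    theta q a (Tm q a (qpow q a)) ≠ 0 := by
  have hq := qc_ne q
  have hr := qpow_ne q a
  have hq2 : 1 - qc q ^ 2 ≠ 0 := by
    intro h; apply q_sub_ne (q := q); field_simp; linear_combination -h
  obtain ⟨δ, hδ, hδ1, hlin⟩ := exists_torus_derivation q
  have hC (r : ℂ) : δ (algebraMap ℂ _ r) = 0 := by
    rw [Algebra.algebraMap_eq_smul_one, map_smul, hδ1, smul_zero]
  have hAt : (At q a (qpow q a) : OqSU2 q) = lin q (-(qc q ^ 2 * qpow q a)) (qpow q a) *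
        lin q (qc q / qpow q a) (-(qc q * qpow q a)⁻¹) := rfl
  have hδ0 : δ (c0 q a : OqSU2 q) ≠ 0 := by
    have : δ (c0 q a : OqSU2 q) = (qc q)⁻¹ * (2 * (1 - qc q ^ 2)) := by
      rw [c0_eq, Subalgebra.coe_sub, Subalgebra.coe_smul, Subalgebra.coe_algebraMap, map_sub, hC,
        map_smul, hAt, hδ, (hlin _ _).1, (hlin _ _).1, (hlin _ _).2, (hlin _ _).2, smul_eq_mul]
      field_simp
      ring
    rw [this]
    exact mul_ne_zero (inv_ne_zero hq) (mul_ne_zero two_ne_zero hq2)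
  have hmul (b : podles q a) : δ ((b * c0 q a : podles q a) : OqSU2 q) =
      counit (R := ℂ) (b : OqSU2 q) * δ (c0 q a) := by
    rw [Subalgebra.coe_mul, hδ, counit_c0, mul_zero, zero_add]
  -- an eigenvector `b * c0` of `i B_t` for an eigenvalue other than `[a]` has `ε(b) = 0`
  have heig (b : podles q a) (c : ℝ) (hc : c ≠ a)
      (h : tauB q a (b * c0 q a) = (qn q c : ℂ) • (b * c0 q a)) :
      counit (R := ℂ) (b : OqSU2 q) = 0 := by
    rw [tauB_mul_c0] at h
    have h1 := congrArg (fun x : podles q a => δ (x : OqSU2 q)) h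
    simp only [hmul, counit_tauB, Subalgebra.coe_smul, map_smul, smul_eq_mul] at h1
    have h2 : ((qn q a : ℂ) - qn q c) * (counit (R := ℂ) (b : OqSU2 q) * δ (c0 q a)) = 0 := by
      linear_combination h1
    rcases mul_eq_zero.1 h2 with h3 | h3
    · exact absurd (qn_strictMono.injective (Complex.ofReal_injective (sub_eq_zero.1 h3))).symm hc
    · exact (mul_eq_zero.1 h3).resolve_right hδ0
  constructor
  · intro h
    obtain ⟨b, hb⟩ := theta_eq_zero.1 h
    have h0 : counit (R := ℂ) (b : OqSU2 q) = 0 := by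
      refine heig b (a + 2) (by linarith) ?_
      rw [← hb]
      ext1
      rw [tauB_eq, wop_Tp a hr, smul_smul, qn_eq_mu, qpow_add_two]
      rfl
    have h1 := Tm_mul_Tp_self (q := q) a
    rw [hb, ← mul_assoc] at h1
    have h3 := congrArg (fun x : podles q a => δ (x : OqSU2 q)) h1
    beta_reduce at h3
    rw [hmul, Subalgebra.coe_smul, map_smul, hmul, Subalgebra.coe_mul, Bialgebra.counit_mul, h0,
      mul_zero, zero_mul] at h3
    have h2 : counit (R := ℂ) (At q a (qpow q a) : OqSU2 q) ≠ 0 := by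
      have e : counit (R := ℂ) (At q a (qpow q a) : OqSU2 q) =
          (qpow q (a + 1) ^ 2 + 1) * (qpow q a ^ 2 + 1) / qpow q a ^ 2 := by
        rw [hAt, Bialgebra.counit_mul, (hlin _ _).2, (hlin _ _).2, qpow_add_one]
        field_simp
        ring
      rw [e]
      exact div_ne_zero (mul_ne_zero (qpow_sq_add_one_ne _) (qpow_sq_add_one_ne _)) (pow_ne_zero _ hr)
    exact mul_ne_zero hq (mul_ne_zero h2 hδ0) h3.symm
  · intro h
    obtain ⟨b, hb⟩ := theta_eq_zero.1 h
    have h0 : counit (R := ℂ) (b : OqSU2 q) = 0 := by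
      refine heig b (a - 2) (by linarith) ?_
      rw [← hb]
      ext1
      rw [tauB_eq, wop_Tm a hr, smul_smul, qn_eq_mu, qpow_sub_two]
      rfl
    have h1 := Tp_mul_Tm_self (q := q) a
    rw [hb, ← mul_assoc] at h1
    have h3 := congrArg (fun x : podles q a => δ (x : OqSU2 q)) h1
    beta_reduce at h3
    rw [hmul, Subalgebra.coe_mul, Bialgebra.counit_mul, h0, mul_zero, zero_mul, Subalgebra.coe_mul,
      Subalgebra.coe_add, Subalgebra.coe_smul, Subalgebra.coe_algebraMap, hδ, map_add,
      map_smul, map_smul, counit_c0, Bialgebra.counit_algebraMap] at h3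
    simp only [smul_zero, mul_zero, zero_mul, zero_add, add_zero, smul_eq_mul] at h3
    refine mul_ne_zero (mul_ne_zero hq hδ0) (mul_ne_zero ?_ (qpow_add_inv_ne a)) h3.symm
    have e : qpow q a + qc q ^ 2 * (qpow q a)⁻¹ =
        qc q * (qpow q (a - 1) + (qpow q (a - 1))⁻¹) := by
      rw [qpow_sub_one]; field_simp
    rw [e]
    exact mul_ne_zero hq (qpow_add_inv_ne _)

/-! ### The weight basis of `M_{q+q⁻¹,a}` -/

lemma isTorsionFree_complex (V : Type*) [AddCommGroup V] [Module ℂ V] :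
    Module.IsTorsionFree ℂ V := inferInstance

instance (a lam b : ℝ) : Module.IsTorsionFree ℂ (Mmod q a lam b) := isTorsionFree_complex _

/-- The string through `e_a` in `M_{q+q⁻¹,a}`. -/
def fM (q : QParam) (a : ℝ) : ℤ → MM q a := str q a a (ea q a)

lemma isString_fM (a : ℝ) :
    IsString (q := q) (a := a) a (strP q a a) (strM q a a) (fM q a) :=
  isString_str (isBasic_cyc a a)

lemma fM_zero (a : ℝ) : fM q a 0 = ea q a := rfl

lemma iBU_fM (a : ℝ) (n : ℤ) :
    iBU q a • fM q a n = (qn q (a + (2 * n : ℤ)) : ℂ) • fM q a n := by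
  rw [((isString_fM a) n).1.1]
  push_cast
  rfl

/-- The real number `q² ({1} + {2a + 2n + 1}) ({1} - {2n + 1})`, by which `T^- T^+` acts on the
`n`-th vector of the string through `e_a`. -/
def tr (q : QParam) (a : ℝ) (n : ℤ) : ℝ :=
  (q : ℝ) ^ 2 * ((qs q 1 + qs q (2 * a + 2 * n + 1)) * (qs q 1 - qs q (2 * n + 1)))

lemma ta_eq_tr (a : ℝ) (n : ℤ) : ta q a (qpow q (a + 2 * n)) = (tr q a n : ℂ) := by
  have hr := qpow_ne q a
  have h1 : (qs q 1 : ℂ) = s1 q := by rw [qs_eq, qpow_one, s1]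
  have h2 : (qs q (2 * a + 2 * n + 1) : ℂ) = br (qc q * qpow q a * qpow q (a + 2 * n)) := by
    rw [qs_eq, br, mul_assoc, ← qpow_add, ← qpow_add_one]; congr 3 <;> ring
  have h3 : (qs q (2 * n + 1) : ℂ) = br (qc q * qpow q (a + 2 * n) / qpow q a) := by
    have e : qc q * qpow q (a + 2 * n) / qpow q a = qpow q (2 * n + 1) := by
      rw [qpow_add_one, qpow_add]; field_simp
    rw [e, br, qs_eq]
  rw [ta, tr]
  push_cast
  rw [h1, h2, h3, qc]

lemma qs_pos (c : ℝ) : 0 < qs q c := add_pos (qpow_pos c) (qpow_pos (-c))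

lemma qs_neg (c : ℝ) : qs q (-c) = qs q c := by rw [qs, qs, neg_neg, add_comm]

lemma qs_one_lt {c : ℝ} (hc : 1 < c) : qs q 1 < qs q c := by
  have h0 := q.2.1
  have h1 := q.2.2
  have e : qs q c - qs q 1 = ((q : ℝ) - (q : ℝ) ^ c) * (((q : ℝ) * (q : ℝ) ^ c)⁻¹ - 1) := by
    have hc := qpow_pos (q := q) c
    rw [qs, qs, Real.rpow_neg h0.le, Real.rpow_neg h0.le, Real.rpow_one]
    field_simp
    ring
  have h2 : (q : ℝ) ^ c < q := by
    simpa using Real.rpow_lt_rpow_of_exponent_gt h0 h1 hc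
  have hc' := qpow_pos (q := q) c
  have h3 : 1 < ((q : ℝ) * (q : ℝ) ^ c)⁻¹ := by
    refine (one_lt_inv₀ (mul_pos h0 hc')).2 ?_
    nlinarith
  have : 0 < qs q c - qs q 1 := by
    rw [e]; exact mul_pos (by linarith) (by linarith)
  linarith

lemma tr_neg (a : ℝ) {n : ℤ} (h0 : n ≠ 0) (h1 : n ≠ -1) : tr q a n < 0 := by
  have h2 : qs q 1 < qs q (2 * n + 1) := by
    rcases lt_or_ge n 0 with h | h
    · rw [← qs_neg (2 * (n : ℝ) + 1)]
      refine qs_one_lt ?_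
      have : (n : ℝ) ≤ -2 := by exact_mod_cast (by omega : n ≤ -2)
      linarith
    · refine qs_one_lt ?_
      have : (1 : ℝ) ≤ n := by exact_mod_cast (by omega : 1 ≤ n)
      linarith
  have h3 := qs_pos (q := q) 1
  have h4 := qs_pos (q := q) (2 * a + 2 * n + 1)
  exact mul_neg_of_pos_of_neg (pow_pos q.2.1 2)
    (mul_neg_of_pos_of_neg (by linarith) (by linarith))

/-- The vector `f_1` generates a proper submodule, as `T^-` kills it. -/
lemma tr_zero (a : ℝ) : tr q a 0 = 0 := by simp [tr]

/-- The vector `f_{-1}` generates a proper submodule, as `T^+` kills it. -/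
lemma tr_neg_one (a : ℝ) : tr q a (-1) = 0 := by
  rw [tr]
  have : (2 : ℝ) * ((-1 : ℤ) : ℝ) + 1 = -1 := by push_cast; norm_num
  rw [this, qs_neg, sub_self, mul_zero, mul_zero]

lemma strP_eq (a : ℝ) (n : ℤ) : strP q a a n = if 0 ≤ n then 1 else (tr q a n : ℂ) := by
  rw [strP, ta_eq_tr]

lemma strM_eq (a : ℝ) (n : ℤ) : strM q a a n = if n ≤ 0 then 1 else (tr q a (n - 1) : ℂ) := by
  rw [strM, ta_eq_tr]

lemma fM_one (a : ℝ) : fM q a 1 = bU (Tp q a (qpow q a)) • ea q a := by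
  have h := str_add_one (q := q) (a := a) (c := a) (ea q a) (n := 0) le_rfl
  rw [zero_add, Int.cast_zero, mul_zero, add_zero, str_zero] at h
  exact h

lemma fM_neg_one (a : ℝ) : fM q a (-1) = bU (Tm q a (qpow q a)) • ea q a := by
  have h := str_sub_one (q := q) (a := a) (c := a) (ea q a) (n := 0) le_rfl
  rw [zero_sub, Int.cast_zero, mul_zero, add_zero, str_zero] at h
  exact h

/-- No vector of the string vanishes: `T_a^± e_a ≠ 0`, and further out `T^∓ T^±` is multiplication by
a nonzero number. -/
lemma fM_ne_zero (a : ℝ) (n : ℤ) : fM q a n ≠ 0 := by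
  have hup (k : ℕ) : fM q a (k + 1) ≠ 0 := by
    induction k with
    | zero =>
      rw [Nat.cast_zero, zero_add, fM_one]
      exact (theta_Tp_Tm_ne_zero a).1
    | succ k ih =>
      intro h
      have h1 := ((isString_fM (q := q) a) ((k + 1 : ℕ) + 1)).2.2
      rw [h, smul_zero, add_sub_cancel_right, strM_eq, if_neg (by omega), add_sub_cancel_right] at h1
      rcases smul_eq_zero.1 h1.symm with h2 | h2
      · exact (tr_neg (q := q) a (n := ((k + 1 : ℕ) : ℤ)) (by omega) (by omega)).ne
          (by exact_mod_cast h2)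
      · exact ih (by exact_mod_cast h2)
  have hdn (k : ℕ) : fM q a (-(k + 1)) ≠ 0 := by
    induction k with
    | zero =>
      rw [Nat.cast_zero, zero_add, fM_neg_one]
      exact (theta_Tp_Tm_ne_zero a).2
    | succ k ih =>
      intro h
      have h1 := ((isString_fM (q := q) a) (-((k + 1 : ℕ) + 1))).2.1
      rw [h, smul_zero, strP_eq, if_neg (by omega)] at h1
      rcases smul_eq_zero.1 h1.symm with h2 | h2
      · exact (tr_neg (q := q) a (n := -(((k + 1 : ℕ) : ℤ) + 1)) (by omega) (by omega)).ne
          (by exact_mod_cast h2)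
      · refine ih ?_
        rw [← h2]
        congr 1
  rcases lt_trichotomy n 0 with h | h | h
  · obtain ⟨k, rfl⟩ : ∃ k : ℕ, n = -(k + 1) := ⟨(-n - 1).toNat, by omega⟩
    exact hdn k
  · subst h
    intro h
    have := pM_ea (q := q) a
    rw [← fM_zero, h, map_zero] at this
    exact zero_ne_one this
  · obtain ⟨k, rfl⟩ : ∃ k : ℕ, n = k + 1 := ⟨(n - 1).toNat, by omega⟩
    exact hup k

lemma linearIndependent_fM (a : ℝ) : LinearIndependent ℂ (fM q a) := by
  refine Module.End.eigenvectors_linearIndependent' (Module.toModuleEnd ℂ (MM q a) (iBU q a))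
    (fun n : ℤ => (qn q (a + (2 * n : ℤ)) : ℂ)) ?_ (fM q a) fun n => ?_
  · intro n m h
    have := qn_int_injective (q := q) a h
    simpa using this
  · exact ⟨Module.End.mem_eigenspace_iff.2 (iBU_fM a n), fM_ne_zero a n⟩

lemma span_str_cyc (a c : ℝ) : Submodule.span ℂ
    (Set.range (str q a c (Mmod.cyc q a (lam0 q) c))) = ⊤ := by
  refine eq_top_iff.2 fun v _ => ?_
  obtain ⟨x, rfl⟩ := Submodule.Quotient.mk_surjective _ v
  have h := (isString_str (isBasic_cyc (q := q) a c)).smul_mem_span x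
    (Submodule.subset_span ⟨0, rfl⟩)
  rwa [str_zero, Mmod.cyc, ← Submodule.Quotient.mk_smul, smul_eq_mul, mul_one] at h

/-- The weight basis of `M_{q+q⁻¹,a}`. -/
def basisM (q : QParam) (a : ℝ) : Module.Basis ℤ ℂ (MM q a) :=
  Module.Basis.mk (linearIndependent_fM a) (span_str_cyc a a).ge

lemma basisM_apply (a : ℝ) (n : ℤ) : basisM q a n = fM q a n := Module.Basis.mk_apply _ _ n

lemma repr_fM (a : ℝ) (n : ℤ) : (basisM q a).repr (fM q a n) = Finsupp.single n 1 := by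
  rw [← basisM_apply, Module.Basis.repr_self]

lemma fM_induction {a : ℝ} {P : MM q a → Prop} (h : ∀ n, P (fM q a n)) (h0 : P 0)
    (hadd : ∀ v w, P v → P w → P (v + w)) (hsmul : ∀ (r : ℂ) v, P v → P (r • v)) (v : MM q a) :
    P v := by
  have hv : v ∈ Submodule.span ℂ (Set.range (fM q a)) := by
    rw [fM, ea, span_str_cyc]; trivial
  induction hv using Submodule.span_induction with
  | mem v hv => obtain ⟨n, rfl⟩ := hv; exact h n
  | zero => exact h0
  | add v w _ _ hv hw => exact hadd v w hv hw
  | smul r v _ hv => exact hsmul r v hv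

/-- The map `p` intertwines `i B_t` with the scalar `[a]`, so it vanishes on the other weights. -/
lemma pM_fM (a : ℝ) (n : ℤ) : pM q a (fM q a n) = if n = 0 then 1 else 0 := by
  split_ifs with h
  · subst h; rw [fM_zero, pM_ea]
  · have h1 := pM_iBU (fM q a n)
    rw [iBU_fM, map_smul, smul_eq_mul, ← sub_eq_zero, ← sub_mul] at h1
    refine (mul_eq_zero.1 h1).resolve_left fun h2 => h ?_
    have h3 : (qn q (a + (2 * n : ℤ)) : ℂ) = (qn q (a + (0 : ℤ)) : ℂ) := by
      rw [sub_eq_zero.1 h2]; simp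
    have := qn_int_injective (q := q) a h3
    omega

lemma pM_eq_repr {a : ℝ} (v : MM q a) : pM q a v = (basisM q a).repr v 0 := by
  induction v using fM_induction with
  | h n => rw [pM_fM, repr_fM, Finsupp.single_apply]
  | h0 => simp
  | hadd v w hv hw => simp [hv, hw]
  | hsmul r v hv => simp [hv]

lemma ker_pM_induction {a : ℝ} {P : MM q a → Prop} (h : ∀ n, n ≠ 0 → P (fM q a n)) (h0 : P 0)
    (hadd : ∀ v w, P v → P w → P (v + w)) (hsmul : ∀ (r : ℂ) v, P v → P (r • v)) {v : MM q a}
    (hv : pM q a v = 0) : P v := by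
  rw [← (basisM q a).linearCombination_repr v, Finsupp.linearCombination_apply]
  refine Finset.sum_induction _ P hadd h0 fun n hn => hsmul _ _ ?_
  rw [basisM_apply]
  refine h n fun h => ?_
  subst h
  rw [pM_eq_repr] at hv
  exact Finsupp.mem_support_iff.1 hn hv

/-! ### The invariant inner product on the kernel of `p` -/

/-- The squared norms of the vectors of the string through `e_a`, determined recursively away from
`e_a` by the requirement that the generators of `O_q(S_t²)` act by a `*`-representation. The values
at `1` and `-1` may be chosen freely and fix the norms of `e_{a+2}` and `e_{a-2}`; the value at `0`
is irrelevant, as the form is only used on the kernel of `p`. -/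
def wgt (q : QParam) (a : ℝ) : ℤ → ℝ
  | Int.ofNat 0 => 0
  | Int.ofNat (n + 1) => n.rec (((q : ℝ) ^ a)⁻¹ ^ 2) fun k w =>
      -(tr q a (k + 1 : ℤ) * qs q (a + 2 * (k + 1 : ℤ))) /
        ((q : ℝ) ^ 2 * ((q : ℝ) ^ (a + 2 * (k + 1 : ℤ))) ^ 2 * qs q (a + 2 * (k + 1 : ℤ) + 2)) * w
  | Int.negSucc n => n.rec (((q : ℝ) ^ a) ^ 2 *
        (qs q (a + 2) * qs q (a - 1) / (qs q (a - 2) * qs q (a + 1)))) fun k w =>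
      -(tr q a (Int.negSucc (k + 1)) * ((q : ℝ) ^ 2 *
        ((q : ℝ) ^ (a + 2 * (Int.negSucc (k + 1) : ℤ))) ^ 2 *
          qs q (a + 2 * (Int.negSucc (k + 1) : ℤ) + 2))) / qs q (a + 2 * (Int.negSucc (k + 1) : ℤ)) * w

lemma wgt_one (a : ℝ) : wgt q a 1 = ((q : ℝ) ^ a)⁻¹ ^ 2 := rfl

lemma wgt_neg_one (a : ℝ) : wgt q a (-1) = ((q : ℝ) ^ a) ^ 2 *
    (qs q (a + 2) * qs q (a - 1) / (qs q (a - 2) * qs q (a + 1))) := rfl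

lemma wgt_succ (a : ℝ) {n : ℤ} (hn : 1 ≤ n) : wgt q a (n + 1) =
    -(tr q a n * qs q (a + 2 * n)) /
      ((q : ℝ) ^ 2 * ((q : ℝ) ^ (a + 2 * n)) ^ 2 * qs q (a + 2 * n + 2)) * wgt q a n := by
  obtain ⟨k, rfl⟩ : ∃ k : ℕ, n = k + 1 := ⟨(n - 1).toNat, by omega⟩
  rfl

lemma wgt_pred (a : ℝ) {n : ℤ} (hn : n ≤ -2) : wgt q a n =
    -(tr q a n * ((q : ℝ) ^ 2 * ((q : ℝ) ^ (a + 2 * n)) ^ 2 * qs q (a + 2 * n + 2))) /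
      qs q (a + 2 * n) * wgt q a (n + 1) := by
  obtain ⟨k, rfl⟩ : ∃ k : ℕ, n = Int.negSucc (k + 1) := ⟨(-n - 2).toNat, by omega⟩
  rfl

lemma wgt_pos (a : ℝ) {n : ℤ} (hn : n ≠ 0) : 0 < wgt q a n := by
  have hq := q.2.1
  have h1 (c : ℝ) := qs_pos (q := q) c
  have h2 (c : ℝ) := qpow_pos (q := q) c
  have hup (k : ℕ) : 0 < wgt q a (k + 1) := by
    induction k with
    | zero => exact pow_pos (inv_pos.2 (h2 a)) 2
    | succ k ih =>
      have ht := tr_neg (q := q) a (n := (k + 1 : ℕ)) (by omega) (by omega)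
      rw [wgt_succ a (by omega)]
      refine mul_pos (div_pos ?_ ?_) (by exact_mod_cast ih)
      · exact neg_pos.2 (mul_neg_of_neg_of_pos ht (h1 _))
      · exact mul_pos (mul_pos (pow_pos hq 2) (pow_pos (h2 _) 2)) (h1 _)
  have hdn (k : ℕ) : 0 < wgt q a (-(k + 1)) := by
    induction k with
    | zero => exact mul_pos (pow_pos (h2 a) 2) (div_pos (mul_pos (h1 _) (h1 _))
        (mul_pos (h1 _) (h1 _)))
    | succ k ih =>
      have ht := tr_neg (q := q) a (n := -((k + 1 : ℕ) + 1)) (by omega) (by omega)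
      rw [wgt_pred a (by omega)]
      refine mul_pos (div_pos ?_ (h1 _)) ?_
      · exact neg_pos.2 (mul_neg_of_neg_of_pos ht
          (mul_pos (mul_pos (pow_pos hq 2) (pow_pos (h2 _) 2)) (h1 _)))
      · rwa [show (-(((k + 1 : ℕ) : ℤ) + 1) + 1) = -((k : ℤ) + 1) by push_cast; ring]
  rcases lt_or_gt_of_ne hn with h | h
  · obtain ⟨k, rfl⟩ : ∃ k : ℕ, n = -(k + 1) := ⟨(-n - 1).toNat, by omega⟩
    exact hdn k
  · obtain ⟨k, rfl⟩ : ∃ k : ℕ, n = k + 1 := ⟨(n - 1).toNat, by omega⟩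
    exact hup k

/-- The recursion for the squared norms, in the form that makes `T^+` and `T^-` adjoint up to
scalars along the string. -/
lemma wgt_rel (a : ℝ) {n : ℤ} (h0 : n ≠ 0) (h1 : n ≠ -1) :
    strP q a a n * (wgt q a (n + 1) : ℂ) *
      (qc q ^ 2 * qpow q (a + 2 * n) ^ 2 * br (qc q ^ 2 * qpow q (a + 2 * n))) =
    -(strM q a a (n + 1) * (wgt q a n : ℂ) * br (qpow q (a + 2 * n))) := by
  have hb (c : ℝ) : br (qpow q c) = (qs q c : ℂ) := by rw [qs_eq, br]
  have hp (c : ℝ) : qpow q c = (((q : ℝ) ^ c : ℝ) : ℂ) := rfl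
  have hq := q.2.1
  have hs (c : ℝ) := (qs_pos (q := q) c).ne'
  have hc (c : ℝ) := (qpow_pos (q := q) c).ne'
  rw [← qpow_add_two, hb, hb, hp, qc, strP_eq, strM_eq, add_sub_cancel_right]
  rcases lt_or_gt_of_ne h0 with h | h
  · have h2 := wgt_pred (q := q) a (n := n) (by omega)
    rw [if_neg (by omega), if_pos (by omega), h2]
    generalize a + 2 * (n : ℝ) = c
    have h3 : (qs q c : ℂ) ≠ 0 := by exact_mod_cast hs c
    push_cast
    field_simp
  · have h2 := wgt_succ (q := q) a (n := n) (by omega)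
    rw [if_pos (by omega), if_neg (by omega), h2]
    generalize a + 2 * (n : ℝ) = c
    have h3 : (qs q (c + 2) : ℂ) ≠ 0 := by exact_mod_cast hs (c + 2)
    have h4 : (((q : ℝ) ^ c : ℝ) : ℂ) ≠ 0 := by exact_mod_cast hc c
    have h5 : ((q : ℝ) : ℂ) ≠ 0 := by exact_mod_cast hq.ne'
    push_cast
    field_simp

/-- The sesquilinear form on `M_{q+q⁻¹,a}` for which the weight basis is orthogonal, with the
squared norms `wgt`. -/
def sM (q : QParam) (a : ℝ) : MM q a →ₗ⋆[ℂ] MM q a →ₗ[ℂ] ℂ :=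
  LinearMap.mk₂'ₛₗ (starRingEnd ℂ) (RingHom.id ℂ)
    (fun v w => Finsupp.linearCombination ℂ
      (fun n => conj ((basisM q a).repr v n) * (wgt q a n : ℂ)) ((basisM q a).repr w))
    (fun v v' w => by
      simp only [Finsupp.linearCombination_apply, map_add, Finsupp.add_apply, add_mul, smul_add]
      exact Finsupp.sum_add)
    (fun r v w => by
      simp only [Finsupp.linearCombination_apply, map_smul, Finsupp.smul_apply, smul_eq_mul,
        map_mul, Finsupp.mul_sum]
      exact Finsupp.sum_congr fun n _ => by ring)
    (fun v w w' => by rw [map_add, map_add])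
    (fun r v w => by rw [map_smul, map_smul, RingHom.id_apply])

lemma sM_fM_right {a : ℝ} (v : MM q a) (m : ℤ) :
    sM q a v (fM q a m) = conj ((basisM q a).repr v m) * (wgt q a m : ℂ) := by
  rw [sM, LinearMap.mk₂'ₛₗ_apply, repr_fM, Finsupp.linearCombination_single, one_smul]

lemma sM_fM_fM (a : ℝ) (n m : ℤ) :
    sM q a (fM q a n) (fM q a m) = if n = m then (wgt q a m : ℂ) else 0 := by
  rw [sM_fM_right, repr_fM, Finsupp.single_apply]
  split_ifs <;> simp

lemma sM_smul_right {a : ℝ} (r : ℂ) (v w : MM q a) : sM q a v (r • w) = r * sM q a v w :=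
  (sM q a v).map_smul r w

lemma sM_smul_left {a : ℝ} (r : ℂ) (v w : MM q a) : sM q a (r • v) w = conj r * sM q a v w := by
  rw [LinearMap.map_smulₛₗ, LinearMap.smul_apply, smul_eq_mul]

lemma conj_sM {a : ℝ} (v w : MM q a) : conj (sM q a v w) = sM q a w v := by
  induction w using fM_induction with
  | h m =>
    rw [sM_fM_right, map_mul, Complex.conj_conj, Complex.conj_ofReal, sM, LinearMap.mk₂'ₛₗ_apply,
      Finsupp.linearCombination_apply, repr_fM]
    refine ((Finsupp.sum_of_support_subset _ (s := insert m ((basisM q a).repr v).support)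
      (Finset.subset_insert _ _) _ (by simp)).trans ?_).symm
    rw [Finset.sum_eq_single_of_mem m (Finset.mem_insert_self _ _)]
    · simp
    · intro n _ hn
      simp [hn.symm]
  | h0 => simp
  | hadd w w' hw hw' => rw [map_add, map_add, map_add, LinearMap.add_apply, hw, hw']
  | hsmul r w hw =>
    rw [sM_smul_right, sM_smul_left, map_mul, hw]

lemma sM_self_pos {a : ℝ} {v : MM q a} (hv : pM q a v = 0) (h : v ≠ 0) :
    0 < (sM q a v v).re := by
  rw [pM_eq_repr] at hv
  have hsum : (sM q a v v).re = ∑ n ∈ ((basisM q a).repr v).support,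
      Complex.normSq ((basisM q a).repr v n) * wgt q a n := by
    rw [sM, LinearMap.mk₂'ₛₗ_apply, Finsupp.linearCombination_apply, Finsupp.sum, Complex.re_sum]
    refine Finset.sum_congr rfl fun n _ => ?_
    rw [smul_eq_mul, ← mul_assoc, Complex.mul_conj, ← Complex.ofReal_mul, Complex.ofReal_re]
  rw [hsum]
  refine Finset.sum_pos (fun n hn => ?_) ?_
  · have hn' := Finsupp.mem_support_iff.1 hn
    refine mul_pos (Complex.normSq_pos.2 hn') (wgt_pos a fun h0 => hn' ?_)
    rw [h0, hv]
  · rw [Finsupp.support_nonempty_iff]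
    exact fun h0 => h ((LinearEquiv.map_eq_zero_iff _).1 h0)

/-- Adjointness of two tridiagonal operators with respect to the weight basis: it suffices to
compare neighbouring coefficients, away from `e_a`. -/
lemma sM_adjoint_of_coeff {a : ℝ} {b b' : podles q a} {α β γ α' β' γ' : ℤ → ℂ}
    (hb : ∀ n, bU b • fM q a n = α n • fM q a (n + 1) + β n • fM q a (n - 1) + γ n • fM q a n)
    (hb' : ∀ n, bU b' • fM q a n =
      α' n • fM q a (n + 1) + β' n • fM q a (n - 1) + γ' n • fM q a n)
    (h1 : ∀ n : ℤ, n ≠ 0 → n ≠ -1 → α n * (wgt q a (n + 1) : ℂ) = conj (β' (n + 1)) * wgt q a n)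
    (h2 : ∀ n : ℤ, n ≠ 0 → n ≠ -1 → β (n + 1) * (wgt q a n : ℂ) = conj (α' n) * wgt q a (n + 1))
    (h3 : ∀ n, γ n = conj (γ' n)) {n m : ℤ} (hn : n ≠ 0) (hm : m ≠ 0) :
    sM q a (fM q a n) (bU b • fM q a m) = sM q a (bU b' • fM q a n) (fM q a m) := by
  rw [hb, hb']
  simp only [map_add, map_smul, map_smulₛₗ, LinearMap.add_apply, LinearMap.smul_apply, sM_fM_fM,
    smul_eq_mul, mul_ite, mul_zero, RingHom.id_apply]
  by_cases e1 : n = m + 1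
  · subst e1
    have := h1 m hm (by omega)
    simp [show ¬ (m + 1 = m - 1) by omega, show ¬ (m + 1 + 1 = m) by omega, this]
  by_cases e2 : m = n + 1
  · subst e2
    have := h2 n hn (by omega)
    simp [show ¬ (n = n + 1 + 1) by omega, show ¬ (n - 1 = n + 1) by omega, this]
  by_cases e3 : n = m
  · subst e3
    simp only [show ¬ n = n + 1 by omega, show ¬ n = n - 1 by omega, show ¬ n + 1 = n by omega,
      show ¬ n - 1 = n by omega, if_false, if_true, h3]
  rw [if_neg e1, if_neg (by omega), if_neg e3, if_neg (by omega), if_neg (by omega), if_neg e3]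

lemma sM_adjoint_of_basis {a : ℝ} {T T' : Module.End ℂ (MM q a)}
    (h : ∀ n m : ℤ, n ≠ 0 → m ≠ 0 →
      sM q a (fM q a n) (T (fM q a m)) = sM q a (T' (fM q a n)) (fM q a m))
    {v w : MM q a} (hv : pM q a v = 0) (hw : pM q a w = 0) :
    sM q a v (T w) = sM q a (T' v) w := by
  refine ker_pM_induction (q := q) (a := a) (P := fun v : MM q a => sM q a v (T w) = sM q a (T' v) w)
    (fun n hn => ?_) (by simp) (fun v v' h h' => ?_) (fun r v h => ?_) hv
  · refine ker_pM_induction (q := q) (a := a)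
      (P := fun w : MM q a => sM q a (fM q a n) (T w) = sM q a (T' (fM q a n)) w)
      (fun m hm => h n m hn hm) (by simp) (fun w w' h h' => ?_) (fun r w h => ?_) hw
    · rw [map_add, map_add, map_add, h, h']
    · rw [T.map_smul, sM_smul_right, sM_smul_right, h]
  · rw [map_add, map_add, map_add, LinearMap.add_apply, LinearMap.add_apply, h, h']
  · rw [T'.map_smul, sM_smul_left, sM_smul_left, h]

lemma conj_br (c : ℝ) : conj (br (qpow q c)) = br (qpow q c) := by
  rw [br, map_add, map_inv₀, conj_qpow]

lemma conj_tr_ite (p : Prop) [Decidable p] (x : ℝ) :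
    conj (if p then 1 else (x : ℂ)) = if p then 1 else (x : ℂ) := by
  split_ifs <;> simp

lemma conj_strP (a : ℝ) (n : ℤ) : conj (strP q a a n) = strP q a a n := by
  rw [strP_eq, conj_tr_ite]

lemma conj_strM (a : ℝ) (n : ℤ) : conj (strM q a a n) = strM q a a n := by
  rw [strM_eq, conj_tr_ite]

lemma conj_alf_sub_atc (a c : ℝ) : conj (alf q a (qpow q c) - atc q a (qpow q c)) =
    alf q a (qpow q c) - atc q a (qpow q c) := by
  simp [alf, atc, br, sa1, sa, s1, conj_qpow]

/-- The generators of `O_q(S_t²)` act on the kernel of `p` by operators that are adjoint to one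
another in the prescribed way. -/
lemma sM_bU_of_combo {a : ℝ} {b b' : podles q a} {x y z x' y' : ℝ → ℂ}
    (hb : ∀ c, b = x c • Tp q a (qpow q c) + y c • Tm q a (qpow q c) +
      z c • (At q a (qpow q c) - algebraMap ℂ _ (atc q a (qpow q c))))
    (hb' : ∀ c, b' = x' c • Tp q a (qpow q c) + y' c • Tm q a (qpow q c) +
      z c • (At q a (qpow q c) - algebraMap ℂ _ (atc q a (qpow q c))))
    (hz : ∀ c, conj (z c) = z c) (hx' : ∀ c, conj (x' c) = x' c)
    (hy' : ∀ c, conj (y' c) = y' c)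
    (h1 : ∀ c, x c * br (qpow q c) =
      -(y' (c + 2) * (qc q ^ 2 * qpow q c ^ 2 * br (qc q ^ 2 * qpow q c))))
    (h2 : ∀ c, x' c * br (qpow q c) =
      -(y (c + 2) * (qc q ^ 2 * qpow q c ^ 2 * br (qc q ^ 2 * qpow q c))))
    {v w : MM q a} (hv : pM q a v = 0) (hw : pM q a w = 0) :
    sM q a v (bU b • w) = sM q a (bU b' • v) w := by
  have hne (n : ℤ) : qc q ^ 2 * qpow q (a + 2 * n) ^ 2 * br (qc q ^ 2 * qpow q (a + 2 * n)) ≠ 0 := by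
    rw [← qpow_add_two]
    exact mul_ne_zero (mul_ne_zero (pow_ne_zero 2 (qc_ne q)) (pow_ne_zero 2 (qpow_ne q _)))
      (br_ne _)
  have hs (n : ℤ) : a + 2 * ((n + 1 : ℤ) : ℝ) = a + 2 * n + 2 := by push_cast; ring
  have key {n m : ℤ} (hn : n ≠ 0) (hm : m ≠ 0) :
      sM q a (fM q a n) (bU b • fM q a m) = sM q a (bU b' • fM q a n) (fM q a m) := by
    have ha (n : ℤ) : bU b • fM q a n = (x (a + 2 * n) * strP q a a n) • fM q a (n + 1) +
        (y (a + 2 * n) * strM q a a n) • fM q a (n - 1) + (z (a + 2 * n) *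
          (alf q a (qpow q (a + 2 * n)) - atc q a (qpow q (a + 2 * n)))) • fM q a n := by
      rw [hb (a + 2 * n)]
      exact (isString_fM (q := q) a).combo n _ _ _
    have ha' (n : ℤ) : bU b' • fM q a n = (x' (a + 2 * n) * strP q a a n) • fM q a (n + 1) +
        (y' (a + 2 * n) * strM q a a n) • fM q a (n - 1) + (z (a + 2 * n) *
          (alf q a (qpow q (a + 2 * n)) - atc q a (qpow q (a + 2 * n)))) • fM q a n := by
      rw [hb' (a + 2 * n)]
      exact (isString_fM (q := q) a).combo n _ _ _
    refine sM_adjoint_of_coeff ha ha' (fun n h0 hn1 => ?_)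
      (fun n h0 hn1 => ?_) (fun n => ?_) hn hm
    · have h := wgt_rel (q := q) a h0 hn1
      rw [map_mul, hy', conj_strM, hs]
      refine mul_right_cancel₀ (mul_ne_zero (hne n) (br_ne (q := q) (a + 2 * n))) ?_
      linear_combination (strP q a a n * (wgt q a (n + 1) : ℂ)) * (qc q ^ 2 *
        qpow q (a + 2 * n) ^ 2 * br (qc q ^ 2 * qpow q (a + 2 * n))) * h1 (a + 2 * n) -
        y' (a + 2 * n + 2) * (qc q ^ 2 * qpow q (a + 2 * n) ^ 2 *
          br (qc q ^ 2 * qpow q (a + 2 * n))) * h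
    · have h := wgt_rel (q := q) a h0 hn1
      rw [map_mul, hx', conj_strP, hs]
      refine mul_right_cancel₀ (mul_ne_zero (hne n) (br_ne (q := q) (a + 2 * n))) ?_
      linear_combination -(strP q a a n * (wgt q a (n + 1) : ℂ)) * (qc q ^ 2 *
        qpow q (a + 2 * n) ^ 2 * br (qc q ^ 2 * qpow q (a + 2 * n))) * h2 (a + 2 * n) +
        y (a + 2 * n + 2) * (qc q ^ 2 * qpow q (a + 2 * n) ^ 2 *
          br (qc q ^ 2 * qpow q (a + 2 * n))) * h
    · rw [map_mul, hz, conj_alf_sub_atc]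
  exact sM_adjoint_of_basis (q := q) (T := Module.toModuleEnd ℂ (MM q a) (bU b))
    (T' := Module.toModuleEnd ℂ (MM q a) (bU b')) (fun n m hn hm => key hn hm) hv hw

lemma sM_bU {a : ℝ} (b : podles q a) {v w : MM q a} (hv : pM q a v = 0) (hw : pM q a w = 0) :
    sM q a v (bU b • w) = sM q a (bU (star b) • v) w := by
  have hq := qc_ne q
  have hcq (c : ℝ) := br_add_one_ne (q := q) c
  have hc2 (c : ℝ) : br (qc q ^ 2 * qpow q c) ≠ 0 := by rw [← qpow_add_two]; exact br_ne _
  have hconj1 (c : ℝ) : conj (br (qc q * qpow q c)) = br (qc q * qpow q c) := by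
    rw [← qpow_add_one, conj_br]
  have hconj2 (c : ℝ) : conj (br (qpow q c / qc q)) = br (qpow q c / qc q) := by
    rw [← qpow_sub_one, conj_br]
  have hsub (c : ℝ) : br (qpow q (c + 2) / qc q) = br (qc q * qpow q c) := by
    rw [qpow_add_two]; congr 1; field_simp
  induction b using podles_induction generalizing v w with
  | hX =>
    rw [star_PX]
    refine sM_bU_of_combo (PX_eq a) (PY_eq a) ?_ ?_ ?_ ?_ ?_ hv hw <;> intro c
    · simp [conj_qpow, conj_br, hconj1, hconj2, conj_s1]
    · simp [conj_qpow, conj_br, hconj1, hconj2, conj_s1]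
    · simp [conj_qpow, conj_br, hconj1, hconj2, conj_s1]
    · have h1 := hcq c
      have h2 := hc2 c
      have h3 := br_ne (q := q) c
      have h4 := qpow_ne q c
      rw [hsub, qpow_add_two]
      generalize br (qc q * qpow q c) = u at *
      generalize br (qc q ^ 2 * qpow q c) = u' at *
      field_simp
    · have h1 := hcq c
      have h2 := hc2 c
      have h3 := br_ne (q := q) c
      have h4 := qpow_ne q c
      rw [hsub, qpow_add_two]
      generalize br (qc q * qpow q c) = u at *
      generalize br (qc q ^ 2 * qpow q c) = u' at *
      field_simp
  | hY =>
    rw [show star (PY q a) = PX q a by rw [← star_PX, podles_star_star]]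
    refine sM_bU_of_combo (PY_eq a) (PX_eq a) ?_ ?_ ?_ ?_ ?_ hv hw <;> intro c
    · simp [conj_qpow, conj_br, hconj1, hconj2, conj_s1]
    · simp [conj_qpow, conj_br, hconj1, hconj2, conj_s1]
    · simp [conj_qpow, conj_br, hconj1, hconj2, conj_s1]
    · have h1 := hcq c
      have h2 := hc2 c
      have h3 := br_ne (q := q) c
      have h4 := qpow_ne q c
      rw [hsub, qpow_add_two]
      generalize br (qc q * qpow q c) = u at *
      generalize br (qc q ^ 2 * qpow q c) = u' at *
      field_simp
    · have h1 := hcq c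
      have h2 := hc2 c
      have h3 := br_ne (q := q) c
      have h4 := qpow_ne q c
      rw [hsub, qpow_add_two]
      generalize br (qc q * qpow q c) = u at *
      generalize br (qc q ^ 2 * qpow q c) = u' at *
      field_simp
  | hZ =>
    rw [star_PZ]
    refine sM_bU_of_combo (PZ_eq a) (PZ_eq a) ?_ ?_ ?_ ?_ ?_ hv hw <;> intro c
    · simp [conj_qpow, conj_br, hconj1, hconj2, conj_s1]
    · simp [conj_qpow, conj_br, hconj1, hconj2, conj_s1]
    · simp [conj_qpow, conj_br, hconj1, hconj2, conj_s1]
    · have h1 := hcq c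
      have h2 := hc2 c
      have h3 := br_ne (q := q) c
      have h4 := qpow_ne q c
      rw [hsub, qpow_add_two]
      generalize br (qc q * qpow q c) = u at *
      generalize br (qc q ^ 2 * qpow q c) = u' at *
      field_simp
    · have h1 := hcq c
      have h2 := hc2 c
      have h3 := br_ne (q := q) c
      have h4 := qpow_ne q c
      rw [hsub, qpow_add_two]
      generalize br (qc q * qpow q c) = u at *
      generalize br (qc q ^ 2 * qpow q c) = u' at *
      field_simp
  | hC r =>
    rw [podles_star_algebraMap, bU_algebraMap_smul, bU_algebraMap_smul, sM_smul_right, sM_smul_left,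
      Complex.conj_conj]
  | hadd b c hb hc =>
    rw [podles_star_add, map_add, map_add, add_smul, add_smul, map_add, map_add,
      LinearMap.add_apply, hb hv hw, hc hv hw]
  | hmul b c hb hc =>
    rw [podles_star_mul, map_mul, map_mul, mul_smul, mul_smul,
      hb hv (pM_smul_eq_zero _ hw), hc (pM_smul_eq_zero _ hv) hw]

lemma sM_iBU {a : ℝ} (v w : MM q a) : sM q a v (iBU q a • w) = sM q a (iBU q a • v) w := by
  induction w using fM_induction with
  | h m =>
    induction v using fM_induction with
    | h n =>
      rw [iBU_fM, iBU_fM, sM_smul_right, sM_smul_left, sM_fM_fM, Complex.conj_ofReal]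
      by_cases h : n = m
      · rw [h]
      · rw [if_neg h, mul_zero, mul_zero]
    | h0 => rw [smul_zero, map_zero, LinearMap.zero_apply, LinearMap.zero_apply]
    | hadd v v' h h' => rw [smul_add, map_add, map_add, LinearMap.add_apply, LinearMap.add_apply, h, h']
    | hsmul r v h => rw [smul_comm, sM_smul_left, sM_smul_left, h]
  | h0 => rw [smul_zero, map_zero, map_zero]
  | hadd w w' h h' => rw [smul_add, map_add, map_add, h, h']
  | hsmul r w h => rw [smul_comm, sM_smul_right, sM_smul_right, h]

lemma piM_psiD_fM (a : ℝ) (m n : ℤ) :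
    piM q a (psiD q a m) (fM q a n) = if m = 2 * n then fM q a n else 0 :=
  piM_psiD_of_eigen (iBU_fM a n) m

lemma sM_psiD {a : ℝ} (m : ℤ) (v w : MM q a) :
    sM q a v (piM q a (psiD q a m) w) = sM q a (piM q a (psiD q a m) v) w := by
  induction w using fM_induction with
  | h k =>
    induction v using fM_induction with
    | h n =>
      rw [piM_psiD_fM, piM_psiD_fM]
      by_cases h : n = k
      · subst h; split_ifs <;> simp
      · split_ifs <;> simp [sM_fM_fM, h]
    | h0 => simp
    | hadd v v' h h' => simp only [map_add, LinearMap.add_apply, h, h']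
    | hsmul r v h => simp only [map_smul, map_smulₛₗ, LinearMap.smul_apply, h]
  | h0 => simp
  | hadd w w' h h' => simp only [map_add, h, h']
  | hsmul r w h => simp only [map_smul, h]

/-! ### The discrete series as submodules of `M_{q+q⁻¹,a}` -/

/-- The pull-back of the form of `M_{q+q⁻¹,a}` along a linear map. -/
def pullForm {a : ℝ} {V : Type*} [AddCommGroup V] [Module ℂ V] (f : V →ₗ[ℂ] MM q a) :
    V →ₗ⋆[ℂ] V →ₗ[ℂ] ℂ :=
  LinearMap.mk₂'ₛₗ (starRingEnd ℂ) (RingHom.id ℂ) (fun v w => sM q a (f v) (f w))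
    (fun v v' w => by rw [map_add, map_add, LinearMap.add_apply])
    (fun r v w => by rw [f.map_smul, sM_smul_left, smul_eq_mul])
    (fun v w w' => by rw [map_add, map_add])
    (fun r v w => by rw [f.map_smul, sM_smul_right, RingHom.id_apply, smul_eq_mul])

lemma pullForm_apply {a : ℝ} {V : Type*} [AddCommGroup V] [Module ℂ V] (f : V →ₗ[ℂ] MM q a)
    (v w : V) : pullForm f v w = sM q a (f v) (f w) := rfl

lemma exists_hom_Mmod {a c : ℝ} {v : MM q a} (hv : IsBasic (q := q) (a := a) c v) :
    ∃ j : Mmod q a (lam0 q) c →ₗ[UqSL q a] MM q a, j (Mmod.cyc q a (lam0 q) c) = v := by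
  obtain ⟨h1, h2⟩ := isBasic_iff.1 hv
  refine ⟨(basicIdeal q a (lam0 q) c).liftQ (LinearMap.toSpanSingleton (UqSL q a) (MM q a) v) ?_,
    ?_⟩
  · refine Submodule.span_le.2 ?_
    rintro x (rfl | rfl)
    · change (iBU q a - algebraMap ℂ _ (qn q c : ℂ)) • v = 0
      rw [sub_smul, algebraMap_smul_UqSL, h1, sub_self]
    · change (bU (Ac q a c) - algebraMap ℂ _ (lam0 q : ℂ)) • v = 0
      rw [sub_smul, algebraMap_smul_UqSL, h2, sub_self]
  · change (1 : UqSL q a) • v = v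
    exact one_smul _ v

lemma smul_cyc_surjective {a lam c : ℝ} (x : Mmod q a lam c) :
    ∃ u : UqSL q a, x = u • Mmod.cyc q a lam c := by
  obtain ⟨u, rfl⟩ := Submodule.Quotient.mk_surjective _ x
  exact ⟨u, by rw [Mmod.cyc, ← Submodule.Quotient.mk_smul, smul_eq_mul, mul_one]⟩

section embedding
variable {a c : ℝ} {v : MM q a} {j : Mmod q a (lam0 q) c →ₗ[UqSL q a] MM q a}

lemma pM_hom (hvp : pM q a v = 0) (hj : j (Mmod.cyc q a (lam0 q) c) = v)
    (x : Mmod q a (lam0 q) c) : pM q a (j x) = 0 := by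
  obtain ⟨u, rfl⟩ := smul_cyc_surjective x
  rw [map_smul, hj]
  exact pM_smul_eq_zero u hvp

/-- The pull-back of the inner product on the kernel of `p` is an invariant form on `M_{λ,c}`, so
that the kernel of the invariant forms is contained in the kernel of the map. -/
lemma formKer_le_ker (hvp : pM q a v = 0) (hj : j (Mmod.cyc q a (lam0 q) c) = v) :
    formKer q a (lam0 q) c ≤ LinearMap.ker j := by
  intro k hk
  have hpos := hk (pullForm (q := q) (j.restrictScalars ℂ)) ⟨fun b x y => ?_, fun x y => ?_⟩ k
  · by_contra h
    have := sM_self_pos (pM_hom hvp hj k) h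
    rw [pullForm_apply] at hpos
    change sM q a (j k) (j k) = 0 at hpos
    rw [hpos] at this
    simp at this
  · change sM q a (j x) (j (bU b • y)) = sM q a (j (bU (star b) • x)) (j y)
    rw [j.map_smul, j.map_smul]
    exact sM_bU b (pM_hom hvp hj x) (pM_hom hvp hj y)
  · change sM q a (j x) (j (iBU q a • y)) = sM q a (j (iBU q a • x)) (j y)
    rw [j.map_smul, j.map_smul]
    exact sM_iBU _ _

/-- An invariant form pairs the cyclic vector only with its own weight component, which can be read
off from the image in `M_{q+q⁻¹,a}`. -/
lemma exists_coeff {m : ℤ} (hc : c = a + m) (hj : j (Mmod.cyc q a (lam0 q) c) = v)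
    {s : Mmod q a (lam0 q) c →ₗ⋆[ℂ] Mmod q a (lam0 q) c →ₗ[ℂ] ℂ}
    (hs : IsInvariantForm (q := q) (a := a) s) (k : Mmod q a (lam0 q) c) :
    ∃ r : ℂ, s (Mmod.cyc q a (lam0 q) c) k =
      r * s (Mmod.cyc q a (lam0 q) c) (Mmod.cyc q a (lam0 q) c) ∧
      piM q a (psiD q a m) (j k) = r • v := by
  have hstr := isString_str (isBasic_cyc (q := q) a c)
  have hwt (n : ℤ) := (hstr n).1.1
  have hk : k ∈ Submodule.span ℂ (Set.range (str q a c (Mmod.cyc q a (lam0 q) c))) := by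
    rw [span_str_cyc]; trivial
  induction hk using Submodule.span_induction with
  | mem k hk =>
    obtain ⟨n, rfl⟩ := hk
    have hqn : qn q (c + 2 * (n : ℝ)) = qn q (a + (m + 2 * n : ℤ)) := by
      rw [hc]; push_cast; rw [add_assoc]
    have h1 : piM q a (psiD q a m) (j (str q a c (Mmod.cyc q a (lam0 q) c) n)) =
        if m = m + 2 * n then j (str q a c (Mmod.cyc q a (lam0 q) c) n) else 0 := by
      refine piM_psiD_of_eigen ?_ m
      rw [← j.map_smul, hwt, hqn]
      exact (j.restrictScalars ℂ).map_smul _ _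
    by_cases hn : n = 0
    · subst hn
      refine ⟨1, by rw [one_mul]; rfl, ?_⟩
      rw [h1, if_pos (by omega), one_smul]
      exact hj
    · refine ⟨0, ?_, by rw [h1, if_neg (by omega), zero_smul]⟩
      have h2 := hs.2 (Mmod.cyc q a (lam0 q) c) (str q a c (Mmod.cyc q a (lam0 q) c) n)
      rw [hwt, (isBasic_cyc (q := q) a c).1, (s _).map_smul, LinearMap.map_smulₛₗ,
        LinearMap.smul_apply, Complex.conj_ofReal, smul_eq_mul, smul_eq_mul, ← sub_eq_zero,
        ← sub_mul] at h2
      rw [zero_mul]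
      refine (mul_eq_zero.1 h2).resolve_left fun h3 => hn ?_
      have h4 : (qn q (a + (m + 2 * n : ℤ)) : ℂ) = (qn q (a + (m : ℤ)) : ℂ) := by
        rw [← hqn, ← hc]; exact sub_eq_zero.1 h3
      have := qn_int_injective (q := q) a h4
      omega
  | zero => exact ⟨0, by simp, by simp⟩
  | add x y _ _ hx hy =>
    obtain ⟨r, h1, h2⟩ := hx
    obtain ⟨r', h1', h2'⟩ := hy
    exact ⟨r + r', by rw [map_add, h1, h1', add_mul], by rw [map_add, map_add, h2, h2', add_smul]⟩
  | smul t x _ hx =>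
    obtain ⟨r, h1, h2⟩ := hx
    refine ⟨t * r, by rw [(s _).map_smul, h1, smul_eq_mul, mul_assoc], ?_⟩
    have h3 : j (t • x) = t • j x := (j.restrictScalars ℂ).map_smul _ _
    rw [h3, map_smul, h2, smul_smul]

lemma ker_le_formKer {m : ℤ} (hc : c = a + m) (hv : v ≠ 0)
    (hj : j (Mmod.cyc q a (lam0 q) c) = v) : LinearMap.ker j ≤ formKer q a (lam0 q) c := by
  intro k hk s hs w
  obtain ⟨u, rfl⟩ := smul_cyc_surjective w
  have hcyc (k : Mmod q a (lam0 q) c) (hk : j k = 0) : s (Mmod.cyc q a (lam0 q) c) k = 0 := by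
    obtain ⟨r, h1, h2⟩ := exists_coeff hc hj hs k
    rw [hk, map_zero] at h2
    rw [h1, (smul_eq_zero.1 h2.symm).resolve_right hv, zero_mul]
  have key (u : UqSL q a) : ∀ w : Mmod q a (lam0 q) c, (∀ k, j k = 0 → s w k = 0) →
      ∀ k, j k = 0 → s (u • w) k = 0 := by
    induction u using UqSL_induction with
    | hb b =>
      intro w hw k hk
      have := hs.1 (star b) w k
      rw [podles_star_star] at this
      rw [← this]
      exact hw _ (by rw [j.map_smul, hk, smul_zero])
    | hB =>
      intro w hw k hk
      rw [← hs.2]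
      exact hw _ (by rw [j.map_smul, hk, smul_zero])
    | hc r =>
      intro w hw k hk
      rw [algebraMap_smul_UqSL, LinearMap.map_smulₛₗ, LinearMap.smul_apply, hw k hk, smul_zero]
    | hadd x y hx hy =>
      intro w hw k hk
      rw [add_smul, map_add, LinearMap.add_apply, hx w hw k hk, hy w hw k hk, add_zero]
    | hmul x y hx hy =>
      intro w hw k hk
      rw [mul_smul]
      exact hx _ (hy w hw) k hk
  exact key u _ hcyc k hk

end embedding

/-- A nonzero basic vector of weight `c ∈ a + ℤ` in the kernel of `p` generates a copy of
`L_{q+q⁻¹,c}`: as the kernel of `p` carries an invariant inner product, the annihilator of the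
vector is the kernel of the invariant forms. -/
lemma exists_embedding {a c : ℝ} {v : MM q a} {m : ℤ} (hc : c = a + m) (hv : v ≠ 0)
    (hvp : pM q a v = 0) (hb : IsBasic (q := q) (a := a) c v) :
    ∃ J : Lmod q a (lam0 q) c →ₗ[UqSL q a] MM q a, Function.Injective J ∧
      J (Lmod.cyc q a (lam0 q) c) = v ∧ ∀ x, ∃ u : UqSL q a, J x = u • v := by
  obtain ⟨j, hj⟩ := exists_hom_Mmod hb
  refine ⟨(formKer q a (lam0 q) c).liftQ j (formKer_le_ker hvp hj), ?_, hj, fun x => ?_⟩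
  · refine LinearMap.ker_eq_bot.1 ?_
    rw [Submodule.ker_liftQ, eq_bot_iff]
    exact (Submodule.map_mono (ker_le_formKer hc hv hj)).trans (by simp)
  · obtain ⟨x, rfl⟩ := Submodule.Quotient.mk_surjective _ x
    obtain ⟨u, rfl⟩ := smul_cyc_surjective x
    refine ⟨u, ?_⟩
    change j (u • _) = _
    rw [j.map_smul, hj]

/-- The submodule generated by `f_1` is spanned by the vectors `f_n` with `n ≥ 1`. -/
lemma repr_smul_fM_one (a : ℝ) (u : UqSL q a) {n : ℤ} (hn : n ≤ 0) :
    (basisM q a).repr (u • fM q a 1) n = 0 := by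
  have hf := isString_fM (q := q) a
  have hs : IsString (q := q) (a := a) a (fun n => if n = 0 then 0 else strP q a a n) (strM q a a)
      (fun n => if 1 ≤ n then fM q a n else 0) := by
    intro n
    by_cases h : 1 ≤ n
    · simp only [if_pos h, if_pos (show 1 ≤ n + 1 by omega), if_neg (show n ≠ 0 by omega)]
      refine ⟨(hf n).1, (hf n).2.1, ?_⟩
      by_cases h1 : n = 1
      · subst h1
        rw [(hf 1).2.2, strM_eq, if_neg (by omega), sub_self, tr_zero, Complex.ofReal_zero,
          zero_smul, zero_smul]
      · rw [if_pos (by omega)]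
        exact (hf n).2.2
    · simp only [if_neg h, if_neg (show ¬ 1 ≤ n - 1 by omega), smul_zero]
      refine ⟨⟨by rw [smul_zero, smul_zero], by rw [smul_zero, smul_zero]⟩, ?_, trivial⟩
      by_cases h1 : n = 0
      · rw [if_pos h1, zero_smul]
      · rw [if_neg (show ¬ 1 ≤ n + 1 by omega), smul_zero]
  have h1 := hs.smul_mem_span u (Submodule.subset_span ⟨1, rfl⟩)
  simp only [le_refl, if_true] at h1
  have h2 : Submodule.span ℂ (Set.range fun n : ℤ => if 1 ≤ n then fM q a n else 0) ≤
      LinearMap.ker ((basisM q a).coord n) := by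
    refine Submodule.span_le.2 ?_
    rintro _ ⟨k, rfl⟩
    change (basisM q a).repr (if 1 ≤ k then fM q a k else 0) n = 0
    split_ifs with h
    · rw [repr_fM, Finsupp.single_apply, if_neg (by omega)]
    · exact LinearMap.map_zero ((basisM q a).coord n)
  exact h2 h1

/-- The submodule generated by `f_{-1}` is spanned by the vectors `f_n` with `n ≤ -1`. -/
lemma repr_smul_fM_neg_one (a : ℝ) (u : UqSL q a) {n : ℤ} (hn : 0 ≤ n) :
    (basisM q a).repr (u • fM q a (-1)) n = 0 := by
  have hf := isString_fM (q := q) a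
  have hs : IsString (q := q) (a := a) a (strP q a a) (fun n => if n = 0 then 0 else strM q a a n)
      (fun n => if n ≤ -1 then fM q a n else 0) := by
    intro n
    by_cases h : n ≤ -1
    · simp only [if_pos h, if_pos (show n - 1 ≤ -1 by omega), if_neg (show n ≠ 0 by omega)]
      refine ⟨(hf n).1, ?_, (hf n).2.2⟩
      by_cases h1 : n = -1
      · subst h1
        rw [(hf (-1)).2.1, strP_eq, if_neg (by omega), tr_neg_one, Complex.ofReal_zero,
          zero_smul, zero_smul]
      · rw [if_pos (by omega)]
        exact (hf n).2.1
    · simp only [if_neg h, if_neg (show ¬ n + 1 ≤ -1 by omega), smul_zero]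
      refine ⟨⟨by rw [smul_zero, smul_zero], by rw [smul_zero, smul_zero]⟩, trivial, ?_⟩
      by_cases h1 : n = 0
      · rw [if_pos h1, zero_smul]
      · rw [if_neg (show ¬ n - 1 ≤ -1 by omega), smul_zero]
  have h1 := hs.smul_mem_span u (Submodule.subset_span ⟨-1, rfl⟩)
  simp only [le_refl, if_true] at h1
  have h2 : Submodule.span ℂ (Set.range fun n : ℤ => if n ≤ -1 then fM q a n else 0) ≤
      LinearMap.ker ((basisM q a).coord n) := by
    refine Submodule.span_le.2 ?_
    rintro _ ⟨k, rfl⟩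
    change (basisM q a).repr (if k ≤ -1 then fM q a k else 0) n = 0
    split_ifs with h
    · rw [repr_fM, Finsupp.single_apply, if_neg (by omega)]
    · exact LinearMap.map_zero ((basisM q a).coord n)
  exact h2 h1

lemma fM_mem_of_one_mem {a : ℝ} {N : Submodule (UqSL q a) (MM q a)} (h : fM q a 1 ∈ N) {n : ℤ}
    (hn : 1 ≤ n) : fM q a n ∈ N := by
  obtain ⟨k, rfl⟩ : ∃ k : ℕ, n = k + 1 := ⟨(n - 1).toNat, by omega⟩
  induction k with
  | zero => exact h
  | succ k ih =>
    have h1 : fM q a (((k + 1 : ℕ) : ℤ) + 1) = _ :=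
      str_add_one (q := q) (c := a) (ea q a) (n := ((k + 1 : ℕ) : ℤ)) (by omega)
    rw [h1]
    exact N.smul_mem _ (ih (by omega))

lemma fM_mem_of_neg_one_mem {a : ℝ} {N : Submodule (UqSL q a) (MM q a)} (h : fM q a (-1) ∈ N)
    {n : ℤ} (hn : n ≤ -1) : fM q a n ∈ N := by
  obtain ⟨k, rfl⟩ : ∃ k : ℕ, n = -(k : ℤ) - 1 := ⟨(-n - 1).toNat, by omega⟩
  induction k with
  | zero => exact h
  | succ k ih =>
    have h1 : fM q a (-((k + 1 : ℕ) : ℤ) - 1) = _ :=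
      str_sub_one (q := q) (c := a) (ea q a) (n := -((k + 1 : ℕ) : ℤ)) (by omega)
    rw [h1, show -((k + 1 : ℕ) : ℤ) = -(k : ℤ) - 1 by push_cast; ring]
    exact N.smul_mem _ (ih (by omega))

lemma Tplus_smul_ea (a : ℝ) : bU (Tplus q a a) • ea q a = qpow q a • fM q a 1 := by
  rw [Tplus_eq, bU_smul_smul, fM_one]

lemma Tminus_smul_ea (a : ℝ) : bU (Tminus q a a) • ea q a = (-(qpow q a)⁻¹) • fM q a (-1) := by
  rw [Tminus_eq, bU_smul_smul, fM_neg_one]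

lemma repr_smul {a : ℝ} (r : ℂ) (v : MM q a) (n : ℤ) :
    (basisM q a).repr (r • v) n = r * (basisM q a).repr v n :=
  LinearMap.map_smul ((basisM q a).coord n) r v

lemma exists_Dplus (q : QParam) (a : ℝ) : ∃ J : Dplus q a →ₗ[UqSL q a] MM q a,
    Function.Injective J ∧ J (Lmod.cyc q a (lam0 q) (a + 2)) = bU (Tplus q a a) • ea q a ∧
    (∀ x, ∀ n ≤ 0, (basisM q a).repr (J x) n = 0) ∧ ∀ n, 1 ≤ n → ∃ x, J x = fM q a n := by
  have hr := qpow_ne q a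
  have hb := ((isString_fM (q := q) a) 1).1.smul (qpow q a)
  rw [show a + 2 * ((1 : ℤ) : ℝ) = a + 2 by push_cast; ring] at hb
  have hp : pM q a (qpow q a • fM q a 1) = 0 := by
    rw [(pM q a).map_smul, pM_fM, if_neg one_ne_zero, smul_zero]
  obtain ⟨J, hJ, hJc, hJu⟩ := exists_embedding (m := 2) (by push_cast; ring)
    (smul_ne_zero hr (fM_ne_zero a 1)) hp hb
  refine ⟨J, hJ, by rw [hJc, Tplus_smul_ea], fun x n hn => ?_, fun n hn => ?_⟩
  · obtain ⟨u, hu⟩ := hJu x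
    rw [hu, smul_comm, repr_smul, repr_smul_fM_one a u hn, mul_zero]
  · refine fM_mem_of_one_mem (N := LinearMap.range J)
      ⟨(qpow q a)⁻¹ • Lmod.cyc q a (lam0 q) (a + 2), ?_⟩ hn
    refine ((J.restrictScalars ℂ).map_smul _ _).trans ?_
    change (qpow q a)⁻¹ • J _ = _
    rw [hJc, smul_smul, inv_mul_cancel₀ hr, one_smul]

lemma exists_Dminus (q : QParam) (a : ℝ) : ∃ J : Dminus q a →ₗ[UqSL q a] MM q a,
    Function.Injective J ∧ J (Lmod.cyc q a (lam0 q) (a - 2)) = bU (Tminus q a a) • ea q a ∧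
    (∀ x, ∀ n, 0 ≤ n → (basisM q a).repr (J x) n = 0) ∧ ∀ n ≤ -1, ∃ x, J x = fM q a n := by
  have hr : -(qpow q a)⁻¹ ≠ 0 := neg_ne_zero.2 (inv_ne_zero (qpow_ne q a))
  have hb := ((isString_fM (q := q) a) (-1)).1.smul (-(qpow q a)⁻¹)
  rw [show a + 2 * ((-1 : ℤ) : ℝ) = a - 2 by push_cast; ring] at hb
  have hp : pM q a (-(qpow q a)⁻¹ • fM q a (-1)) = 0 := by
    rw [(pM q a).map_smul, pM_fM, if_neg (by omega), smul_zero]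
  obtain ⟨J, hJ, hJc, hJu⟩ := exists_embedding (m := -2) (by push_cast; ring)
    (smul_ne_zero hr (fM_ne_zero a (-1))) hp hb
  refine ⟨J, hJ, by rw [hJc, Tminus_smul_ea], fun x n hn => ?_, fun n hn => ?_⟩
  · obtain ⟨u, hu⟩ := hJu x
    rw [hu, smul_comm, repr_smul, repr_smul_fM_neg_one a u hn, mul_zero]
  · refine fM_mem_of_neg_one_mem (N := LinearMap.range J)
      ⟨(-(qpow q a)⁻¹)⁻¹ • Lmod.cyc q a (lam0 q) (a - 2), ?_⟩ hn
    refine ((J.restrictScalars ℂ).map_smul _ _).trans ?_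
    change (-(qpow q a)⁻¹)⁻¹ • J _ = _
    rw [hJc, smul_smul, inv_mul_cancel₀ hr, one_smul]

/-- The embedding of `D_2^+ ⊕ D_2^-` in `M_{q+q⁻¹,a}` as the kernel of `p`. -/
lemma exists_phiM (q : QParam) (a : ℝ) : ∃ φ : DD q a →ₗ[ℂ] MM q a, Function.Injective φ ∧
    (∀ v, pM q a v = 0 ↔ ∃ w, φ w = v) ∧ φ (ePlus q a) = bU (Tplus q a a) • ea q a ∧
    φ (eMinus q a) = bU (Tminus q a a) • ea q a ∧
    ∀ (x : UqSL q a) (w : DD q a), φ (x • w) = x • φ w := by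
  obtain ⟨J, hJ, hJc, hJn, hJs⟩ := exists_Dplus q a
  obtain ⟨J', hJ', hJc', hJn', hJs'⟩ := exists_Dminus q a
  refine ⟨(J.restrictScalars ℂ).coprod (J'.restrictScalars ℂ), ?_, fun v => ⟨fun hv => ?_, ?_⟩,
    ?_, ?_, fun x w => ?_⟩
  · refine LinearMap.ker_eq_bot.1 (eq_bot_iff.2 ?_)
    rintro ⟨x, y⟩ hxy
    have h : J x + J' y = 0 := hxy
    have hx : J x = 0 := by
      refine (basisM q a).ext_elem fun n => ?_
      have h0 : (basisM q a).repr (0 : MM q a) n = 0 := LinearMap.map_zero ((basisM q a).coord n)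
      rw [h0]
      rcases le_or_gt n 0 with hn | hn
      · exact hJn x n hn
      · have h1 : (basisM q a).repr (J x + J' y) n = _ :=
          LinearMap.map_add ((basisM q a).coord n) (J x) (J' y)
        have h2 : (basisM q a).coord n (J' y) = 0 := hJn' y n hn.le
        rw [h, h0, h2, add_zero] at h1
        exact h1.symm
    rw [hx, zero_add] at h
    exact Prod.ext (hJ (hx.trans J.map_zero.symm)) (hJ' (h.trans J'.map_zero.symm))
  · refine ker_pM_induction (q := q) (a := a) (P := fun v : MM q a => v ∈
      LinearMap.range ((J.restrictScalars ℂ).coprod (J'.restrictScalars ℂ))) (fun n hn => ?_)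
      (zero_mem _) (fun _ _ => add_mem) (fun r v hv => Submodule.smul_mem _ r hv) hv
    rcases lt_or_gt_of_ne hn with h | h
    · obtain ⟨x, hx⟩ := hJs' n (by omega)
      exact ⟨(0, x), by
        change J 0 + J' x = _
        rw [J.map_zero, zero_add, hx]⟩
    · obtain ⟨x, hx⟩ := hJs n (by omega)
      exact ⟨(x, 0), by
        change J x + J' 0 = _
        rw [J'.map_zero, add_zero, hx]⟩
  · rintro ⟨⟨x, y⟩, rfl⟩
    change pM q a (J x + J' y) = 0
    rw [map_add, pM_eq_repr, pM_eq_repr, hJn x 0 le_rfl, hJn' y 0 le_rfl, add_zero]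
  · change J _ + J' 0 = _
    rw [J'.map_zero, add_zero]
    exact hJc
  · change J 0 + J' _ = _
    rw [J.map_zero, zero_add]
    exact hJc'
  · change J (x • w.1) + J' (x • w.2) = x • (J w.1 + J' w.2)
    rw [J.map_smul, J'.map_smul, smul_add]

/-! ### The representation on `D_2^+ ⊕ D_2^-` and the cocycles -/

lemma exists_factor_of_injective {U V M : Type*} [AddCommGroup U] [Module ℂ U] [AddCommGroup V]
    [Module ℂ V] [AddCommGroup M] [Module ℂ M] {φ : V →ₗ[ℂ] M} (hφ : Function.Injective φ)
    (f : U →ₗ[ℂ] M) (h : ∀ u, ∃ v, φ v = f u) : ∃ g : U →ₗ[ℂ] V, ∀ u, φ (g u) = f u := by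
  refine ⟨(LinearEquiv.ofInjective φ hφ).symm.toLinearMap ∘ₗ f.codRestrict (LinearMap.range φ) h,
    fun u => ?_⟩
  have := (LinearEquiv.ofInjective φ hφ).apply_symm_apply (f.codRestrict (LinearMap.range φ) h u)
  exact congrArg Subtype.val this

lemma exists_restriction {D V M : Type*} [Ring D] [Algebra ℂ D] [AddCommGroup V] [Module ℂ V]
    [AddCommGroup M] [Module ℂ M] {φ : V →ₗ[ℂ] M} (hφ : Function.Injective φ)
    (ρ : D →ₐ[ℂ] Module.End ℂ M) (h : ∀ z v, ∃ w, φ w = ρ z (φ v)) :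
    ∃ π : D →ₐ[ℂ] Module.End ℂ V, ∀ z v, φ (π z v) = ρ z (φ v) := by
  choose g hg using fun z => exists_factor_of_injective hφ (ρ z ∘ₗ φ) (h z)
  have hg' (z v) : φ (g z v) = ρ z (φ v) := hg z v
  refine ⟨AlgHom.ofLinearMap
    { toFun := g
      map_add' := fun x y => LinearMap.ext fun v => hφ ?_
      map_smul' := fun r x => LinearMap.ext fun v => hφ ?_ }
    (LinearMap.ext fun v => hφ ?_) (fun x y => LinearMap.ext fun v => hφ ?_), hg'⟩
  · rw [LinearMap.add_apply, map_add φ, hg', hg', hg', map_add, LinearMap.add_apply]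
  · rw [LinearMap.smul_apply, map_smul φ, hg', hg', map_smul]; rfl
  · change φ (g 1 v) = φ v
    rw [hg', map_one, Module.End.one_apply]
  · change φ (g (x * y) v) = φ (g x (g y v))
    rw [hg', hg', hg', map_mul, Module.End.mul_apply]

lemma dualStar_add (h k : Dual q) : dualStar (h + k) = dualStar h + dualStar k :=
  dual_ext fun x => map_add (starRingEnd ℂ) (h (star (S q x))) (k (star (S q x)))

lemma dualStar_smul (r : ℂ) (h : Dual q) : dualStar (r • h) = conj r • dualStar h :=
  dual_ext fun x => map_mul (starRingEnd ℂ) r (h (star (S q x)))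

lemma dualStar_zero : dualStar (0 : Dual q) = 0 :=
  dual_ext fun _ => map_zero (starRingEnd ℂ)

lemma yD_add {a : ℝ} {x y : Dual q} (hx : x ∈ Ic q a) (hy : y ∈ Ic q a) (h : x + y ∈ Ic q a) :
    yD (x + y) h = yD x hx + yD y hy := Subtype.ext (map_add Double.ofU x y)

lemma yD_smul {a : ℝ} (r : ℂ) {x : Dual q} (hx : x ∈ Ic q a) (h : r • x ∈ Ic q a) :
    yD (r • x) h = r • yD x hx := Subtype.ext (map_smul Double.ofU r x)

lemma yD_zero {a : ℝ} (h : (0 : Dual q) ∈ Ic q a) : yD 0 h = 0 := Subtype.ext (map_zero Double.ofU)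

lemma sM_yD {a : ℝ} {y : Dual q} (hy : y ∈ Ic q a) : ∃ hy' : dualStar y ∈ Ic q a, ∀ v w : MM q a,
    sM q a v (piM q a (yD y hy) w) = sM q a (piM q a (yD (dualStar y) hy') v) w := by
  have hspan : y ∈ Submodule.span ℂ (Set.range (psi q a)) := Ic_eq (q := q) a ▸ hy
  suffices h : ∃ (hy : y ∈ Ic q a) (hy' : dualStar y ∈ Ic q a), ∀ v w : MM q a,
      sM q a v (piM q a (yD y hy) w) = sM q a (piM q a (yD (dualStar y) hy') v) w from h.2
  clear hy
  induction hspan using Submodule.span_induction with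
  | mem y hy =>
    obtain ⟨m, rfl⟩ := hy
    have h (z : Dual q) (hz : z ∈ Ic q a) (e : z = psi q a m) : yD z hz = psiD q a m := by
      subst e; rfl
    have hm : dualStar (psi q a m) ∈ Ic q a := (dualStar_psi (q := q) a m).symm ▸ psi_mem_Ic a m
    refine ⟨psi_mem_Ic a m, hm, fun v w => ?_⟩
    rw [h _ hm (dualStar_psi a m)]
    exact sM_psiD m v w
  | zero =>
    have h0 : dualStar (0 : Dual q) ∈ Ic q a := by rw [dualStar_zero]; exact zero_mem _
    refine ⟨zero_mem _, h0, fun v w => ?_⟩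
    have h1 : yD (dualStar (0 : Dual q)) h0 = 0 := by
      refine Subtype.ext ?_
      change Double.ofU (dualStar (0 : Dual q)) = 0
      rw [dualStar_zero, map_zero]
    rw [h1, yD_zero, map_zero, LinearMap.zero_apply, LinearMap.zero_apply, map_zero, map_zero,
      LinearMap.zero_apply]
  | add x y _ _ hx hy =>
    obtain ⟨h1, h1', e1⟩ := hx
    obtain ⟨h2, h2', e2⟩ := hy
    have h' : dualStar (x + y) ∈ Ic q a := by rw [dualStar_add]; exact add_mem h1' h2'
    have h3 : yD (dualStar (x + y)) h' = yD (dualStar x) h1' + yD (dualStar y) h2' := by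
      refine Subtype.ext ?_
      change Double.ofU (dualStar (x + y)) = Double.ofU (dualStar x) + Double.ofU (dualStar y)
      rw [dualStar_add, map_add]
    refine ⟨add_mem h1 h2, h', fun v w => ?_⟩
    rw [h3, yD_add h1 h2, map_add, map_add, LinearMap.add_apply, LinearMap.add_apply, map_add,
      map_add, LinearMap.add_apply, e1, e2]
  | smul r x _ hx =>
    obtain ⟨h1, h1', e1⟩ := hx
    have h' : dualStar (r • x) ∈ Ic q a := by
      rw [dualStar_smul]; exact Submodule.smul_mem _ _ h1'
    have h3 : yD (dualStar (r • x)) h' = conj r • yD (dualStar x) h1' := by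
      refine Subtype.ext ?_
      change Double.ofU (dualStar (r • x)) = conj r • Double.ofU (dualStar x)
      rw [dualStar_smul, map_smul]
    refine ⟨Submodule.smul_mem _ _ h1, h', fun v w => ?_⟩
    rw [h3, yD_smul r h1, map_smul, map_smul, LinearMap.smul_apply, LinearMap.smul_apply,
      sM_smul_right, sM_smul_left, e1, Complex.conj_conj]

lemma epsD_eq {a : ℝ} (z : DCoid q a) : epsD z = pM q a (piM q a z (ea q a)) := by
  rw [pM_piM, pM_ea, mul_one]

lemma epsD_mul {a : ℝ} (z w : DCoid q a) : epsD (z * w) = epsD z * epsD w := by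
  rw [epsD_eq, map_mul, Module.End.mul_apply, pM_piM, pM_piM, pM_ea, mul_one]

lemma epsD_bD {a : ℝ} (b : podles q a) : epsD (bD b) = counit (R := ℂ) (b : OqSU2 q) := by
  rw [epsD_eq, piM_bD, pM_bU, pM_ea, mul_one]

lemma piM_psiD_zero {a : ℝ} (v : MM q a) : piM q a (psiD q a 0) v = pM q a v • ea q a := by
  induction v using fM_induction with
  | h n =>
    rw [piM_psiD_fM, pM_fM]
    by_cases h : n = 0
    · subst h; simp [fM_zero]
    · rw [if_neg (by omega), if_neg h, zero_smul]
  | h0 => rw [map_zero, map_zero, zero_smul]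
  | hadd v w hv hw => rw [map_add, map_add, hv, hw, add_smul]
  | hsmul r v hv => rw [map_smul, map_smul, hv, smul_eq_mul, mul_smul]

/-- An invariant complement would have weight `a`, hence be spanned by `e_a`, which `T^+` does not
annihilate. -/
lemma nonSplit_piM (q : QParam) (a : ℝ) : NonSplit (piM q a) (pM q a) := by
  rintro ⟨v, hv, h⟩
  have h0 := h (psiD q a 0)
  rw [epsD_eq, piM_psiD_zero, piM_psiD_zero, pM_ea, one_smul, pM_ea, one_smul, hv, one_smul] at h0
  subst h0
  have h1 := h (bD (Tp q a (qpow q a)))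
  rw [piM_bD, ← fM_one] at h1
  have h2 := pM_fM (q := q) a 1
  rw [h1, if_neg one_ne_zero, (pM q a).map_smul, pM_ea, smul_eq_mul, mul_one] at h2
  rw [h2, zero_smul] at h1
  exact fM_ne_zero a 1 h1

lemma piM_yD_bU {a : ℝ} {y : Dual q} (hy : y ∈ Ic q a) (b : podles q a) :
    piM q a (yD y hy) (bU b • ea q a - counit (R := ℂ) (b : OqSU2 q) • ea q a) =
      bU ⟨ract (dualSinv y) (b : OqSU2 q), ract_mem_podles _ b.2⟩ • ea q a -
        counit (R := ℂ) (ract (dualSinv y) (b : OqSU2 q)) • ea q a := by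
  have hact (b : podles q a) : piM q a (yD y hy) (bU b • ea q a) =
      bU ⟨ract (dualSinv y) (b : OqSU2 q), ract_mem_podles _ b.2⟩ • ea q a := by
    have h := piM_theta (yD y hy) b
    rw [theta_apply, theta_apply] at h
    refine h.trans ?_
    congr 2
    exact Subtype.ext (actD_yD hy b)
  have hone : piM q a (yD y hy) (ea q a) = y 1 • ea q a := by
    have h := hact 1
    rw [map_one, one_smul] at h
    rw [h]
    have e : (⟨ract (dualSinv y) ((1 : podles q a) : OqSU2 q), ract_mem_podles _ (one_mem _)⟩ :
        podles q a) = algebraMap ℂ _ (y 1) := by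
      refine Subtype.ext ?_
      change ract (dualSinv y) (1 : OqSU2 q) = algebraMap ℂ _ (y 1)
      rw [ract, LinearMap.comp_apply, LinearMap.comp_apply, Bialgebra.comul_one,
        Algebra.TensorProduct.one_def, LinearMap.rTensor_tmul, LinearEquiv.coe_coe,
        TensorProduct.lid_tmul, Algebra.algebraMap_eq_smul_one]
      congr 1
      change y (Sinv q 1) = y 1
      rw [Sinv_one]
    rw [← bU_algebraMap_smul (q := q) (a := a) (y 1) (ea q a), ← e]
  rw [map_sub, (piM q a (yD y hy)).map_smul, hact, hone, counit_ract, dualSinv_apply,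
    apply_Sinv_stab (Ic_le_stabDual a hy) b.2, mul_smul]

lemma sM_Tplus_smul_ea (a : ℝ) :
    sM q a (bU (Tplus q a a) • ea q a) (bU (Tplus q a a) • ea q a) = 1 := by
  have h : ((q : ℝ) ^ a : ℝ) ≠ 0 := (qpow_pos a).ne'
  rw [Tplus_smul_ea, sM_smul_right, sM_smul_left, sM_fM_fM, if_pos rfl, conj_qpow, wgt_one, qpow]
  norm_cast
  field_simp

lemma sM_Tminus_smul_ea (a : ℝ) :
    sM q a (bU (Tminus q a a) • ea q a) (bU (Tminus q a a) • ea q a) =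
      ((qs q (a + 2) * qs q (a - 1) / (qs q (a - 2) * qs q (a + 1)) : ℝ) : ℂ) := by
  have h : ((q : ℝ) ^ a : ℝ) ≠ 0 := (qpow_pos a).ne'
  rw [Tminus_smul_ea, sM_smul_right, sM_smul_left, sM_fM_fM, if_pos rfl, map_neg, map_inv₀,
    conj_qpow, wgt_neg_one, qpow]
  generalize qs q (a + 2) * qs q (a - 1) / (qs q (a - 2) * qs q (a + 1)) = K
  norm_cast
  field_simp

end SLqR

end

set_option maxHeartbeats 1000000 in
theorem mainTheorem3 (q : Set.Ioo (0 : ℝ) 1) (a : ℝ) :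
    ∃ (πM : DCoid q a →ₐ[ℂ] Module.End ℂ (MM q a))
      (π : DCoid q a →ₐ[ℂ] Module.End ℂ (DD q a))
      (φ : DD q a →ₗ[ℂ] MM q a) (p : MM q a →ₗ[ℂ] ℂ)
      (s : DD q a →ₗ⋆[ℂ] DD q a →ₗ[ℂ] ℂ)
      (Ct : DCoid q a →ₗ[ℂ] DD q a) (C : podles q a →ₗ[ℂ] DD q a),
      CorrespondsTo πM ∧ CorrespondsTo π ∧ IsExtension πM π φ p ∧ NonSplit πM p ∧
      IsInner s ∧ s (ePlus q a) (ePlus q a) = 1 ∧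
      s (eMinus q a) (eMinus q a) =
        ((qs q (a + 2) * qs q (a - 1) / (qs q (a - 2) * qs q (a + 1)) : ℝ) : ℂ) ∧
      IsStarRep s π ∧
      (∀ z : DCoid q a, φ (Ct z) = πM z (ea q a) - epsD z • ea q a) ∧
      (∀ b : podles q a, φ (C b) =
        πM (bD b) (ea q a) - Coalgebra.counit (R := ℂ) (b : OqSU2 q) • ea q a) ∧
      IsCocycle π Ct ∧ IsYDCocycle π C := by
  obtain ⟨φ, hφ, hker, hplus, hminus, hsmul⟩ := exists_phiM q a
  have hp (w : DD q a) : pM q a (φ w) = 0 := (hker _).2 ⟨w, rfl⟩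
  obtain ⟨π, hπ⟩ := exists_restriction hφ (piM q a) fun z w =>
    (hker _).1 (by rw [pM_piM, hp, mul_zero])
  have hbD (b : podles q a) (w : DD q a) : φ (π (bD b) w) = bU b • φ w := by
    rw [hπ, piM_bD]
  -- `p` kills `π̃(z) e_a - ε(z) e_a`, so that this map factors through `φ`
  have heps : ∀ z : DCoid q a, ∃ w, φ w = ((LinearMap.applyₗ (ea q a) ∘ₗ (piM q a).toLinearMap) -
      epsD.smulRight (ea q a) : DCoid q a →ₗ[ℂ] MM q a) z := fun z => (hker _).1 (by
    change pM q a (piM q a z (ea q a) - epsD z • ea q a) = 0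
    rw [map_sub, (pM q a).map_smul, pM_piM, pM_ea, smul_eq_mul, sub_self])
  obtain ⟨Ct, hCt⟩ := exists_factor_of_injective hφ _ heps
  replace hCt : ∀ z, φ (Ct z) = piM q a z (ea q a) - epsD z • ea q a := hCt
  have hC (b : podles q a) : φ ((Ct ∘ₗ bD.toLinearMap) b) =
      piM q a (bD b) (ea q a) - counit (R := ℂ) (b : OqSU2 q) • ea q a := by
    rw [← epsD_bD]; exact hCt _
  have hcoc : IsCocycle π Ct := by
    intro x y
    refine hφ ?_
    rw [map_add, φ.map_smul, hπ, hCt, hCt, hCt, map_mul, Module.End.mul_apply, epsD_mul, map_sub,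
      map_smul, smul_sub, mul_comm, mul_smul]
    abel
  refine ⟨piM q a, π, φ, pM q a, pullForm φ, Ct, Ct ∘ₗ bD.toLinearMap, correspondsTo_piM q a,
    ⟨fun b w => hφ ?_, fun y hy w => hφ ?_, ?_⟩, ⟨hπ, pM_piM, hφ, hker, hplus, hminus, pM_ea a⟩,
    nonSplit_piM q a, ⟨fun v w => conj_sM _ _, fun v hv => sM_self_pos (hp v) ?_⟩, ?_, ?_,
    ⟨fun b v w => ?_, fun y hy => ?_⟩, hCt, hC, hcoc, fun b c => ?_, fun y hy b => hφ ?_⟩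
  · exact (hbD b w).trans (hsmul _ _).symm
  · refine (hπ _ _).trans ((piM_iBt_mul hy _).trans ?_)
    rw [← hπ]
    exact (hsmul _ _).symm
  · refine eq_top_iff.2 fun w _ => ?_
    -- every vector is the sum of its components under the matrix units `ψ_m ∈ 𝓘_c`
    obtain ⟨F, hF⟩ := sum_piM_psiD (φ w)
    have h : ∑ m ∈ F, π (psiD q a m) w = w := hφ (by
      rw [map_sum, ← hF F subset_rfl]
      refine Finset.sum_congr rfl fun m _ => ?_
      exact hπ _ _)
    rw [← h]
    exact Submodule.sum_mem _ fun m _ => Submodule.subset_span ⟨psi q a m, psi_mem_Ic a m, w, rfl⟩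
  · exact fun h => hv (hφ (h.trans φ.map_zero.symm))
  · rw [pullForm_apply, hplus, sM_Tplus_smul_ea]
  · rw [pullForm_apply, hminus, sM_Tminus_smul_ea]
  · rw [pullForm_apply, pullForm_apply, hbD, hbD]
    exact sM_bU b (hp v) (hp w)
  · obtain ⟨hy', h⟩ := sM_yD hy
    refine ⟨hy', fun v w => ?_⟩
    rw [pullForm_apply, pullForm_apply, hπ, hπ, h]
  · change Ct (bD (b * c)) = π (bD b) (Ct (bD c)) + _ • Ct (bD b)
    rw [map_mul, hcoc, epsD_bD]
  · rw [hπ, hC, hC, piM_bD, piM_bD, piM_yD_bU]
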